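/- Let $J,K\in\mathbb{N}$. For $1\le k\le K$ let $a_k,b_k,\mu_k:\mathbb{R}_+\times\mathbb{R}_+^J\to\mathbb{R}_+$ and $\lambda_k:\mathbb{R}_+^J\to\mathbb{R}_+$ be Lipschitz functions with $a_k$ bounded, let $r_k\in[0,1]$, and let $\alpha_k$ be a probability law on $\mathbb{R}_+$ with $m_k=\int w\,\alpha_k(dw)<\infty$. Let $\mathcal{A}_k$ be Poisson point processes on $\mathbb{R}_+^3$ with intensity $\alpha_k(dw)\,dz\,dt$, and $\mathcal{N}_k,\mathcal{D}_k$ Poisson point processes on $\mathbb{R}_+^2$ with intensity $dz\,dt$, all forming an independent family. For $M\in\mathbb N$, $x\in\mathbb{R}^M$ and $v:\mathbb{R}_+\to\mathbb{R}^M$ write $\|x\|=\max_m|x_m|$ and $\|v\|_t=\sup_{0\le s\le t}\|v(s)\|$. Let $\mathcal{H}$ be a $\sigma$-algebra independent of the Poisson point processes (for instance $\mathcal H=\sigma(X_0,X_0')$ for a pair of initial values $(X_0,X_0')$ that is independent of them). For a continuous path $u:\mathbb{R}_+\to\mathbb{R}_+^J$ and an $\mathcal{H}$-measurable random variable $X_0$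 with values in $(\mathbb{R}_+\cup\{-1\})^K$, a solution of $(\mathcal{E}_u)$ started at $X_0$ is a càdlàg process $X=(X_k)_{1\le k\le K}$ with values in $(\mathbb{R}_+\cup\{-1\})^K$, adapted (up to null sets) to the filtration generated by $\mathcal{H}$ and the Poisson point processes, such that almost surely, for all $t\ge 0$ and $1\le k\le K$ (all integrals being absolutely convergent), \[ \begin{aligned} X_k(t)={}&X_{0,k}+\int_{(0,t]}\!\int \mathbf 1_{\{X_k(s-)=-1\}}(1+w)\mathbf 1_{\{0<z<\lambda_k(u(s))\}}\,\mathcal{A}_k(dw,dz,ds) +\int_0^t \mathbf 1_{\{X_k(s-)\ge0\}}\,a_k(X_k(s-),u(s))\,ds\\ &-\int_{(0,t]}\!\int \mathbf 1_{\{X_k(s-)\ge0\}}(1-r_k)X_k(s-)\mathbf 1_{\{0<z<b_k(X_k(s-),u(s))\}}\,\mathcal{N}_k(dz,ds)\\ &-\int_{(0,t]}\!\int \mathbf 1_{\{X_k(s-)\ge0\}}(1+X_k(s-))\mathbf 1_{\{0<z<\mu_k(X_k(s-),u(s))\}}\,\mathcal{D}_k(dz,ds). \end{aligned} \] Then such a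 solution exists for every such $u$ and $X_0$. Moreover there is a constant $A<\infty$, depending only on the functions $a_k,b_k,\lambda_k,\mu_k$ and the numbers $m_k$, $1\le k\le K$, such that for all continuous paths $u,u':\mathbb{R}_+\to\mathbb{R}_+^J$, all $\mathcal{H}$-measurable $(\mathbb{R}_+\cup\{-1\})^K$-valued $X_0,X_0'$, every solution $X=\phi(X_0,u)$ of $(\mathcal{E}_u)$ started at $X_0$, every solution $X'=\phi(X_0',u')$ of $(\mathcal{E}_{u'})$ started at $X_0'$, and every $t\ge 0$, almost surely \[ \mathbb{E}\bigl[\|X-X'\|_t\,\big|\,X_0,X_0'\bigr]\le\Bigl[\|X_0-X_0'\|+\int_0^t C(s)\,\|u-u'\|_s\,ds\Bigr]e^{tC(t)}, \qquad C(t)=A\bigl(1+t+\|u\|_t+\|X_0\|+\|X_0'\|\bigr). \] (The conditional expectation is that of a $[0,\infty]$-valued variable; no integrability of $X_0,X_0'$ is assumed. The case $u=u'$, $X_0=X_0'$ gives uniqueness of the solution up to indistinguishability.) -/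

import Mathlib

open MeasureTheory ProbabilityTheory Filter Topology Set
open scoped NNReal ENNReal

namespace OnOffNetwork

/-- Lebesgue measure on the half-line `[0, ∞)`. -/
noncomputable def leb : Measure ℝ≥0 := (volume : Measure ℝ).comap ((↑) : ℝ≥0 → ℝ)

/-- The running supremum `‖v‖_t = sup_{0 ≤ s ≤ t} ‖v(s)‖`, where `‖·‖` is the maximum norm
(the norm of the Pi type `Fin M → ℝ`); it takes the value `∞` if `v` is unbounded on `[0, t]`. -/
noncomputable def supNorm {M : ℕ} (v : ℝ≥0 → Fin M → ℝ) (t : ℝ≥0) : ℝ≥0∞ :=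
  ⨆ s ∈ Icc 0 t, ‖v s‖ₑ

/-- A path in `[0, ∞)^J`, seen as a path in `ℝ^J`. -/
def realPath {J : ℕ} (u : ℝ≥0 → Fin J → ℝ≥0) : ℝ≥0 → Fin J → ℝ := fun s j => (u s j : ℝ)

/-- The state space `[0, ∞) ∪ {-1}` of one user; `-1` is the OFF state. -/
def stateSpace : Set ℝ := {x | x = -1 ∨ 0 ≤ x}

/-- Right-continuity with left limits. -/
def IsCadlag (x : ℝ≥0 → ℝ) : Prop :=
  ∀ t, ContinuousWithinAt x (Ici t) t ∧ ∃ l, Tendsto x (𝓝[<] t) (𝓝 l)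

section Poisson

variable {Ω E : Type*} [MeasurableSpace Ω] [MeasurableSpace E]

/-- The random measure `N` is a Poisson point process with intensity measure `ν` under `P`. -/
structure IsPoissonPointProcess (N : Ω → Measure E) (ν : Measure E) (P : Measure Ω) : Prop where
  measurable : Measurable N
  integer_valued : ∀ᵐ ω ∂P, ∀ B, MeasurableSet B → ∃ n : ℕ∞, N ω B = n
  law : ∀ B, MeasurableSet B → ν B ≠ ∞ →
    P.map (fun ω => N ω B) = (poissonMeasure (ν B).toNNReal).map (fun n : ℕ => (n : ℝ≥0∞))
  indep : ∀ (n : ℕ) (B : Fin n → Set E), (∀ i, MeasurableSet (B i)) →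
    Pairwise (fun i j => Disjoint (B i) (B j)) → iIndepFun (fun i ω => N ω (B i)) P

end Poisson

/-- The functions `a_k, b_k, μ_k : [0,∞) × [0,∞)^J → [0,∞)` and `λ_k : [0,∞)^J → [0,∞)`. -/
structure Rates (K J : ℕ) where
  a : Fin K → ℝ≥0 → (Fin J → ℝ≥0) → ℝ≥0
  b : Fin K → ℝ≥0 → (Fin J → ℝ≥0) → ℝ≥0
  lam : Fin K → (Fin J → ℝ≥0) → ℝ≥0
  mu : Fin K → ℝ≥0 → (Fin J → ℝ≥0) → ℝ≥0

/-- `a_k` is bounded, and `a_k`, `b_k`, `λ_k`, `μ_k` are Lipschitz. -/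
structure Rates.IsRegular {K J : ℕ} (ρ : Rates K J) : Prop where
  a_bounded : ∀ k, ∃ M : ℝ≥0, ∀ w v, ρ.a k w v ≤ M
  a_lipschitz : ∀ k, ∃ L : ℝ≥0,
    LipschitzWith L (fun q : ℝ≥0 × (Fin J → ℝ≥0) => ρ.a k q.1 q.2)
  b_lipschitz : ∀ k, ∃ L : ℝ≥0,
    LipschitzWith L (fun q : ℝ≥0 × (Fin J → ℝ≥0) => ρ.b k q.1 q.2)
  lam_lipschitz : ∀ k, ∃ L : ℝ≥0, LipschitzWith L (ρ.lam k)
  mu_lipschitz : ∀ k, ∃ L : ℝ≥0,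
    LipschitzWith L (fun q : ℝ≥0 × (Fin J → ℝ≥0) => ρ.mu k q.1 q.2)

/-- The driving random measures. Points of `A k` are written `(w, z, s)` and points of
`N k` and `D k` are written `(z, s)`, where `s` is the time. -/
structure Noise (K : ℕ) (Ω : Type*) where
  A : Fin K → Ω → Measure (ℝ≥0 × ℝ≥0 × ℝ≥0)
  N : Fin K → Ω → Measure (ℝ≥0 × ℝ≥0)
  D : Fin K → Ω → Measure (ℝ≥0 × ℝ≥0)

namespace Noise

variable {K : ℕ} {Ω : Type*}

/-- The σ-algebras generated by the individual driving random measures. -/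
noncomputable abbrev sigmaFamily (η : Noise K Ω) : Fin K ⊕ Fin K ⊕ Fin K → MeasurableSpace Ω :=
  Sum.elim (fun k => MeasurableSpace.comap (η.A k) inferInstance)
    (Sum.elim (fun k => MeasurableSpace.comap (η.N k) inferInstance)
      (fun k => MeasurableSpace.comap (η.D k) inferInstance))

/-- The σ-algebra generated by all driving random measures. -/
noncomputable abbrev sigma (η : Noise K Ω) : MeasurableSpace Ω := ⨆ i, η.sigmaFamily i

/-- The σ-algebra generated by the driving random measures on the time interval `[0, t]`. -/
noncomputable abbrev sigmaUpTo (η : Noise K Ω) (t : ℝ≥0) : MeasurableSpace Ω :=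
  ⨆ k, (MeasurableSpace.comap (fun ω => (η.A k ω).restrict {p | p.2.2 ≤ t}) inferInstance ⊔
    MeasurableSpace.comap (fun ω => (η.N k ω).restrict {p | p.2 ≤ t}) inferInstance ⊔
    MeasurableSpace.comap (fun ω => (η.D k ω).restrict {p | p.2 ≤ t}) inferInstance)

/-- The `A k` are Poisson point processes with intensity `α_k(dw) dz ds`, the `N k` and `D k` are
Poisson point processes with intensity `dz ds`, and all of them form an independent family. -/
structure IsPoisson [MeasurableSpace Ω] (η : Noise K Ω) (α : Fin K → Measure ℝ≥0)
    (P : Measure Ω) : Prop where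
  poisson_A : ∀ k, IsPoissonPointProcess (η.A k) ((α k).prod (leb.prod leb)) P
  poisson_N : ∀ k, IsPoissonPointProcess (η.N k) (leb.prod leb) P
  poisson_D : ∀ k, IsPoissonPointProcess (η.D k) (leb.prod leb) P
  indep : iIndep η.sigmaFamily P

end Noise

section Equation

variable {K J : ℕ}

/-- `1{x(s-) ≥ 0} a_k(x(s-), u(s))`. -/
noncomputable def drift (ρ : Rates K J) (u : ℝ≥0 → Fin J → ℝ≥0) (k : Fin K) (x : ℝ≥0 → ℝ)
    (s : ℝ≥0) : ℝ :=
  if 0 ≤ Function.leftLim x s then (ρ.a k (Function.leftLim x s).toNNReal (u s) : ℝ) else 0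

/-- `1{x(s-) = -1} (1 + w) 1{0 < z < λ_k(u(s))}` at the point `(w, z, s)`. -/
noncomputable def onJump (ρ : Rates K J) (u : ℝ≥0 → Fin J → ℝ≥0) (k : Fin K) (x : ℝ≥0 → ℝ)
    (p : ℝ≥0 × ℝ≥0 × ℝ≥0) : ℝ :=
  if Function.leftLim x p.2.2 = -1 ∧ 0 < p.2.1 ∧ p.2.1 < ρ.lam k (u p.2.2) then 1 + (p.1 : ℝ)
  else 0

/-- `1{x(s-) ≥ 0} (1 - r_k) x(s-) 1{0 < z < b_k(x(s-), u(s))}` at the point `(z, s)`. -/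
noncomputable def lossJump (ρ : Rates K J) (r : Fin K → ℝ) (u : ℝ≥0 → Fin J → ℝ≥0) (k : Fin K)
    (x : ℝ≥0 → ℝ) (p : ℝ≥0 × ℝ≥0) : ℝ :=
  if 0 ≤ Function.leftLim x p.2 ∧ 0 < p.1 ∧
      p.1 < ρ.b k (Function.leftLim x p.2).toNNReal (u p.2) then
    (1 - r k) * Function.leftLim x p.2
  else 0

/-- `1{x(s-) ≥ 0} (1 + x(s-)) 1{0 < z < μ_k(x(s-), u(s))}` at the point `(z, s)`. -/
noncomputable def offJump (ρ : Rates K J) (u : ℝ≥0 → Fin J → ℝ≥0) (k : Fin K)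
    (x : ℝ≥0 → ℝ) (p : ℝ≥0 × ℝ≥0) : ℝ :=
  if 0 ≤ Function.leftLim x p.2 ∧ 0 < p.1 ∧
      p.1 < ρ.mu k (Function.leftLim x p.2).toNNReal (u p.2) then
    1 + Function.leftLim x p.2
  else 0

/-- The process `X` solves the stochastic differential equation with parameter path `u`, driven by
`η` and started at `X₀`. The σ-algebra `H` is the information available at time `0`: the process
is adapted, up to null sets, to the filtration generated by `H` and the noise. -/
structure IsSolution {Ω : Type*} (H : MeasurableSpace Ω) [mΩ : MeasurableSpace Ω]
    (P : Measure Ω) (ρ : Rates K J) (r : Fin K → ℝ) (η : Noise K Ω) (u : ℝ≥0 → Fin J → ℝ≥0)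
    (X₀ : Ω → Fin K → ℝ) (X : ℝ≥0 → Ω → Fin K → ℝ) : Prop where
  measurable : ∀ t, Measurable[mΩ] (X t)
  adapted : ∀ t, AEStronglyMeasurable[H ⊔ η.sigmaUpTo t] (X t) P
  state : ∀ᵐ ω ∂P, ∀ t k, X t ω k ∈ stateSpace
  cadlag : ∀ᵐ ω ∂P, ∀ k, IsCadlag (fun t => X t ω k)
  integrable : ∀ᵐ ω ∂P, ∀ t k,
    IntegrableOn (drift ρ u k (fun s => X s ω k)) (Ioc 0 t) leb ∧
    IntegrableOn (onJump ρ u k (fun s => X s ω k)) {p | p.2.2 ∈ Ioc 0 t} (η.A k ω) ∧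
    IntegrableOn (lossJump ρ r u k (fun s => X s ω k)) {p | p.2 ∈ Ioc 0 t} (η.N k ω) ∧
    IntegrableOn (offJump ρ u k (fun s => X s ω k)) {p | p.2 ∈ Ioc 0 t} (η.D k ω)
  equation : ∀ᵐ ω ∂P, ∀ t k,
    X t ω k = X₀ ω k
      + ∫ p in {p | p.2.2 ∈ Ioc 0 t}, onJump ρ u k (fun s => X s ω k) p ∂(η.A k ω)
      + ∫ s in Ioc 0 t, drift ρ u k (fun s => X s ω k) s ∂leb
      - ∫ p in {p | p.2 ∈ Ioc 0 t}, lossJump ρ r u k (fun s => X s ω k) p ∂(η.N k ω)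
      - ∫ p in {p | p.2 ∈ Ioc 0 t}, offJump ρ u k (fun s => X s ω k) p ∂(η.D k ω)

/-- `C(t) = A (1 + t + ‖u‖_t + ‖x‖ + ‖x'‖)`. -/
noncomputable def rateC (A : ℝ≥0) (u : ℝ≥0 → Fin J → ℝ≥0) (x x' : Fin K → ℝ) (t : ℝ≥0) : ℝ :=
  A * (1 + t + (supNorm (realPath u) t).toReal + ‖x‖ + ‖x'‖)

end Equation

end OnOffNetwork

/-!
The parameter path `u` is given, so the users do not influence each other, and each of them can be
treated on its own. The three driving measures of one user are collected in a single measure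
`Noise.points` on the space `Pt` of kinds, marks, heights and times. Two facts about it carry the
proof. Its intensity is its compensator (`hasCompensator`): since the past and the future of a
Poisson point process are independent, the integral of a nonnegative predictable function against
the points and the one against the intensity have the same expectation
(`HasCompensator.lintegral_eq`). And almost surely it is separated (`ae_isSeparated`): among the
points of bounded height and time, a sufficiently fine dyadic subdivision of the time axis isolates
each point from the others. The equation can then be studied path by path (`PathSol`).

*Existence.* Without jumps a user follows the flow of the drift (`driftFlow`). The total mass of
all connections that could ever be accepted until time `N` is finite, which bounds the states and
hence the heights of the relevant points, so that a fine enough dyadic cell contains at most one of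
them. In such a cell the evolution is explicit (`step`): drift, jump, drift. The steps can be
composed inside a cell, so that the scheme which makes one step per cell does not change until time
`N` under further refinement, and its limit solves the equation (`exists_pathSol`). For each mesh
the scheme is adapted (`measurable_scheme_cutoff`); its upper limit is therefore an adapted
solution (`exists_adapted_pathSol`).

*Estimate.* A jump may be as large as the state, and `α` has only a first moment, so Grönwall's
inequality does not apply to the distance of the two solutions directly. Instead, call two states
coupled if both are ON or both are OFF. Points that act on both of two coupled states, or on
neither of them, do not increase their distance (`Coupled.add_incr`). As long as no point acts on
exactly one of them, the distance therefore grows by the drift alone and is at most `gapBound`, the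
explicit bound from Grönwall's inequality (`PathSol.driftCoupled_of_forall_not_decouples`). A point
that acts on exactly one of two coupled states at distance at most `gapBound` is a decoupling
point. By the Lipschitz continuity of the rates, the rate of decoupling points at each time is at
most `3 L` times the sum of `gapBound` and the distance of the parameters
(`lintegral_decoupling_le`). After a decoupling the distance is bounded by the larger state, and
thus by the state at that point, the drift and the later connections (`PathSol.ofReal_abs_sub_le`).
The random ones among these terms are integrals of predictable functions against the points, so the
compensation formula turns them into the bound `distBound` (`exists_abs_sub_le_add`), and
elementary inequalities turn that bound into the asserted one (`add_mul_bound_le`). Because a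
compensator remains a compensator when the law is restricted to an event known at time `0`
(`HasCompensator.restrict`), the estimate holds on each event generated by the initial values,
which is the estimate for the conditional expectation.
-/

set_option linter.unusedSectionVars false

namespace OnOffNetwork

/-! ### Integer-valued measures -/

section IntegerValued

variable {E : Type*} [MeasurableSpace E]

/-- A measure all of whose values on measurable sets are in `{0, 1, 2, …, ∞}`. -/
def IsIntegerValued (q : Measure E) : Prop := ∀ B, MeasurableSet B → ∃ n : ℕ∞, q B = n

lemma IsIntegerValued.restrict {q : Measure E} (hq : IsIntegerValued q) {W : Set E}
    (hW : MeasurableSet W) : IsIntegerValued (q.restrict W) := fun B hB => by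
  rw [Measure.restrict_apply hB]; exact hq _ (hB.inter hW)

lemma IsIntegerValued.map {E' : Type*} [MeasurableSpace E'] {q : Measure E}
    (hq : IsIntegerValued q) {f : E → E'} (hf : Measurable f) : IsIntegerValued (q.map f) :=
  fun B hB => by rw [Measure.map_apply hf hB]; exact hq _ (hf hB)

lemma IsIntegerValued.add {q q' : Measure E} (hq : IsIntegerValued q) (hq' : IsIntegerValued q') :
    IsIntegerValued (q + q') := fun B hB => by
  obtain ⟨n, hn⟩ := hq B hB
  obtain ⟨m, hm⟩ := hq' B hB
  exact ⟨n + m, by simp [hn, hm]⟩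

lemma IsIntegerValued.eq_zero_of_lt_one {q : Measure E} (hq : IsIntegerValued q) {B : Set E}
    (hB : MeasurableSet B) (h : q B < 1) : q B = 0 := by
  obtain ⟨n, hn⟩ := hq B hB
  rw [hn] at h ⊢
  have : n < 1 := by exact_mod_cast h
  simpa using Order.lt_one_iff.1 this

lemma IsIntegerValued.eq_zero_or_eq_dirac [StandardBorelSpace E] {q : Measure E}
    (hq : IsIntegerValued q) (h : q univ ≤ 1) : q = 0 ∨ ∃ p, q = Measure.dirac p := by
  by_cases h0 : q = 0
  · exact Or.inl h0
  · right
    have : NeZero q := ⟨h0⟩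
    have : IsZeroOneMeasure q := ⟨fun B hB => by
      rcases lt_or_ge (q B) 1 with hB1 | hB1
      · exact Or.inl (hq.eq_zero_of_lt_one hB hB1)
      · exact Or.inr (le_antisymm ((measure_mono (subset_univ _)).trans h) hB1)⟩
    exact IsZeroOneMeasure.exists_eq_dirac

end IntegerValued

/-! ### Kernels of locally finite measures -/

section Kernels

variable {Ω E : Type*} {mΩ : MeasurableSpace Ω} {mE : MeasurableSpace E}

/-- The masses of the measures need not be uniformly bounded. -/
lemma isSFiniteKernel_of_isFiniteMeasure (κ : Kernel Ω E) (h : ∀ a, IsFiniteMeasure (κ a)) :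
    IsSFiniteKernel κ := by
  classical
  have hS : ∀ n : ℕ, MeasurableSet {a | κ a univ ∈ Ico (n : ℝ≥0∞) (n + 1)} := fun n =>
    (κ.measurable_coe MeasurableSet.univ) measurableSet_Ico
  let κs : ℕ → Kernel Ω E := fun n => Kernel.piecewise (hS n) κ 0
  have hfin : ∀ n, IsFiniteKernel (κs n) := fun n => by
    refine ⟨⟨n + 1, by simp, fun a => ?_⟩⟩
    simp only [κs, Kernel.piecewise_apply]
    split_ifs with ha
    · exact ha.2.le
    · simp
  have hsum : κ = Kernel.sum κs := by
    ext a s hs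
    rw [Kernel.sum_apply' _ _ hs]
    -- exactly one level contains the total mass
    have hlt : κ a univ ≠ ∞ := measure_ne_top _ _
    set n := ⌊(κ a univ).toNNReal⌋₊ with hn
    have hmem : ∀ m : ℕ, κ a univ ∈ Ico (m : ℝ≥0∞) (m + 1) ↔ m = n := fun m => by
      have e : κ a univ = ((κ a univ).toNNReal : ℝ≥0∞) := (ENNReal.coe_toNNReal hlt).symm
      rw [hn, eq_comm, Nat.floor_eq_iff (zero_le), e]
      simp only [mem_Ico, ENNReal.toNNReal_coe]
      norm_cast
    rw [tsum_eq_single n]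
    · have := (hmem n).2 rfl
      simp only [κs, Kernel.piecewise_apply, mem_ofPred_eq]
      rw [if_pos this]
    · intro m hm
      have := mt (hmem m).1 hm
      simp only [κs, Kernel.piecewise_apply, mem_ofPred_eq]
      rw [if_neg this]; simp
  rw [hsum]
  exact Kernel.isSFiniteKernel_sum

/-- The measures of the kernel may be infinite, but a single sequence of sets exhausts the space by
sets of finite mass for all of them. -/
lemma isSFiniteKernel_of_cover (κ : Kernel Ω E) (B : ℕ → Set E) (hB : ∀ n, MeasurableSet (B n))
    (hcov : ⋃ n, B n = univ) (h : ∀ a n, κ a (B n) < ∞) : IsSFiniteKernel κ := by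
  have hD : ∀ n, MeasurableSet (disjointed B n) := fun n => .disjointed hB n
  have : ∀ n, IsSFiniteKernel (Kernel.restrict κ (hD n)) := fun n =>
    isSFiniteKernel_of_isFiniteMeasure _ fun a => ⟨by
      rw [Kernel.restrict_apply, Measure.restrict_apply_univ]
      exact (measure_mono (disjointed_subset B n)).trans_lt (h a n)⟩
  have hsum : κ = Kernel.sum fun n => Kernel.restrict κ (hD n) := by
    ext a s hs
    rw [Kernel.sum_apply' _ _ hs]
    simp_rw [Kernel.restrict_apply' _ _ _ hs]
    rw [← measure_iUnion]
    · rw [← inter_iUnion, iUnion_disjointed, hcov, inter_univ]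
    · exact fun i j hij => (disjoint_disjointed B hij).mono inter_subset_right inter_subset_right
    · exact fun n => hs.inter (hD n)
  rw [hsum]
  exact Kernel.isSFiniteKernel_sum

end Kernels

/-! ### The compensation formula -/

section Compensation

variable {Ω E : Type*} [mΩ : MeasurableSpace Ω] [mE : MeasurableSpace E]

/-- The points that come after time `s`; every point comes after time `0`. -/
def after (T : E → ℝ≥0) (s : ℝ≥0) : Set E := {p | s = 0 ∨ s < T p}

/-- The predictable σ-algebra on `Ω × E` for a filtration `F` and a time function `T` on the
space `E` of points. -/
abbrev predSigma (F : ℝ≥0 → MeasurableSpace Ω) (T : E → ℝ≥0) : MeasurableSpace (Ω × E) :=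
  MeasurableSpace.generateFrom {S | ∃ (s : ℝ≥0) (G : Set Ω) (B : Set E),
    MeasurableSet[F s] G ∧ MeasurableSet B ∧ S = G ×ˢ (B ∩ after T s)}

/-- The random measure `Q` is adapted to `F` and its compensator is the deterministic measure `ν`;
the sets `box n` exhaust the space by sets of finite `ν`-measure. -/
structure HasCompensator (F : ℝ≥0 → MeasurableSpace Ω) (T : E → ℝ≥0) (box : ℕ → Set E)
    (Q : Ω → Measure E) (ν : Measure E) (P : Measure Ω) : Prop where
  mono : Monotone F
  le : ∀ t, F t ≤ mΩ
  measurable_time : Measurable T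
  measurableSet_box : ∀ n, MeasurableSet (box n)
  monotone_box : Monotone box
  iUnion_box : ⋃ n, box n = univ
  measure_box : ∀ n, ν (box n) < ∞
  measurable : Measurable Q
  adapted : ∀ t, Measurable[F t] fun ω => (Q ω).restrict {p | T p ≤ t}
  comp : ∀ s G B, MeasurableSet[F s] G → MeasurableSet B → B ⊆ after T s → ν B ≠ ∞ →
    ∫⁻ ω in G, Q ω B ∂P = P G * ν B

lemma measurableSet_after {T : E → ℝ≥0} (hT : Measurable T) (s : ℝ≥0) :
    MeasurableSet (after T s) :=
  MeasurableSet.union (MeasurableSet.const (s = 0))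
    (measurableSet_lt measurable_const hT : MeasurableSet {p | s < T p})

lemma after_anti (T : E → ℝ≥0) {s t : ℝ≥0} (h : s ≤ t) : after T t ⊆ after T s := by
  rintro p (rfl | hp)
  · exact Or.inl (le_antisymm h bot_le)
  · exact Or.inr (h.trans_lt hp)

lemma isPiSystem_pred {F : ℝ≥0 → MeasurableSpace Ω} (hF : Monotone F) (T : E → ℝ≥0) :
    IsPiSystem {S : Set (Ω × E) | ∃ (s : ℝ≥0) (G : Set Ω) (B : Set E),
      MeasurableSet[F s] G ∧ MeasurableSet B ∧ S = G ×ˢ (B ∩ after T s)} := by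
  rintro _ ⟨s, G, B, hG, hB, rfl⟩ _ ⟨s', G', B', hG', hB', rfl⟩ -
  refine ⟨max s s', G ∩ G', B ∩ B', ?_, hB.inter hB', ?_⟩
  · exact MeasurableSet.inter (hF (le_max_left _ _) _ hG) (hF (le_max_right _ _) _ hG')
  · have : after T (max s s') = after T s ∩ after T s' := by
      rcases le_total s s' with h | h
      · rw [max_eq_right h, inter_eq_right.2 (after_anti T h)]
      · rw [max_eq_left h, inter_eq_left.2 (after_anti T h)]
    rw [this, prod_inter_prod]
    congr 1
    ext; simp only [mem_inter_iff]; tauto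

lemma predSigma_le {F : ℝ≥0 → MeasurableSpace Ω} (hF : ∀ t, F t ≤ mΩ) {T : E → ℝ≥0}
    (hT : Measurable T) : predSigma F T ≤ (inferInstance : MeasurableSpace (Ω × E)) := by
  refine MeasurableSpace.generateFrom_le ?_
  rintro _ ⟨s, G, B, hG, hB, rfl⟩
  exact (hF s _ hG).prod (hB.inter (measurableSet_after hT s))

lemma measurable_snd_predSigma (F : ℝ≥0 → MeasurableSpace Ω) (T : E → ℝ≥0) :
    Measurable[predSigma F T] (Prod.snd : Ω × E → E) := by
  intro B hB
  refine MeasurableSpace.measurableSet_generateFrom ⟨0, univ, B, MeasurableSet.univ, hB, ?_⟩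
  ext; simp [after]

lemma measurable_comp_fst_predSigma {β : Type*} [MeasurableSpace β] {F : ℝ≥0 → MeasurableSpace Ω}
    (T : E → ℝ≥0) {h : Ω → β} (hh : Measurable[F 0] h) :
    Measurable[predSigma F T] (fun x : Ω × E => h x.1) := by
  intro B hB
  refine MeasurableSpace.measurableSet_generateFrom ⟨0, h ⁻¹' B, univ, hh hB, .univ, ?_⟩
  ext; simp [after]

/-- Before time `t`, a predictable function only uses the information available at time `t`. -/
lemma measurable_indicator_predSigma {F : ℝ≥0 → MeasurableSpace Ω} (hF : Monotone F) {T : E → ℝ≥0}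
    (hT : Measurable T) {f : Ω × E → ℝ≥0∞} (hf : Measurable[predSigma F T] f) (t : ℝ≥0) :
    Measurable[@Prod.instMeasurableSpace Ω E (F t) mE]
      (fun x : Ω × E => {p | T p ≤ t}.indicator (fun p => f (x.1, p)) x.2) := by
  let m := @Prod.instMeasurableSpace Ω E (F t) mE
  have hTt : MeasurableSet {p | T p ≤ t} := measurableSet_le hT measurable_const
  have hC : MeasurableSet[m] (Prod.snd ⁻¹' {p | T p ≤ t} : Set (Ω × E)) :=
    (@measurable_snd Ω E (F t) mE) hTt
  have key : ∀ S, MeasurableSet[predSigma F T] S →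
      MeasurableSet[m] (S ∩ Prod.snd ⁻¹' {p | T p ≤ t}) := by
    intro S hS
    induction S, hS using MeasurableSpace.generateFrom_induction with
    | hC S hS =>
      obtain ⟨s, G, B, hG, hB, rfl⟩ := hS
      rcases le_or_gt s t with hst | hst
      · exact MeasurableSet.inter (@MeasurableSet.prod Ω E (F t) mE _ _ (hF hst _ hG)
          (hB.inter (measurableSet_after hT s))) hC
      · have : G ×ˢ (B ∩ after T s) ∩ Prod.snd ⁻¹' {p | T p ≤ t} = ∅ := by
          ext x
          simp only [mem_inter_iff, mem_prod, after, mem_ofPred_eq, mem_preimage,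
            mem_empty_iff_false, iff_false, not_and, not_le, and_imp]
          rintro - - (rfl | h)
          · exact absurd hst (not_lt.2 bot_le)
          · exact hst.trans h
        rw [this]; exact MeasurableSet.empty
    | empty => simp
    | compl S _ ih =>
      have : Sᶜ ∩ Prod.snd ⁻¹' {p | T p ≤ t} =
          Prod.snd ⁻¹' {p | T p ≤ t} \ (S ∩ Prod.snd ⁻¹' {p | T p ≤ t}) := by
        ext; simp only [mem_inter_iff, mem_compl_iff, Set.mem_sdiff]; tauto
      rw [this]; exact MeasurableSet.diff hC ih
    | iUnion S _ ih => rw [iUnion_inter]; exact MeasurableSet.iUnion ih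
  intro B hB
  have hfB := key _ (hf hB)
  by_cases h0 : (0 : ℝ≥0∞) ∈ B
  · have : (fun x : Ω × E => {p | T p ≤ t}.indicator (fun p => f (x.1, p)) x.2) ⁻¹' B =
        (f ⁻¹' B ∩ Prod.snd ⁻¹' {p | T p ≤ t}) ∪ (Prod.snd ⁻¹' {p | T p ≤ t})ᶜ := by
      ext x; by_cases hx : T x.2 ≤ t <;> simp [hx, h0, indicator]
    rw [this]; exact MeasurableSet.union hfB (MeasurableSet.compl hC)
  · have : (fun x : Ω × E => {p | T p ≤ t}.indicator (fun p => f (x.1, p)) x.2) ⁻¹' B =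
        (f ⁻¹' B ∩ Prod.snd ⁻¹' {p | T p ≤ t}) := by
      ext x; by_cases hx : T x.2 ≤ t <;> simp [hx, h0, indicator]
    rw [this]; exact hfB

open Classical in
/-- The restriction of `Q` to the points up to time `t`, replaced by `0` where it is not finite on
all the boxes. -/
noncomputable def cutoff (T : E → ℝ≥0) (box : ℕ → Set E) (Q : Ω → Measure E) (t : ℝ≥0) (ω : Ω) :
    Measure E :=
  if ∀ n, (Q ω).restrict {p | T p ≤ t} (box n) < ∞ then (Q ω).restrict {p | T p ≤ t} else 0

lemma cutoff_box_lt_top (T : E → ℝ≥0) (box : ℕ → Set E) (Q : Ω → Measure E) (t : ℝ≥0) (ω : Ω)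
    (n : ℕ) : cutoff T box Q t ω (box n) < ∞ := by
  unfold cutoff; split_ifs with h
  · exact h n
  · simp

lemma cutoff_eq {T : E → ℝ≥0} {box : ℕ → Set E} {Q : Ω → Measure E} {ω : Ω}
    (h : ∀ n, Q ω (box n) < ∞) (t : ℝ≥0) : cutoff T box Q t ω = (Q ω).restrict {p | T p ≤ t} :=
  if_pos fun n => (Measure.restrict_apply_le _ _).trans_lt (h n)

namespace HasCompensator

variable {F : ℝ≥0 → MeasurableSpace Ω} {T : E → ℝ≥0} {box : ℕ → Set E} {Q : Ω → Measure E}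
  {ν : Measure E} {P : Measure Ω}

lemma measurable_cutoff (h : HasCompensator F T box Q ν P) (t : ℝ≥0) :
    Measurable[F t] (cutoff T box Q t) := by
  classical
  unfold cutoff
  refine Measurable.ite ?_ (h.adapted t) measurable_const
  have : {ω | ∀ n, (Q ω).restrict {p | T p ≤ t} (box n) < ∞} =
      ⋂ n, {ω | (Q ω).restrict {p | T p ≤ t} (box n) < ∞} := by ext; simp
  rw [this]
  exact MeasurableSet.iInter fun n =>
    ((Measure.measurable_coe (h.measurableSet_box n)).comp (h.adapted t)) measurableSet_Iio

/-- `cutoff` as a kernel from `(Ω, F t)`. -/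
noncomputable def cutoffKernel (h : HasCompensator F T box Q ν P) (t : ℝ≥0) :
    @Kernel Ω E (F t) mE :=
  @Kernel.mk Ω E (F t) mE (cutoff T box Q t) (h.measurable_cutoff t)

lemma isSFiniteKernel_cutoffKernel (h : HasCompensator F T box Q ν P) (t : ℝ≥0) :
    @IsSFiniteKernel Ω E (F t) mE (h.cutoffKernel t) :=
  @isSFiniteKernel_of_cover Ω E (F t) mE (h.cutoffKernel t) box h.measurableSet_box h.iUnion_box
    fun ω n => cutoff_box_lt_top T box Q t ω n

lemma measurable_lintegral_cutoff (h : HasCompensator F T box Q ν P) {f : Ω × E → ℝ≥0∞} {t : ℝ≥0}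
    (hf : Measurable[@Prod.instMeasurableSpace Ω E (F t) mE] f) :
    Measurable[F t] fun ω => ∫⁻ p, f (ω, p) ∂cutoff T box Q t ω := by
  have := h.isSFiniteKernel_cutoffKernel t
  exact @Measurable.lintegral_kernel_prod_right' Ω E (F t) mE (h.cutoffKernel t) this f hf

lemma stronglyMeasurable_integral_cutoff (h : HasCompensator F T box Q ν P) {f : Ω → E → ℝ}
    {t : ℝ≥0} (hf : StronglyMeasurable[@Prod.instMeasurableSpace Ω E (F t) mE]
      (Function.uncurry f)) :
    StronglyMeasurable[F t] fun ω => ∫ p, f ω p ∂cutoff T box Q t ω := by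
  have := h.isSFiniteKernel_cutoffKernel t
  exact @StronglyMeasurable.integral_kernel_prod_right Ω E (F t) mE (h.cutoffKernel t) ℝ _ this _
    f hf

/-- The integral of a predictable function over the points up to time `t` is known at time `t`. -/
lemma measurable_lintegral_cutoff_of_pred (h : HasCompensator F T box Q ν P) {f : Ω × E → ℝ≥0∞}
    (hf : Measurable[predSigma F T] f) (t : ℝ≥0) :
    Measurable[F t] fun ω => ∫⁻ p, f (ω, p) ∂cutoff T box Q t ω := by
  have h1 := h.measurable_lintegral_cutoff
    (measurable_indicator_predSigma h.mono h.measurable_time hf t)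
  have hTt : MeasurableSet {p | T p ≤ t} := measurableSet_le h.measurable_time measurable_const
  convert h1 using 2 with ω
  unfold cutoff
  split_ifs
  · exact (setLIntegral_congr_fun hTt fun p hp => by
      rw [indicator_of_mem (show p ∈ {p | T p ≤ t} from hp)])
  · simp

lemma ae_box_lt_top (h : HasCompensator F T box Q ν P) [IsFiniteMeasure P] :
    ∀ᵐ ω ∂P, ∀ n, Q ω (box n) < ∞ := by
  rw [ae_all_iff]
  intro n
  refine ae_lt_top ((Measure.measurable_coe (h.measurableSet_box n)).comp h.measurable) ?_
  have := h.comp 0 univ (box n) MeasurableSet.univ (h.measurableSet_box n)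
    (fun p _ => Or.inl rfl) (h.measure_box n).ne
  rw [setLIntegral_univ] at this
  rw [this]
  exact ENNReal.mul_ne_top (measure_ne_top _ _) (h.measure_box n).ne

open Classical in
/-- `Q` on the `n`-th box, made finite everywhere. -/
noncomputable def boxKernel (h : HasCompensator F T box Q ν P) (n : ℕ) : Kernel Ω E where
  toFun ω := if Q ω (box n) < ∞ then (Q ω).restrict (box n) else 0
  measurable' := by
    refine Measurable.ite (measurableSet_lt ((Measure.measurable_coe
      (h.measurableSet_box n)).comp h.measurable) measurable_const) ?_ measurable_const
    exact (Measure.measurable_of_measurable_coe _ fun s hs => by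
      simp_rw [Measure.restrict_apply hs]
      exact (Measure.measurable_coe (hs.inter (h.measurableSet_box n))).comp h.measurable)

lemma boxKernel_apply (h : HasCompensator F T box Q ν P) {n : ℕ} {ω : Ω} (hω : Q ω (box n) < ∞) :
    h.boxKernel n ω = (Q ω).restrict (box n) := if_pos hω

instance isSFiniteKernel_boxKernel (h : HasCompensator F T box Q ν P) (n : ℕ) :
    IsSFiniteKernel (h.boxKernel n) := by
  refine isSFiniteKernel_of_isFiniteMeasure _ fun ω => ⟨?_⟩
  by_cases hω : Q ω (box n) < ∞
  · rw [boxKernel_apply h hω, Measure.restrict_apply_univ]; exact hω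
  · have : h.boxKernel n ω = 0 := if_neg hω
    simp [this]

/-- The compensation formula on one box. Both sides are integrals against finite measures on the
predictable σ-algebra, which agree on the rectangles that generate it. -/
lemma lintegral_boxKernel (h : HasCompensator F T box Q ν P) [IsFiniteMeasure P] (n : ℕ)
    {f : Ω × E → ℝ≥0∞} (hf : Measurable[predSigma F T] f) :
    ∫⁻ ω, ∫⁻ p, f (ω, p) ∂h.boxKernel n ω ∂P = ∫⁻ ω, ∫⁻ p in box n, f (ω, p) ∂ν ∂P := by
  have hle := predSigma_le (E := E) h.le h.measurable_time
  have hfm : Measurable f := hf.mono hle le_rfl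
  have hfin : IsFiniteMeasure (ν.restrict (box n)) :=
    ⟨by rw [Measure.restrict_apply_univ]; exact h.measure_box n⟩
  have hrect : ∀ s G B, MeasurableSet[F s] G → MeasurableSet B →
      (P ⊗ₘ h.boxKernel n) (G ×ˢ (B ∩ after T s)) =
        (P.prod (ν.restrict (box n))) (G ×ˢ (B ∩ after T s)) := by
    intro s G B hG hB
    have hBa := hB.inter (measurableSet_after h.measurable_time s)
    rw [Measure.compProd_apply_prod (h.le s _ hG) hBa, Measure.prod_prod,
      Measure.restrict_apply hBa]
    rw [← h.comp s G (B ∩ after T s ∩ box n) hG (hBa.inter (h.measurableSet_box n))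
      (fun p hp => hp.1.2) ((measure_mono inter_subset_right).trans_lt (h.measure_box n)).ne]
    refine lintegral_congr_ae (ae_restrict_of_ae ?_)
    filter_upwards [h.ae_box_lt_top] with ω hω
    rw [boxKernel_apply h (hω n), Measure.restrict_apply hBa]
  have huniv : (P ⊗ₘ h.boxKernel n) univ = (P.prod (ν.restrict (box n))) univ := by
    have := hrect 0 univ univ MeasurableSet.univ MeasurableSet.univ
    -- `after T 0` is the whole space: points at time `0` are included
    have e : (univ : Set Ω) ×ˢ ((univ : Set E) ∩ after T 0) = univ := by ext; simp [after]
    rwa [e] at this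
  have htrim : (P ⊗ₘ h.boxKernel n).trim hle = (P.prod (ν.restrict (box n))).trim hle := by
    have : IsFiniteMeasure (P ⊗ₘ h.boxKernel n) := ⟨by rw [huniv]; exact measure_lt_top _ _⟩
    refine @ext_of_generate_finite _ (predSigma F T) _ _ _ rfl (isPiSystem_pred h.mono T)
      (isFiniteMeasure_trim hle) ?_ ?_
    · rintro S ⟨s, G, B, hG, hB, rfl⟩
      rw [trim_measurableSet_eq hle, trim_measurableSet_eq hle, hrect s G B hG hB]
      all_goals exact MeasurableSpace.measurableSet_generateFrom ⟨s, G, B, hG, hB, rfl⟩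
    · rw [trim_measurableSet_eq hle, trim_measurableSet_eq hle, huniv]
      all_goals exact MeasurableSet.univ
  rw [← Measure.lintegral_compProd hfm, ← lintegral_prod _ hfm.aemeasurable,
    ← lintegral_trim hle hf, htrim, lintegral_trim hle hf]

/-- The integral of a nonnegative predictable function against `Q` has the same expectation as its
integral against the compensator. -/
theorem lintegral_eq (h : HasCompensator F T box Q ν P) [IsFiniteMeasure P]
    {f : Ω × E → ℝ≥0∞} (hf : Measurable[predSigma F T] f) :
    ∫⁻ ω, ∫⁻ p, f (ω, p) ∂Q ω ∂P = ∫⁻ ω, ∫⁻ p, f (ω, p) ∂ν ∂P := by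
  have hle := predSigma_le (E := E) h.le h.measurable_time
  have hfm : Measurable f := hf.mono hle le_rfl
  have hsec : ∀ ω, Measurable fun p => f (ω, p) := fun ω => hfm.comp measurable_prodMk_left
  have hsup : ∀ (μ : Measure E) ω, ∫⁻ p, f (ω, p) ∂μ = ⨆ n, ∫⁻ p in box n, f (ω, p) ∂μ :=
    fun μ ω => by
      rw [← setLIntegral_univ, ← h.iUnion_box]
      exact setLIntegral_iUnion_of_directed _ (directed_of_isDirected_le h.monotone_box)
  have hmono : ∀ (μ : Measure E) ω, Monotone fun n => ∫⁻ p in box n, f (ω, p) ∂μ :=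
    fun μ ω n k hnk => lintegral_mono_set (h.monotone_box hnk)
  have hfin : ∀ n, IsFiniteMeasure (ν.restrict (box n)) := fun n =>
    ⟨by rw [Measure.restrict_apply_univ]; exact h.measure_box n⟩
  have e1 : ∀ n, ∀ᵐ ω ∂P, ∫⁻ p in box n, f (ω, p) ∂Q ω = ∫⁻ p, f (ω, p) ∂h.boxKernel n ω :=
    fun n => by
      filter_upwards [h.ae_box_lt_top] with ω hω
      rw [boxKernel_apply h (hω n)]
  rw [lintegral_congr fun ω => hsup (Q ω) ω, lintegral_congr fun ω => hsup ν ω]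
  rw [lintegral_iSup' (fun n => ?_) (Eventually.of_forall fun ω => hmono _ ω),
    lintegral_iSup' (fun n => ?_) (Eventually.of_forall fun ω => hmono _ ω)]
  · congr 1; ext n
    rw [lintegral_congr_ae (e1 n), h.lintegral_boxKernel n hf]
  · exact (Measurable.lintegral_prod_right' hfm).aemeasurable
  · exact ⟨_, Measurable.lintegral_kernel_prod_right' (κ := h.boxKernel n) hfm, e1 n⟩

/-- The compensation formula over a time interval. -/
lemma lintegral_setLIntegral_eq (h : HasCompensator F T box Q ν P) [IsFiniteMeasure P]
    {f : Ω × E → ℝ≥0∞} (hf : Measurable[predSigma F T] f) {I : Set ℝ≥0} (hI : MeasurableSet I) :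
    ∫⁻ ω, ∫⁻ p in {p | T p ∈ I}, f (ω, p) ∂Q ω ∂P =
      ∫⁻ ω, ∫⁻ p in {p | T p ∈ I}, f (ω, p) ∂ν ∂P := by
  have hm : MeasurableSet {p | T p ∈ I} := h.measurable_time hI
  have := h.lintegral_eq (f := (Prod.snd ⁻¹' {p | T p ∈ I} : Set (Ω × E)).indicator f)
    (hf.indicator (measurable_snd_predSigma F T hm))
  simp_rw [← lintegral_indicator hm]
  exact this

lemma aemeasurable_setLIntegral (h : HasCompensator F T box Q ν P) [IsFiniteMeasure P]
    {f : Ω × E → ℝ≥0∞} (hf : Measurable[predSigma F T] f) (t : ℝ≥0) :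
    AEMeasurable (fun ω => ∫⁻ p in {p | T p ∈ Ioc 0 t}, f (ω, p) ∂Q ω) P := by
  have hm : MeasurableSet {p | T p ∈ Ioc 0 t} := h.measurable_time measurableSet_Ioc
  have h1 := h.measurable_lintegral_cutoff_of_pred
    (f := (Prod.snd ⁻¹' {p | T p ∈ Ioc 0 t} : Set (Ω × E)).indicator f)
    (hf.indicator (measurable_snd_predSigma F T hm)) t
  refine ⟨_, h1.mono (h.le t) le_rfl, ?_⟩
  filter_upwards [h.ae_box_lt_top] with ω hω
  rw [cutoff_eq hω, ← Measure.restrict_restrict_of_subset (s := {p | T p ∈ Ioc 0 t})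
    (t := {p | T p ≤ t}) fun p hp => hp.2, ← lintegral_indicator hm]
  rfl

/-- Conditioning on an event known at time `0` does not change the compensator. -/
lemma restrict (h : HasCompensator F T box Q ν P) {G : Set Ω} (hG : MeasurableSet[F 0] G) :
    HasCompensator F T box Q ν (P.restrict G) where
  mono := h.mono
  le := h.le
  measurable_time := h.measurable_time
  measurableSet_box := h.measurableSet_box
  monotone_box := h.monotone_box
  iUnion_box := h.iUnion_box
  measure_box := h.measure_box
  measurable := h.measurable
  adapted := h.adapted
  comp s G' B hG' hB hBs hν := by
    rw [Measure.restrict_restrict (h.le s _ hG'), Measure.restrict_apply (h.le s _ hG')]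
    exact h.comp s _ B (MeasurableSet.inter hG' (h.mono zero_le _ hG)) hB hBs hν

end HasCompensator

end Compensation

end OnOffNetwork

namespace OnOffNetwork

/-! ### Counts of a Poisson point process -/

lemma lintegral_cast_poissonMeasure (r : ℝ≥0) :
    ∫⁻ n : ℕ, (n : ℝ≥0∞) ∂poissonMeasure r = r := by
  rw [poissonMeasure, lintegral_sum_measure]
  simp_rw [lintegral_smul_measure, lintegral_dirac, smul_eq_mul]
  have h0 : ∀ n : ℕ, ENNReal.ofReal (Real.exp (-(r : ℝ)) * (r : ℝ) ^ n / n.factorial) * n =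
      ENNReal.ofReal (Real.exp (-(r : ℝ)) * (r : ℝ) ^ n / n.factorial * n) := fun n => by
    rw [ENNReal.ofReal_mul (by positivity), ENNReal.ofReal_natCast]
  simp_rw [h0]
  have hs : HasSum (fun n : ℕ => Real.exp (-(r : ℝ)) * (r : ℝ) ^ n / n.factorial * n) r := by
    rw [hasSum_nat_add_iff' 1 |>.symm]
    have h1 := (hasSum_one_poissonMeasure r).mul_left (r : ℝ)
    simp only [Finset.range_one, Finset.sum_singleton, Nat.cast_zero, mul_zero, sub_zero]
    rw [mul_one] at h1
    refine (funext fun n => ?_ : (fun n : ℕ => Real.exp (-(r : ℝ)) * (r : ℝ) ^ (n + 1) /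
      (n + 1).factorial * ((n + 1 : ℕ) : ℝ)) = _) ▸ h1
    rw [Nat.factorial_succ]
    push_cast
    field_simp
    ring
  rw [← ENNReal.ofReal_tsum_of_nonneg (fun n => by positivity) hs.summable, hs.tsum_eq]
  simp

lemma poissonMeasure_two_le (r : ℝ≥0) : poissonMeasure r {n : ℕ | 2 ≤ n} ≤ (r : ℝ≥0∞) ^ 2 := by
  have hc : {n : ℕ | 2 ≤ n} = ({0, 1} : Set ℕ)ᶜ := by
    ext n; simp only [mem_ofPred_eq, mem_compl_iff, mem_insert_iff, mem_singleton_iff]; omega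
  have h01 : poissonMeasure r ({0, 1} : Set ℕ) =
      ENNReal.ofReal (Real.exp (-(r : ℝ)) * (1 + r)) := by
    rw [insert_eq, measure_union (by simp) (measurableSet_singleton _), poissonMeasure_singleton,
      poissonMeasure_singleton, ← ENNReal.ofReal_add (by positivity) (by positivity)]
    congr 1; simp; ring
  rw [hc, prob_compl_eq_one_sub (by measurability), h01, ← ENNReal.ofReal_one,
    ← ENNReal.ofReal_sub _ (by positivity)]
  have : (r : ℝ≥0∞) ^ 2 = ENNReal.ofReal ((r : ℝ) ^ 2) := by
    rw [ENNReal.ofReal_pow r.coe_nonneg, ENNReal.ofReal_coe_nnreal]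
  rw [this]
  refine ENNReal.ofReal_le_ofReal ?_
  have := Real.add_one_le_exp (-(r : ℝ))
  have hr : (0 : ℝ) ≤ 1 + r := by positivity
  nlinarith [mul_le_mul_of_nonneg_right this hr]

section Poisson

variable {Ω E : Type*} [mΩ : MeasurableSpace Ω] [mE : MeasurableSpace E] {N : Ω → Measure E}
  {ν : Measure E} {P : Measure Ω}

lemma IsPoissonPointProcess.measurable_apply (h : IsPoissonPointProcess N ν P) {B : Set E}
    (hB : MeasurableSet B) : Measurable fun ω => N ω B :=
  (Measure.measurable_coe hB).comp h.measurable

lemma IsPoissonPointProcess.lintegral_apply (h : IsPoissonPointProcess N ν P) {B : Set E}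
    (hB : MeasurableSet B) (hν : ν B ≠ ∞) : ∫⁻ ω, N ω B ∂P = ν B := by
  have e : ∫⁻ ω, N ω B ∂P = ∫⁻ x, x ∂(P.map fun ω => N ω B) :=
    (lintegral_map measurable_id (h.measurable_apply hB)).symm
  have e' := lintegral_map (μ := poissonMeasure (ν B).toNNReal) (f := fun x : ℝ≥0∞ => x)
    (g := fun n : ℕ => (n : ℝ≥0∞)) measurable_id' .of_discrete
  rw [e, h.law B hB hν, e', lintegral_cast_poissonMeasure, ENNReal.coe_toNNReal hν]

lemma IsPoissonPointProcess.measure_two_le (h : IsPoissonPointProcess N ν P) {B : Set E}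
    (hB : MeasurableSet B) (hν : ν B ≠ ∞) : P {ω | 2 ≤ N ω B} ≤ ν B ^ 2 := by
  have e : P {ω | 2 ≤ N ω B} = (P.map fun ω => N ω B) (Ici 2) :=
    (Measure.map_apply (h.measurable_apply hB) measurableSet_Ici).symm
  rw [e, h.law B hB hν, Measure.map_apply .of_discrete measurableSet_Ici]
  have : (fun n : ℕ => (n : ℝ≥0∞)) ⁻¹' Ici 2 = {n | 2 ≤ n} := by
    ext n; simp only [mem_preimage, mem_Ici, mem_ofPred_eq]; norm_cast
  rw [this]
  refine (poissonMeasure_two_le _).trans ?_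
  rw [ENNReal.coe_toNNReal hν]

lemma IsPoissonPointProcess.measure_one_le (h : IsPoissonPointProcess N ν P) {B : Set E}
    (hB : MeasurableSet B) (hν : ν B ≠ ∞) : P {ω | 1 ≤ N ω B} ≤ ν B := by
  rw [← h.lintegral_apply hB hν]
  simpa using meas_ge_le_lintegral_div (h.measurable_apply hB).aemeasurable one_ne_zero (by simp)

lemma IsPoissonPointProcess.isProbabilityMeasure (h : IsPoissonPointProcess N ν P) :
    IsProbabilityMeasure P := by
  have h0 := h.law ∅ .empty (by simp)
  have h1 : (P.map fun ω => N ω ∅) univ = P univ :=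
    Measure.map_apply (h.measurable_apply .empty) .univ
  rw [h0] at h1
  refine ⟨h1 ▸ ?_⟩
  rw [Measure.map_apply .of_discrete .univ, preimage_univ, measure_univ]

/-! ### Independence of the past and the future -/

/-- Finitely many counts inside `C` are jointly independent of the count of a set `B` disjoint from
`C`: they are sums of counts of disjoint pieces of `C`, the atoms of the finite algebra generated
by `S`. -/
lemma IsPoissonPointProcess.indep_finset (h : IsPoissonPointProcess N ν P) {B C : Set E}
    (hB : MeasurableSet B) (hC : MeasurableSet C) (hBC : Disjoint B C)
    (S : Finset {D : Set E // MeasurableSet D}) :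
    Indep (⨆ D ∈ S, MeasurableSpace.comap (fun ω => N ω (D.1 ∩ C)) inferInstance)
      (MeasurableSpace.comap (fun ω => N ω B) inferInstance) P := by
  classical
  -- the pieces: `B`, and the atoms of the algebra generated by `S` in `C`
  let atom : (S → Bool) → Set E := fun ε => C ∩ ⋂ D : S, if ε D then D.1.1 else D.1.1ᶜ
  let piece : Option (S → Bool) → Set E := fun o => o.elim B atom
  have hatom : ∀ ε, MeasurableSet (atom ε) := fun ε => hC.inter (.iInter fun D => by
    split_ifs; exacts [D.1.2, D.1.2.compl])
  have hpiece : ∀ o, MeasurableSet (piece o) := by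
    rintro (_ | ε); exacts [hB, hatom ε]
  have hdisj_atom : ∀ ε ε', ε ≠ ε' → Disjoint (atom ε) (atom ε') := by
    intro ε ε' hne
    obtain ⟨D, hD⟩ := Function.ne_iff.1 hne
    rw [Set.disjoint_left]
    rintro x ⟨-, hx⟩ ⟨-, hx'⟩
    have h1 := mem_iInter.1 hx D
    have h2 := mem_iInter.1 hx' D
    cases h3 : ε D <;> cases h4 : ε' D <;> simp_all
  have hdisj : Pairwise fun o o' => Disjoint (piece o) (piece o') := by
    rintro (_ | ε) (_ | ε') hne
    · exact absurd rfl hne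
    · exact hBC.mono_right inter_subset_left
    · exact hBC.symm.mono_left inter_subset_left
    · exact hdisj_atom _ _ fun h => hne (by rw [h])
  have hind : iIndepFun (fun o ω => N ω (piece o)) P := by
    let e := Fintype.equivFin (Option (S → Bool))
    have := (h.indep _ (fun i => piece (e.symm i)) (fun i => hpiece _)
      (fun i j hij => hdisj (e.symm.injective.ne hij))).precomp e.injective
    simpa using this
  have hmeas : ∀ o, Measurable fun ω => N ω (piece o) := fun o => h.measurable_apply (hpiece o)
  have hi := hind.indepFun_finset (Finset.univ.image some) {none} (by simp) hmeas
  have hi' := (IndepFun_iff_Indep _ _ _).1 hi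
  refine indep_of_indep_of_le_left (indep_of_indep_of_le_right hi' ?_) ?_
  · rw [← measurable_iff_comap_le]
    exact (measurable_pi_apply (⟨none, by simp⟩ : ({none} : Finset (Option (S → Bool))))).comp
      (comap_measurable (fun a (i : ({none} : Finset (Option (S → Bool)))) => N a (piece i)))
  · refine iSup₂_le fun D hD => ?_
    rw [← measurable_iff_comap_le]
    have hunion : D.1 ∩ C = ⋃ ε : {ε : S → Bool // ε ⟨D, hD⟩ = true}, atom ε := by
      ext x
      simp only [mem_inter_iff, mem_iUnion]
      constructor
      · rintro ⟨hx, hxC⟩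
        refine ⟨⟨fun D' => decide (x ∈ D'.1.1), by simpa using hx⟩, hxC, mem_iInter.2 fun D' => ?_⟩
        by_cases hx' : x ∈ D'.1.1 <;> simp [hx']
      · rintro ⟨⟨ε, hε⟩, hxC, hx⟩
        have := mem_iInter.1 hx ⟨D, hD⟩
        simp only [hε, if_true] at this
        exact ⟨this, hxC⟩
    have hsum : (fun ω => N ω (D.1 ∩ C)) =
        fun ω => ∑ ε : {ε : S → Bool // ε ⟨D, hD⟩ = true}, N ω (piece (some ε.1)) := by
      ext ω
      rw [hunion, measure_iUnion (fun ε ε' hne => hdisj_atom _ _ fun h => hne (Subtype.ext h))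
        (fun ε => hatom _), tsum_fintype]
      rfl
    rw [hsum]
    refine Finset.measurable_sum _ fun ε _ => ?_
    exact (measurable_pi_apply (⟨some ε.1, by simp⟩ :
      ((Finset.univ.image some) : Finset (Option (S → Bool))))).comp
      (comap_measurable (fun a (i : ((Finset.univ.image some) : Finset (Option (S → Bool)))) =>
        N a (piece i)))

/-- The restriction of a Poisson point process to `C` is independent of the number of points in a
set disjoint from `C`. -/
lemma IsPoissonPointProcess.indep_restrict (h : IsPoissonPointProcess N ν P) {B C : Set E}
    (hB : MeasurableSet B) (hC : MeasurableSet C) (hBC : Disjoint B C) :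
    Indep (MeasurableSpace.comap (fun ω => (N ω).restrict C) inferInstance)
      (MeasurableSpace.comap (fun ω => N ω B) inferInstance) P := by
  have := h.isProbabilityMeasure
  have hle : ∀ S : Finset {D : Set E // MeasurableSet D},
      (⨆ D ∈ S, MeasurableSpace.comap (fun ω => N ω (D.1 ∩ C)) inferInstance) ≤ mΩ := fun S =>
    iSup₂_le fun D _ => (h.measurable_apply (D.2.inter hC)).comap_le
  have key := indep_iSup_of_directed_le (fun S => h.indep_finset hB hC hBC S) hle
    (h.measurable_apply hB).comap_le
    (Monotone.directed_le fun S S' hSS' => biSup_mono fun D hD => Finset.mem_of_subset hSS' hD)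
  refine indep_of_indep_of_le_left key ?_
  rw [← measurable_iff_comap_le]
  refine Measure.measurable_of_measurable_coe _ fun D hD => ?_
  simp_rw [Measure.restrict_apply hD]
  rw [measurable_iff_comap_le]
  refine le_trans ?_ (le_iSup _ {⟨D, hD⟩})
  simp

end Poisson

/-- If `m₁` is independent of `m₂` and both together are independent of `m₃`, then `m₁` is
independent of `m₂` and `m₃` together. -/
lemma indep_sup_right_of_indep_sup_left {Ω : Type*} {m₁ m₂ m₃ : MeasurableSpace Ω}
    [mΩ : MeasurableSpace Ω] {P : Measure Ω} [IsProbabilityMeasure P]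
    (h₁ : m₁ ≤ mΩ) (h₂ : m₂ ≤ mΩ) (h₃ : m₃ ≤ mΩ) (h12 : Indep m₁ m₂ P)
    (h123 : Indep (m₁ ⊔ m₂) m₃ P) : Indep m₁ (m₂ ⊔ m₃) P := by
  have hp : IsPiSystem {S : Set Ω | ∃ A B, MeasurableSet[m₂] A ∧ MeasurableSet[m₃] B ∧
      S = A ∩ B} := by
    rintro _ ⟨A, B, hA, hB, rfl⟩ _ ⟨A', B', hA', hB', rfl⟩ -
    exact ⟨A ∩ A', B ∩ B', MeasurableSet.inter hA hA', MeasurableSet.inter hB hB',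
      by ext; simp only [mem_inter_iff]; tauto⟩
  have hg : m₂ ⊔ m₃ = MeasurableSpace.generateFrom {S : Set Ω | ∃ A B, MeasurableSet[m₂] A ∧
      MeasurableSet[m₃] B ∧ S = A ∩ B} := by
    apply le_antisymm
    · refine sup_le (fun A hA => ?_) (fun B hB => ?_)
      · exact MeasurableSpace.measurableSet_generateFrom ⟨A, univ, hA, .univ, by simp⟩
      · exact MeasurableSpace.measurableSet_generateFrom ⟨univ, B, .univ, hB, by simp⟩
    · refine MeasurableSpace.generateFrom_le ?_
      rintro _ ⟨A, B, hA, hB, rfl⟩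
      have hA' : MeasurableSet[m₂ ⊔ m₃] A := le_sup_left (a := m₂) (b := m₃) _ hA
      have hB' : MeasurableSet[m₂ ⊔ m₃] B := le_sup_right (a := m₂) (b := m₃) _ hB
      exact MeasurableSet.inter hA' hB'
  refine IndepSets.indep h₁ (sup_le h₂ h₃) (@MeasurableSpace.isPiSystem_measurableSet Ω m₁) hp
    (@MeasurableSpace.generateFrom_measurableSet Ω m₁).symm hg ?_
  rw [IndepSets_iff]
  rintro S _ hS ⟨A, B, hA, hB, rfl⟩
  have h123' := (Indep_iff _ _ P).1 h123
  have h12' := (Indep_iff _ _ P).1 h12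
  have hA' : MeasurableSet[m₁ ⊔ m₂] A := le_sup_right (a := m₁) (b := m₂) _ hA
  have hS' : MeasurableSet[m₁ ⊔ m₂] S := le_sup_left (a := m₁) (b := m₂) _ hS
  rw [← inter_assoc, h123' _ B (MeasurableSet.inter hS' hA') hB, h12' S A hS hA, h123' A B hA' hB,
    mul_assoc]

/-- The intensity of a Poisson point process is its compensator, for a filtration whose information
at time `s` comes from the points up to time `s`, from independent sources `O` and from an
independent initial source `H`. -/
lemma IsPoissonPointProcess.lintegral_future {Ω E : Type*} {O H m : MeasurableSpace Ω}
    [mΩ : MeasurableSpace Ω] [mE : MeasurableSpace E] {N : Ω → Measure E} {ν : Measure E}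
    {P : Measure Ω} (h : IsPoissonPointProcess N ν P) {T : E → ℝ≥0}
    (hT : Measurable T) (hT0 : ν {p | T p = 0} = 0) (hO : O ≤ mΩ) (hH : H ≤ mΩ) {s : ℝ≥0}
    (hm : m ≤ MeasurableSpace.comap (fun ω => (N ω).restrict {p | T p ≤ s}) inferInstance ⊔ O ⊔ H)
    (hNO : Indep (MeasurableSpace.comap N inferInstance) O P)
    (hNOH : Indep (MeasurableSpace.comap N inferInstance ⊔ O) H P)
    {G : Set Ω} {B : Set E} (hG : MeasurableSet[m] G) (hB : MeasurableSet B) (hBs : B ⊆ after T s)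
    (hν : ν B ≠ ∞) : ∫⁻ ω in G, N ω B ∂P = P G * ν B := by
  have := h.isProbabilityMeasure
  have hTs : MeasurableSet {p | T p ≤ s} := measurableSet_le hT measurable_const
  -- without the points at time `0`, of which there are none, `B` is disjoint from the past
  set B' := B ∩ {p | s < T p} with hB'
  have hB'm : MeasurableSet B' := hB.inter (measurableSet_lt measurable_const hT)
  have hnull : ν (B \ B') = 0 := by
    refine measure_mono_null ?_ hT0
    rintro p ⟨hp, hp'⟩
    rcases hBs hp with rfl | h'
    · have : ¬ 0 < T p := fun h0 => hp' ⟨hp, h0⟩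
      simpa using this
    · exact absurd ⟨hp, h'⟩ hp'
  have hdm : MeasurableSet (B \ B') := hB.diff hB'm
  have hνB : ν B' = ν B := by
    refine le_antisymm (measure_mono inter_subset_left) ?_
    calc ν B ≤ ν (B \ B') + ν B' := by
          rw [← measure_union disjoint_sdiff_left hB'm, sdiff_union_of_subset inter_subset_left]
      _ = ν B' := by rw [hnull, zero_add]
  have hae : ∀ᵐ ω ∂P, N ω B = N ω B' := by
    have h0 : ∫⁻ ω, N ω (B \ B') ∂P = 0 := by
      rw [h.lintegral_apply hdm (by simp [hnull]), hnull]
    rw [lintegral_eq_zero_iff (h.measurable_apply hdm)] at h0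
    filter_upwards [h0] with ω hω
    refine le_antisymm ?_ (measure_mono inter_subset_left)
    calc N ω B ≤ N ω (B \ B') + N ω B' := by
          rw [← measure_union disjoint_sdiff_left hB'm, sdiff_union_of_subset inter_subset_left]
      _ = N ω B' := by rw [show N ω (B \ B') = 0 from hω, zero_add]
  have hrestr : MeasurableSpace.comap (fun ω => (N ω).restrict {p | T p ≤ s}) inferInstance ≤
      MeasurableSpace.comap N inferInstance := by
    rw [← measurable_iff_comap_le]
    refine Measure.measurable_of_measurable_coe _ fun D hD => ?_
    simp_rw [Measure.restrict_apply hD]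
    exact (Measure.measurable_coe (hD.inter hTs)).comp (comap_measurable N)
  have hval : MeasurableSpace.comap (fun ω => N ω B') inferInstance ≤
      MeasurableSpace.comap N inferInstance := by
    rw [← measurable_iff_comap_le]
    exact (Measure.measurable_coe hB'm).comp (comap_measurable N)
  have hNle : MeasurableSpace.comap N inferInstance ≤ mΩ := h.measurable.comap_le
  have i1 : Indep (MeasurableSpace.comap (fun ω => N ω B') inferInstance)
      (MeasurableSpace.comap (fun ω => (N ω).restrict {p | T p ≤ s}) inferInstance) P :=
    (h.indep_restrict hB'm hTs (Set.disjoint_left.2 fun p hp hp' =>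
      not_lt.2 (show T p ≤ s from hp') hp.2)).symm
  have i2 := indep_sup_right_of_indep_sup_left (hval.trans hNle) (hrestr.trans hNle) hO i1
    (indep_of_indep_of_le_left hNO (sup_le hval hrestr))
  have i3 := indep_sup_right_of_indep_sup_left (hval.trans hNle)
    (sup_le (hrestr.trans hNle) hO) hH i2
    (indep_of_indep_of_le_left hNOH (sup_le (hval.trans le_sup_left)
      (sup_le (hrestr.trans le_sup_left) le_sup_right)))
  have i4 := indep_of_indep_of_le_right i3 hm
  have hmle : m ≤ mΩ := hm.trans (sup_le (sup_le (hrestr.trans hNle) hO) hH)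
  have hGm : MeasurableSet G := hmle _ hG
  have hprod := lintegral_mul_eq_lintegral_mul_lintegral_of_independent_measurableSpace
    (hval.trans hNle) hmle i4 (f := fun ω => N ω B') (g := G.indicator 1)
    (comap_measurable _) (Measurable.indicator (@measurable_one _ _ _ m _) hG)
  rw [lintegral_congr_ae (ae_restrict_of_ae hae), ← lintegral_indicator hGm, mul_comm, ← hνB,
    ← h.lintegral_apply hB'm (hνB ▸ hν)]
  have e2 : ∫⁻ ω, G.indicator 1 ω ∂P = P G := lintegral_indicator_one hGm
  rw [e2] at hprod
  rw [← hprod]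
  refine lintegral_congr fun ω => ?_
  by_cases hω : ω ∈ G <;> simp [hω]

end OnOffNetwork

namespace OnOffNetwork

/-! ### Lebesgue measure on the half-line -/

lemma leb_apply (s : Set ℝ≥0) : leb s = volume ((↑) '' s : Set ℝ) :=
  (MeasurableEmbedding.subtype_coe measurableSet_Ici).comap_apply _ _

lemma leb_Ioc (a b : ℝ≥0) : leb (Ioc a b) = ENNReal.ofReal (b - a) := by
  rw [leb_apply]
  have : ((↑) '' Ioc a b : Set ℝ) = Ioc (a : ℝ) b := by
    ext x; constructor
    · rintro ⟨y, hy, rfl⟩; exact ⟨by exact_mod_cast hy.1, by exact_mod_cast hy.2⟩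
    · rintro ⟨h1, h2⟩
      exact ⟨⟨x, a.coe_nonneg.trans h1.le⟩, ⟨by exact_mod_cast h1, by exact_mod_cast h2⟩, rfl⟩
  rw [this, Real.volume_Ioc]

lemma leb_singleton (a : ℝ≥0) : leb {a} = 0 := by
  rw [leb_apply, image_singleton, Real.volume_singleton]

lemma leb_Iic (a : ℝ≥0) : leb (Iic a) = a := by
  have : Iic a = {0} ∪ Ioc 0 a := by
    ext x; simp only [mem_Iic, mem_union, mem_singleton_iff, mem_Ioc]
    constructor
    · intro h; rcases eq_or_ne x 0 with h0 | h0
      · exact Or.inl h0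
      · exact Or.inr ⟨pos_iff_ne_zero.2 h0, h⟩
    · rintro (rfl | h); exacts [zero_le, h.2]
  rw [this, measure_union (by simp) measurableSet_Ioc, leb_singleton, leb_Ioc]
  simp

instance : SigmaFinite leb :=
  (⟨⟨{ set := fun n => Iic (n : ℝ≥0), set_mem := fun _ => trivial,
       finite := fun n => by rw [leb_Iic]; exact ENNReal.coe_lt_top,
       spanning := by
        ext x; simp only [mem_iUnion, mem_Iic, mem_univ, iff_true]; exact exists_nat_ge x }⟩⟩)

instance : NullSingletonClass leb := ⟨leb_singleton⟩

/-! ### The noise of one user as a single point process -/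

/-- A point of the noise that drives one user: its kind (`0` for a connection, `1` for a loss, `2`
for a disconnection), its mark `w` (only relevant for connections), its height `z` and its time. -/
abbrev Pt := Fin 3 × ℝ≥0 × ℝ≥0 × ℝ≥0

namespace Pt

/-- The time of a point. -/
def time (p : Pt) : ℝ≥0 := p.2.2.2

/-- The height of a point. -/
def height (p : Pt) : ℝ≥0 := p.2.2.1

/-- The point of kind `0` with mark, height and time `q`. -/
def conn (q : ℝ≥0 × ℝ≥0 × ℝ≥0) : Pt := (0, q)

/-- The point of kind `i ≠ 0` with height and time `q`. Such points carry no mark; the mark is set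
to `0`. -/
def plain (i : Fin 3) (q : ℝ≥0 × ℝ≥0) : Pt := (i, 0, q)

/-- The points of height and time at most `n`. -/
def box (n : ℕ) : Set Pt := {p | p.height ≤ n ∧ p.time ≤ n}

@[fun_prop] lemma measurable_time : Measurable time := by unfold time; fun_prop
@[fun_prop] lemma measurable_height : Measurable height := by unfold height; fun_prop
@[fun_prop] lemma measurable_conn : Measurable conn := by unfold conn; fun_prop
@[fun_prop] lemma measurable_plain (i : Fin 3) : Measurable (plain i) := by unfold plain; fun_prop

lemma measurableEmbedding_conn : MeasurableEmbedding conn :=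
  MeasurableEmbedding.prodMk_left 0 MeasurableEmbedding.id

lemma measurableEmbedding_plain (i : Fin 3) : MeasurableEmbedding (plain i) :=
  MeasurableEmbedding.prodMk_left i (MeasurableEmbedding.prodMk_left 0 MeasurableEmbedding.id)

lemma measurableSet_box (n : ℕ) : MeasurableSet (box n) :=
  (measurableSet_le measurable_height measurable_const : MeasurableSet {p | height p ≤ n}).inter
    (measurableSet_le measurable_time measurable_const : MeasurableSet {p | time p ≤ n})

lemma monotone_box : Monotone box := fun n m h p hp =>
  ⟨hp.1.trans (by exact_mod_cast h), hp.2.trans (by exact_mod_cast h)⟩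

lemma iUnion_box : ⋃ n, box n = univ := by
  ext p
  simp only [mem_iUnion, mem_univ, iff_true]
  obtain ⟨n, hn⟩ := exists_nat_ge (max p.height p.time)
  exact ⟨n, (le_max_left _ _).trans hn, (le_max_right _ _).trans hn⟩

end Pt

open Pt

/-- The measure on `Pt` whose parts of the kinds `0`, `1` and `2` are `a`, `n` and `d`. -/
noncomputable def combine (a : Measure (ℝ≥0 × ℝ≥0 × ℝ≥0)) (n d : Measure (ℝ≥0 × ℝ≥0)) :
    Measure Pt := a.map conn + n.map (plain 1) + d.map (plain 2)

lemma combine_apply (a : Measure (ℝ≥0 × ℝ≥0 × ℝ≥0)) (n d : Measure (ℝ≥0 × ℝ≥0)) {B : Set Pt}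
    (hB : MeasurableSet B) :
    combine a n d B = a (conn ⁻¹' B) + n (plain 1 ⁻¹' B) + d (plain 2 ⁻¹' B) := by
  simp only [combine, Measure.add_apply, Measure.map_apply measurable_conn hB,
    Measure.map_apply (measurable_plain _) hB]

lemma lintegral_combine (a : Measure (ℝ≥0 × ℝ≥0 × ℝ≥0)) (n d : Measure (ℝ≥0 × ℝ≥0))
    {f : Pt → ℝ≥0∞} (hf : Measurable f) :
    ∫⁻ p, f p ∂combine a n d = ∫⁻ q, f (conn q) ∂a + ∫⁻ q, f (plain 1 q) ∂n +
      ∫⁻ q, f (plain 2 q) ∂d := by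
  rw [combine, lintegral_add_measure, lintegral_add_measure, lintegral_map hf measurable_conn,
    lintegral_map hf (measurable_plain 1), lintegral_map hf (measurable_plain 2)]

/-- The noise that drives user `k`. -/
noncomputable def Noise.points {K : ℕ} {Ω : Type*} (η : Noise K Ω) (k : Fin K) (ω : Ω) :
    Measure Pt := combine (η.A k ω) (η.N k ω) (η.D k ω)

/-- The intensity of the noise that drives one user. -/
noncomputable def intensity (α : Measure ℝ≥0) : Measure Pt :=
  combine (α.prod (leb.prod leb)) (leb.prod leb) (leb.prod leb)

/-- The dyadic interval `(i / 2^j, (i + 1) / 2^j]`. -/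
def cell (j i : ℕ) : Set ℝ≥0 := Ioc ((i : ℝ≥0) / 2 ^ j) ((i + 1 : ℕ) / 2 ^ j)

/-- The regularity of the noise used path by path: points are counted by integers, and for each
height bound and time horizon a sufficiently fine dyadic subdivision separates the points. -/
structure IsSeparated (q : Measure Pt) : Prop where
  integerValued : IsIntegerValued q
  cell_le : ∀ R N : ℕ, ∃ j, ∀ i < N * 2 ^ j, q {p | p.height ≤ R ∧ p.time ∈ cell j i} ≤ 1

lemma leb_cell (j i : ℕ) : leb (cell j i) = ENNReal.ofReal ((2 ^ j)⁻¹) := by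
  rw [cell, leb_Ioc]
  congr 1
  push_cast
  field_simp
  ring

/-- If three independent integer counts have Poisson-like tails at level `ρ`, then the
probability of more than one point in total is of order `ρ²`. -/
lemma measure_one_lt_add_le {Ω : Type*} [MeasurableSpace Ω] {P : Measure Ω}
    {a b d : Ω → ℝ≥0∞} {ρ : ℝ≥0∞}
    (hai : ∀ᵐ ω ∂P, ∃ n : ℕ∞, a ω = n) (hbi : ∀ᵐ ω ∂P, ∃ n : ℕ∞, b ω = n)
    (hdi : ∀ᵐ ω ∂P, ∃ n : ℕ∞, d ω = n)
    (ha2 : P {ω | 2 ≤ a ω} ≤ ρ ^ 2) (hb2 : P {ω | 2 ≤ b ω} ≤ ρ ^ 2)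
    (hd2 : P {ω | 2 ≤ d ω} ≤ ρ ^ 2)
    (ha1 : P {ω | 1 ≤ a ω} ≤ ρ) (hb1 : P {ω | 1 ≤ b ω} ≤ ρ) (hd1 : P {ω | 1 ≤ d ω} ≤ ρ)
    (hab : IndepFun a b P) (had : IndepFun a d P) (hbd : IndepFun b d P) :
    P {ω | 1 < a ω + b ω + d ω} ≤ 6 * ρ ^ 2 := by
  have pair : ∀ {f g : Ω → ℝ≥0∞}, IndepFun f g P → P {ω | 1 ≤ f ω} ≤ ρ → P {ω | 1 ≤ g ω} ≤ ρ →
      P ({ω | 1 ≤ f ω} ∩ {ω | 1 ≤ g ω}) ≤ ρ ^ 2 := fun {f g} hfg hf hg => by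
    have := hfg.measure_inter_preimage_eq_mul (Ici 1) (Ici 1) measurableSet_Ici measurableSet_Ici
    calc P ({ω | 1 ≤ f ω} ∩ {ω | 1 ≤ g ω}) = P {ω | 1 ≤ f ω} * P {ω | 1 ≤ g ω} := this
      _ ≤ ρ ^ 2 := by rw [sq]; exact mul_le_mul' hf hg
  calc P {ω | 1 < a ω + b ω + d ω}
      ≤ P ((({ω | 2 ≤ a ω} ∪ {ω | 2 ≤ b ω}) ∪ ({ω | 2 ≤ d ω} ∪ ({ω | 1 ≤ a ω} ∩ {ω | 1 ≤ b ω}))) ∪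
        (({ω | 1 ≤ a ω} ∩ {ω | 1 ≤ d ω}) ∪ ({ω | 1 ≤ b ω} ∩ {ω | 1 ≤ d ω}))) := by
        refine measure_mono_ae ?_
        filter_upwards [hai, hbi, hdi] with ω ⟨n, hn⟩ ⟨m, hm⟩ ⟨l, hl⟩
        intro hω
        change 1 < a ω + b ω + d ω at hω
        change ((2 ≤ a ω ∨ 2 ≤ b ω) ∨ 2 ≤ d ω ∨ 1 ≤ a ω ∧ 1 ≤ b ω) ∨
          (1 ≤ a ω ∧ 1 ≤ d ω) ∨ (1 ≤ b ω ∧ 1 ≤ d ω)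
        rw [hn, hm, hl] at hω ⊢
        norm_cast at hω ⊢
        have h2 : ∀ x : ℕ∞, x = 0 ∨ x = 1 ∨ 2 ≤ x := fun x => by
          induction x with
          | top => simp
          | coe x => norm_cast; omega
        rcases h2 n with rfl | rfl | h <;> rcases h2 m with rfl | rfl | h' <;>
          rcases h2 l with rfl | rfl | h'' <;> simp_all
    _ ≤ (ρ ^ 2 + ρ ^ 2 + (ρ ^ 2 + ρ ^ 2)) + (ρ ^ 2 + ρ ^ 2) := by
        refine (measure_union_le _ _).trans (add_le_add ((measure_union_le _ _).trans (add_le_add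
          ((measure_union_le _ _).trans (add_le_add ha2 hb2))
          ((measure_union_le _ _).trans (add_le_add hd2 (pair hab ha1 hb1)))))
          ((measure_union_le _ _).trans (add_le_add (pair had ha1 hd1) (pair hbd hb1 hd1))))
    _ = 6 * ρ ^ 2 := by ring

section

variable {K : ℕ} {Ω : Type*}

/-- The filtration generated by the initial information `H` and the noise. -/
noncomputable abbrev filt (H : MeasurableSpace Ω) (η : Noise K Ω) (t : ℝ≥0) : MeasurableSpace Ω :=
  H ⊔ η.sigmaUpTo t

lemma comap_restrict_mono {E : Type*} [MeasurableSpace E] (N : Ω → Measure E) {C D : Set E}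
    (hCD : C ⊆ D) (hC : MeasurableSet C) :
    MeasurableSpace.comap (fun ω => (N ω).restrict C) inferInstance ≤
      MeasurableSpace.comap (fun ω => (N ω).restrict D) inferInstance := by
  rw [← measurable_iff_comap_le]
  refine Measure.measurable_of_measurable_coe _ fun B hB => ?_
  have e : ∀ ω, (N ω).restrict C B = (N ω).restrict D (B ∩ C) := fun ω => by
    rw [Measure.restrict_apply hB, Measure.restrict_apply (hB.inter hC), inter_assoc,
      inter_eq_left.2 hCD]
  simp_rw [e]
  exact (Measure.measurable_coe (hB.inter hC)).comp (comap_measurable _)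

lemma comap_restrict_le {E : Type*} [MeasurableSpace E] (N : Ω → Measure E) {C : Set E}
    (hC : MeasurableSet C) :
    MeasurableSpace.comap (fun ω => (N ω).restrict C) inferInstance ≤
      MeasurableSpace.comap N inferInstance := by
  simpa using comap_restrict_mono N (subset_univ C) hC

lemma measurableSet_time_le₃ (t : ℝ≥0) : MeasurableSet {p : ℝ≥0 × ℝ≥0 × ℝ≥0 | p.2.2 ≤ t} :=
  measurableSet_le (by fun_prop) measurable_const

lemma measurableSet_time_le₂ (t : ℝ≥0) : MeasurableSet {p : ℝ≥0 × ℝ≥0 | p.2 ≤ t} :=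
  measurableSet_le (by fun_prop) measurable_const

lemma sigmaUpTo_mono (η : Noise K Ω) : Monotone η.sigmaUpTo := fun s _ hst =>
  iSup_mono fun _ => sup_le_sup (sup_le_sup
    (comap_restrict_mono _ (fun _ h => le_trans h hst) (measurableSet_time_le₃ s))
    (comap_restrict_mono _ (fun _ h => le_trans h hst) (measurableSet_time_le₂ s)))
    (comap_restrict_mono _ (fun _ h => le_trans h hst) (measurableSet_time_le₂ s))

lemma filt_mono (H : MeasurableSpace Ω) (η : Noise K Ω) : Monotone (filt H η) := fun _ _ hst =>
  sup_le_sup_left (sigmaUpTo_mono η hst) _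

/-- The information up to time `t` is that of one source up to time `t`, with all the other sources
and the initial information. -/
lemma filt_le (H : MeasurableSpace Ω) (η : Noise K Ω) (t : ℝ≥0)
    (i : Fin K ⊕ Fin K ⊕ Fin K) (m : MeasurableSpace Ω)
    (hA : ∀ k, i = Sum.inl k →
      MeasurableSpace.comap (fun ω => (η.A k ω).restrict {p | p.2.2 ≤ t}) inferInstance ≤ m)
    (hN : ∀ k, i = Sum.inr (Sum.inl k) →
      MeasurableSpace.comap (fun ω => (η.N k ω).restrict {p | p.2 ≤ t}) inferInstance ≤ m)
    (hD : ∀ k, i = Sum.inr (Sum.inr k) →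
      MeasurableSpace.comap (fun ω => (η.D k ω).restrict {p | p.2 ≤ t}) inferInstance ≤ m) :
    filt H η t ≤ m ⊔ (⨆ l ∈ ({i} : Set (Fin K ⊕ Fin K ⊕ Fin K))ᶜ, η.sigmaFamily l) ⊔ H := by
  refine sup_le le_sup_right (le_trans (iSup_le fun k => sup_le (sup_le ?_ ?_) ?_) le_sup_left)
  · by_cases hi : i = Sum.inl k
    · exact (hA k hi).trans le_sup_left
    · refine (comap_restrict_le _ (measurableSet_time_le₃ t)).trans (le_trans ?_ le_sup_right)
      exact le_iSup₂_of_le (f := fun l (_ : l ∈ ({i} : Set (Fin K ⊕ Fin K ⊕ Fin K))ᶜ) =>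
        η.sigmaFamily l) (Sum.inl k) (fun h => hi h.symm) le_rfl
  · by_cases hi : i = Sum.inr (Sum.inl k)
    · exact (hN k hi).trans le_sup_left
    · refine (comap_restrict_le _ (measurableSet_time_le₂ t)).trans (le_trans ?_ le_sup_right)
      exact le_iSup₂_of_le (f := fun l (_ : l ∈ ({i} : Set (Fin K ⊕ Fin K ⊕ Fin K))ᶜ) =>
        η.sigmaFamily l) (Sum.inr (Sum.inl k)) (fun h => hi h.symm) le_rfl
  · by_cases hi : i = Sum.inr (Sum.inr k)
    · exact (hD k hi).trans le_sup_left
    · refine (comap_restrict_le _ (measurableSet_time_le₂ t)).trans (le_trans ?_ le_sup_right)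
      exact le_iSup₂_of_le (f := fun l (_ : l ∈ ({i} : Set (Fin K ⊕ Fin K ⊕ Fin K))ᶜ) =>
        η.sigmaFamily l) (Sum.inr (Sum.inr k)) (fun h => hi h.symm) le_rfl

end

namespace Noise.IsPoisson

variable {K : ℕ} {Ω : Type*} {H : MeasurableSpace Ω} [mΩ : MeasurableSpace Ω] {P : Measure Ω}
  {η : Noise K Ω} {α : Fin K → Measure ℝ≥0}

lemma sigmaFamily_le (h : η.IsPoisson α P) (i : Fin K ⊕ Fin K ⊕ Fin K) :
    η.sigmaFamily i ≤ mΩ := by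
  rcases i with k | k | k
  · exact (h.poisson_A k).measurable.comap_le
  · exact (h.poisson_N k).measurable.comap_le
  · exact (h.poisson_D k).measurable.comap_le

lemma filt_le_self (h : η.IsPoisson α P) (hH : H ≤ mΩ) (t : ℝ≥0) : filt H η t ≤ mΩ := by
  refine sup_le hH (iSup_le fun k => sup_le (sup_le ?_ ?_) ?_)
  · exact (comap_restrict_le _ (measurableSet_time_le₃ t)).trans
      (h.poisson_A k).measurable.comap_le
  · exact (comap_restrict_le _ (measurableSet_time_le₂ t)).trans
      (h.poisson_N k).measurable.comap_le
  · exact (comap_restrict_le _ (measurableSet_time_le₂ t)).trans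
      (h.poisson_D k).measurable.comap_le

lemma indep_others [IsProbabilityMeasure P] (h : η.IsPoisson α P) (i : Fin K ⊕ Fin K ⊕ Fin K) :
    Indep (η.sigmaFamily i)
      (⨆ l ∈ ({i} : Set (Fin K ⊕ Fin K ⊕ Fin K))ᶜ, η.sigmaFamily l) P := by
  have := indep_iSup_of_disjoint h.sigmaFamily_le h.indep
    (S := {i}) (T := {i}ᶜ) disjoint_compl_right
  simpa using this

lemma indep_initial (hHη : Indep H η.sigma P) (i : Fin K ⊕ Fin K ⊕ Fin K) :
    Indep (η.sigmaFamily i ⊔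
      (⨆ l ∈ ({i} : Set (Fin K ⊕ Fin K ⊕ Fin K))ᶜ, η.sigmaFamily l)) H P :=
  indep_of_indep_of_le_left hHη.symm
    (sup_le (le_iSup _ i) (iSup₂_le fun l _ => le_iSup _ l))

lemma prod_time_zero {E : Type*} [MeasurableSpace E] (μ : Measure E) [SFinite μ] :
    (μ.prod leb) {p | p.2 = 0} = 0 := by
  have : {p : E × ℝ≥0 | p.2 = 0} = univ ×ˢ {0} := by ext; simp
  rw [this, Measure.prod_prod, leb_singleton, mul_zero]

lemma prod_time_zero₃ (μ : Measure ℝ≥0) [SFinite μ] :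
    (μ.prod (leb.prod leb)) {p | p.2.2 = 0} = 0 := by
  have : {p : ℝ≥0 × ℝ≥0 × ℝ≥0 | p.2.2 = 0} = univ ×ˢ (univ ×ˢ {0}) := by ext; simp
  rw [this, Measure.prod_prod, Measure.prod_prod, leb_singleton, mul_zero, mul_zero]

lemma prod_strip (R : ℝ≥0) (I : Set ℝ≥0) :
    (leb.prod leb) {p | p.1 ≤ R ∧ p.2 ∈ I} = R * leb I := by
  have : {p : ℝ≥0 × ℝ≥0 | p.1 ≤ R ∧ p.2 ∈ I} = Iic R ×ˢ I := by ext; simp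
  rw [this, Measure.prod_prod, leb_Iic]

lemma prod_strip₃ (μ : Measure ℝ≥0) [IsProbabilityMeasure μ] (R : ℝ≥0) (I : Set ℝ≥0) :
    (μ.prod (leb.prod leb)) {p | p.2.1 ≤ R ∧ p.2.2 ∈ I} = R * leb I := by
  have : {p : ℝ≥0 × ℝ≥0 × ℝ≥0 | p.2.1 ≤ R ∧ p.2.2 ∈ I} = univ ×ˢ (Iic R ×ˢ I) := by ext; simp
  rw [this, Measure.prod_prod, Measure.prod_prod, leb_Iic, measure_univ, one_mul]

/-- The noise of user `k` has its intensity as compensator. -/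
theorem hasCompensator [IsProbabilityMeasure P] (h : η.IsPoisson α P)
    (hα : ∀ k, IsProbabilityMeasure (α k)) (hH : H ≤ mΩ) (hHη : Indep H η.sigma P) (k : Fin K) :
    HasCompensator (filt H η) time box (η.points k) (intensity (α k)) P where
  mono := filt_mono H η
  le := h.filt_le_self hH
  measurable_time := measurable_time
  measurableSet_box := measurableSet_box
  monotone_box := monotone_box
  iUnion_box := iUnion_box
  measure_box n := by
    have := hα k
    rw [intensity, combine_apply _ _ _ (measurableSet_box n)]
    have e1 : conn ⁻¹' box n = {p | p.2.1 ≤ (n : ℝ≥0) ∧ p.2.2 ∈ Iic (n : ℝ≥0)} := rfl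
    have e2 : ∀ i, plain i ⁻¹' box n = {p | p.1 ≤ (n : ℝ≥0) ∧ p.2 ∈ Iic (n : ℝ≥0)} := fun _ => rfl
    rw [e1, e2, e2, prod_strip, prod_strip₃, leb_Iic]
    exact ENNReal.add_lt_top.2 ⟨ENNReal.add_lt_top.2 ⟨ENNReal.mul_lt_top ENNReal.coe_lt_top
      ENNReal.coe_lt_top, ENNReal.mul_lt_top ENNReal.coe_lt_top ENNReal.coe_lt_top⟩,
      ENNReal.mul_lt_top ENNReal.coe_lt_top ENNReal.coe_lt_top⟩
  measurable := by
    refine Measure.measurable_of_measurable_coe _ fun B hB => ?_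
    simp_rw [Noise.points, combine_apply _ _ _ hB]
    exact (((h.poisson_A k).measurable_apply (measurable_conn hB)).add
      ((h.poisson_N k).measurable_apply (measurable_plain 1 hB))).add
      ((h.poisson_D k).measurable_apply (measurable_plain 2 hB))
  adapted t := by
    refine Measure.measurable_of_measurable_coe _ fun B hB => ?_
    have hTt : MeasurableSet {p : Pt | p.time ≤ t} :=
      measurableSet_le measurable_time measurable_const
    have e : ∀ ω, (η.points k ω).restrict {p | p.time ≤ t} B =
        (η.A k ω).restrict {p | p.2.2 ≤ t} (conn ⁻¹' B) +
        (η.N k ω).restrict {p | p.2 ≤ t} (plain 1 ⁻¹' B) +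
        (η.D k ω).restrict {p | p.2 ≤ t} (plain 2 ⁻¹' B) := fun ω => by
      rw [Measure.restrict_apply hB, Noise.points, combine_apply _ _ _ (hB.inter hTt),
        Measure.restrict_apply (measurable_conn hB), Measure.restrict_apply (measurable_plain 1 hB),
        Measure.restrict_apply (measurable_plain 2 hB)]
      rfl
    simp_rw [e]
    have hk := le_iSup (fun k => (MeasurableSpace.comap
      (fun ω => (η.A k ω).restrict {p | p.2.2 ≤ t}) inferInstance ⊔
      MeasurableSpace.comap (fun ω => (η.N k ω).restrict {p | p.2 ≤ t}) inferInstance ⊔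
      MeasurableSpace.comap (fun ω => (η.D k ω).restrict {p | p.2 ≤ t}) inferInstance)) k
    have hk' := hk.trans (le_sup_right (a := H))
    refine Measurable.add (Measurable.add ?_ ?_) ?_
    · exact ((Measure.measurable_coe (measurable_conn hB)).comp (comap_measurable _)).mono
        (le_trans (le_trans le_sup_left le_sup_left) hk') le_rfl
    · exact ((Measure.measurable_coe (measurable_plain 1 hB)).comp (comap_measurable _)).mono
        (le_trans (le_trans le_sup_right le_sup_left) hk') le_rfl
    · exact ((Measure.measurable_coe (measurable_plain 2 hB)).comp (comap_measurable _)).mono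
        (le_trans le_sup_right hk') le_rfl
  comp s G B hG hB hBs hν := by
    have := hα k
    rw [intensity, combine_apply _ _ _ hB] at hν ⊢
    simp only [ne_eq, ENNReal.add_eq_top, not_or] at hν
    have hO : ∀ i, (⨆ l ∈ ({i} : Set (Fin K ⊕ Fin K ⊕ Fin K))ᶜ, η.sigmaFamily l) ≤ mΩ := fun i =>
      iSup₂_le fun l _ => h.sigmaFamily_le l
    have hA := (h.poisson_A k).lintegral_future (T := fun p => p.2.2) (by fun_prop)
      (prod_time_zero₃ (α k)) (hO (Sum.inl k)) hH (filt_le H η s (Sum.inl k) _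
        (fun k' hk' => by rw [Sum.inl.inj hk']) (fun k' hk' => by simp at hk')
        (fun k' hk' => by simp at hk')) (h.indep_others (Sum.inl k))
      (indep_initial hHη (Sum.inl k)) hG (measurable_conn hB) (fun p hp => hBs hp) hν.1.1
    have hN := (h.poisson_N k).lintegral_future (T := fun p => p.2) (by fun_prop)
      (prod_time_zero leb) (hO (Sum.inr (Sum.inl k))) hH (filt_le H η s (Sum.inr (Sum.inl k)) _
        (fun k' hk' => by simp at hk')
        (fun k' hk' => by rw [Sum.inl.inj (Sum.inr.inj hk')])
        (fun k' hk' => by simp at hk')) (h.indep_others (Sum.inr (Sum.inl k)))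
      (indep_initial hHη (Sum.inr (Sum.inl k))) hG (measurable_plain 1 hB) (fun p hp => hBs hp)
      hν.1.2
    have hD := (h.poisson_D k).lintegral_future (T := fun p => p.2) (by fun_prop)
      (prod_time_zero leb) (hO (Sum.inr (Sum.inr k))) hH (filt_le H η s (Sum.inr (Sum.inr k)) _
        (fun k' hk' => by simp at hk') (fun k' hk' => by simp at hk')
        (fun k' hk' => by rw [Sum.inr.inj (Sum.inr.inj hk')]))
      (h.indep_others (Sum.inr (Sum.inr k)))
      (indep_initial hHη (Sum.inr (Sum.inr k))) hG (measurable_plain 2 hB) (fun p hp => hBs hp)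
      hν.2
    simp_rw [Noise.points, combine_apply _ _ _ hB]
    rw [lintegral_add_right _ ((h.poisson_D k).measurable_apply (measurable_plain 2 hB)),
      lintegral_add_left ((h.poisson_A k).measurable_apply (measurable_conn hB)), hA, hN, hD,
      mul_add, mul_add]

lemma measure_one_lt_le [IsProbabilityMeasure P] (h : η.IsPoisson α P)
    (hα : ∀ k, IsProbabilityMeasure (α k)) (k : Fin K) (R j i : ℕ) :
    P {ω | 1 < η.points k ω {p | p.height ≤ R ∧ p.time ∈ cell j i}} ≤
      6 * (R * ENNReal.ofReal ((2 ^ j)⁻¹)) ^ 2 := by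
  have := hα k
  have hI : MeasurableSet (cell j i) := measurableSet_Ioc
  have hB : MeasurableSet {p : Pt | p.height ≤ R ∧ p.time ∈ cell j i} :=
    (measurableSet_le measurable_height measurable_const).inter (measurable_time hI)
  have e3 : (α k).prod (leb.prod leb) (conn ⁻¹' {p : Pt | p.height ≤ R ∧ p.time ∈ cell j i}) =
      R * ENNReal.ofReal ((2 ^ j)⁻¹) := by
    rw [← leb_cell j i]; exact prod_strip₃ (α k) R (cell j i)
  have e2 : ∀ l, leb.prod leb (plain l ⁻¹' {p : Pt | p.height ≤ R ∧ p.time ∈ cell j i}) =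
      R * ENNReal.ofReal ((2 ^ j)⁻¹) := fun l => by
    rw [← leb_cell j i]; exact prod_strip R (cell j i)
  have hfin : (R : ℝ≥0∞) * ENNReal.ofReal ((2 ^ j)⁻¹) ≠ ∞ :=
    ENNReal.mul_ne_top (by simp) ENNReal.ofReal_ne_top
  have ind : ∀ {E E' : Type} [MeasurableSpace E] [MeasurableSpace E'] {N : Ω → Measure E}
      {N' : Ω → Measure E'} {C : Set E} {C' : Set E'}, MeasurableSet C → MeasurableSet C' →
      Indep (MeasurableSpace.comap N inferInstance) (MeasurableSpace.comap N' inferInstance) P →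
      IndepFun (fun ω => N ω C) (fun ω => N' ω C') P := by
    intro E E' _ _ N N' C C' hC hC' hi
    exact IndepFun.comp (f := N) (g := N') hi (Measure.measurable_coe hC)
      (Measure.measurable_coe hC')
  simp_rw [Noise.points, combine_apply _ _ _ hB]
  refine measure_one_lt_add_le ?_ ?_ ?_ ?_ ?_ ?_ ?_ ?_ ?_ ?_ ?_ ?_
  · filter_upwards [(h.poisson_A k).integer_valued] with ω hω using hω _ (measurable_conn hB)
  · filter_upwards [(h.poisson_N k).integer_valued] with ω hω using hω _ (measurable_plain 1 hB)
  · filter_upwards [(h.poisson_D k).integer_valued] with ω hω using hω _ (measurable_plain 2 hB)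
  · exact ((h.poisson_A k).measure_two_le (measurable_conn hB) (e3 ▸ hfin)).trans (by rw [e3])
  · exact ((h.poisson_N k).measure_two_le (measurable_plain 1 hB) (e2 1 ▸ hfin)).trans (by rw [e2])
  · exact ((h.poisson_D k).measure_two_le (measurable_plain 2 hB) (e2 2 ▸ hfin)).trans (by rw [e2])
  · exact ((h.poisson_A k).measure_one_le (measurable_conn hB) (e3 ▸ hfin)).trans (by rw [e3])
  · exact ((h.poisson_N k).measure_one_le (measurable_plain 1 hB) (e2 1 ▸ hfin)).trans (by rw [e2])
  · exact ((h.poisson_D k).measure_one_le (measurable_plain 2 hB) (e2 2 ▸ hfin)).trans (by rw [e2])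
  · exact ind (measurable_conn hB) (measurable_plain 1 hB)
      (h.indep.indep (i := Sum.inl k) (j := Sum.inr (Sum.inl k)) (by simp))
  · exact ind (measurable_conn hB) (measurable_plain 2 hB)
      (h.indep.indep (i := Sum.inl k) (j := Sum.inr (Sum.inr k)) (by simp))
  · exact ind (measurable_plain 1 hB) (measurable_plain 2 hB)
      (h.indep.indep (i := Sum.inr (Sum.inl k)) (j := Sum.inr (Sum.inr k)) (by simp))

/-- Almost surely the points of user `k` have distinct times, uniformly on bounded sets. -/
theorem ae_isSeparated [IsProbabilityMeasure P] (h : η.IsPoisson α P)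
    (hα : ∀ k, IsProbabilityMeasure (α k)) (k : Fin K) :
    ∀ᵐ ω ∂P, IsSeparated (η.points k ω) := by
  have h1 : ∀ᵐ ω ∂P, IsIntegerValued (η.points k ω) := by
    filter_upwards [(h.poisson_A k).integer_valued, (h.poisson_N k).integer_valued,
      (h.poisson_D k).integer_valued] with ω hA hN hD
    exact ((IsIntegerValued.map hA measurable_conn).add
      (IsIntegerValued.map hN (measurable_plain 1))).add
      (IsIntegerValued.map hD (measurable_plain 2))
  have h2 : ∀ R N : ℕ, ∀ᵐ ω ∂P, ∃ j, ∀ i < N * 2 ^ j,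
      η.points k ω {p | p.height ≤ R ∧ p.time ∈ cell j i} ≤ 1 := by
    intro R N
    rw [ae_iff]
    have hle : ∀ j : ℕ, P {ω | ¬ ∃ j, ∀ i < N * 2 ^ j,
        η.points k ω {p | p.height ≤ R ∧ p.time ∈ cell j i} ≤ 1} ≤
        ENNReal.ofReal (6 * N * R ^ 2 * ((2 : ℝ)⁻¹) ^ j) := by
      intro j
      calc P {ω | ¬ ∃ j, ∀ i < N * 2 ^ j,
            η.points k ω {p | p.height ≤ R ∧ p.time ∈ cell j i} ≤ 1}
          ≤ P (⋃ i ∈ Finset.range (N * 2 ^ j),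
              {ω | 1 < η.points k ω {p | p.height ≤ R ∧ p.time ∈ cell j i}}) := by
            refine measure_mono fun ω hω => ?_
            simp only [mem_ofPred_eq, not_exists, not_forall, not_le] at hω
            obtain ⟨i, hi, hi'⟩ := hω j
            simp only [mem_iUnion, Finset.mem_range]
            exact ⟨i, hi, hi'⟩
        _ ≤ ∑ i ∈ Finset.range (N * 2 ^ j), 6 * (R * ENNReal.ofReal ((2 ^ j)⁻¹)) ^ 2 :=
            (measure_biUnion_finset_le _ _).trans
              (Finset.sum_le_sum fun i _ => h.measure_one_lt_le hα k R j i)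
        _ = ENNReal.ofReal (6 * N * R ^ 2 * ((2 : ℝ)⁻¹) ^ j) := by
            rw [Finset.sum_const, Finset.card_range, nsmul_eq_mul]
            have e : (6 : ℝ≥0∞) * (R * ENNReal.ofReal ((2 ^ j)⁻¹)) ^ 2 =
                ENNReal.ofReal (6 * (R * (2 ^ j)⁻¹) ^ 2) := by
              rw [ENNReal.ofReal_mul (by norm_num), ENNReal.ofReal_pow (by positivity),
                ENNReal.ofReal_mul (by positivity)]
              simp
            rw [e, ← ENNReal.ofReal_natCast, ← ENNReal.ofReal_mul (by positivity)]
            congr 1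
            push_cast
            rw [inv_pow]
            field_simp
    have hlim : Tendsto (fun j : ℕ => ENNReal.ofReal (6 * N * R ^ 2 * ((2 : ℝ)⁻¹) ^ j)) atTop
        (𝓝 0) := by
      have := (tendsto_pow_atTop_nhds_zero_of_lt_one (r := (2 : ℝ)⁻¹) (by norm_num)
        (by norm_num)).const_mul (6 * N * R ^ 2 : ℝ)
      rw [mul_zero] at this
      simpa using ENNReal.tendsto_ofReal this
    exact le_antisymm (ge_of_tendsto' hlim hle) bot_le
  filter_upwards [h1, ae_all_iff.2 fun R => ae_all_iff.2 fun N => h2 R N] with ω hω hω'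
  exact ⟨hω, hω'⟩

end Noise.IsPoisson

end OnOffNetwork

namespace OnOffNetwork

open Pt

/-! ### Càdlàg paths -/

namespace IsCadlag

variable {x : ℝ≥0 → ℝ}

lemma tendsto_leftLim (hx : IsCadlag x) (t : ℝ≥0) :
    Tendsto x (𝓝[<] t) (𝓝 (Function.leftLim x t)) :=
  tendsto_leftLim_of_tendsto (hx t).2

end IsCadlag

/-- The last point of the grid of mesh `2^{-n}` strictly before `s` (or `0` if `s = 0`). -/
noncomputable def gridBefore (n : ℕ) (s : ℝ≥0) : ℝ≥0 := ((⌈s * 2 ^ n⌉₊ - 1 : ℕ) : ℝ≥0) / 2 ^ n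

lemma gridBefore_lt {n : ℕ} {s : ℝ≥0} (hs : 0 < s) : gridBefore n s < s := by
  have h2 : (0 : ℝ≥0) < 2 ^ n := by positivity
  rw [gridBefore, div_lt_iff₀ h2]
  have hpos : 0 < ⌈s * 2 ^ n⌉₊ := Nat.ceil_pos.2 (by positivity)
  exact Nat.lt_ceil.1 (by omega)

lemma tendsto_gridBefore (s : ℝ≥0) : Tendsto (fun n => gridBefore n s) atTop (𝓝 s) := by
  have h2 : ∀ n : ℕ, (0 : ℝ) < 2 ^ n := fun n => by positivity
  rw [← NNReal.tendsto_coe]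
  have hb : Tendsto (fun n : ℕ => (s : ℝ) - (2⁻¹ : ℝ) ^ n) atTop (𝓝 s) := by
    simpa using (tendsto_pow_atTop_nhds_zero_of_lt_one (r := (2 : ℝ)⁻¹) (by norm_num)
      (by norm_num)).const_sub (s : ℝ)
  refine tendsto_of_tendsto_of_tendsto_of_le_of_le hb tendsto_const_nhds (fun n => ?_) (fun n => ?_)
  · have h1 : (s : ℝ) * 2 ^ n ≤ (⌈s * 2 ^ n⌉₊ : ℝ) := by exact_mod_cast Nat.le_ceil (s * 2 ^ n)
    have h3 : (⌈s * 2 ^ n⌉₊ : ℝ) - 1 ≤ ((⌈s * 2 ^ n⌉₊ - 1 : ℕ) : ℝ) := by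
      have : ⌈s * 2 ^ n⌉₊ ≤ (⌈s * 2 ^ n⌉₊ - 1) + 1 := by omega
      have h' : (⌈s * 2 ^ n⌉₊ : ℝ) ≤ ((⌈s * 2 ^ n⌉₊ - 1 : ℕ) : ℝ) + 1 := by exact_mod_cast this
      linarith
    simp only [gridBefore, NNReal.coe_div, NNReal.coe_natCast, NNReal.coe_pow, NNReal.coe_ofNat]
    rw [le_div_iff₀ (h2 n), sub_mul, inv_pow, inv_mul_cancel₀ (h2 n).ne']
    linarith
  · rcases eq_or_ne s 0 with rfl | hs
    · simp [gridBefore]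
    · exact_mod_cast (gridBefore_lt (pos_iff_ne_zero.2 hs)).le

lemma IsCadlag.tendsto_gridBefore {x : ℝ≥0 → ℝ} (hx : IsCadlag x) (s : ℝ≥0) :
    Tendsto (fun n => x (gridBefore n s)) atTop (𝓝 (Function.leftLim x s)) := by
  rcases eq_or_ne s 0 with rfl | hs
  · have h0 : Function.leftLim x 0 = x 0 :=
      leftLim_eq_of_eq_bot _ (by simp)
    simp [gridBefore, h0]
  · exact (hx.tendsto_leftLim s).comp (tendsto_nhdsWithin_iff.2
      ⟨OnOffNetwork.tendsto_gridBefore s,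
        Eventually.of_forall fun n => gridBefore_lt (pos_iff_ne_zero.2 hs)⟩)

lemma IsCadlag.measurable_leftLim {x : ℝ≥0 → ℝ} (hx : IsCadlag x) :
    Measurable (Function.leftLim x) := by
  refine measurable_of_tendsto_metrizable (f := fun n s => x (gridBefore n s)) (fun n => ?_)
    (tendsto_pi_nhds.2 hx.tendsto_gridBefore)
  have : (fun s => x (gridBefore n s)) = (fun i : ℕ => x (((i - 1 : ℕ) : ℝ≥0) / 2 ^ n)) ∘
      (fun s : ℝ≥0 => ⌈s * 2 ^ n⌉₊) := rfl
  rw [this]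
  exact Measurable.of_discrete.comp (Nat.measurable_ceil.comp (by fun_prop))

/-! ### Constants -/

variable {K J : ℕ}

/-- Common constants for all users: `L` is a Lipschitz constant, `M` bounds the drift and `Λ` is a
constant of linear growth for the connection rates. -/
structure Rates.HasBounds (ρ : Rates K J) (L M Λ : ℝ≥0) : Prop where
  a_le : ∀ k w v, ρ.a k w v ≤ M
  a_lip : ∀ k, LipschitzWith L (fun q : ℝ≥0 × (Fin J → ℝ≥0) => ρ.a k q.1 q.2)
  b_lip : ∀ k, LipschitzWith L (fun q : ℝ≥0 × (Fin J → ℝ≥0) => ρ.b k q.1 q.2)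
  lam_lip : ∀ k, LipschitzWith L (ρ.lam k)
  mu_lip : ∀ k, LipschitzWith L (fun q : ℝ≥0 × (Fin J → ℝ≥0) => ρ.mu k q.1 q.2)
  lam_le : ∀ k v, (ρ.lam k v : ℝ) ≤ Λ * (1 + dist v 0)

lemma Rates.IsRegular.exists_hasBounds {ρ : Rates K J} (hρ : ρ.IsRegular) :
    ∃ L M Λ : ℝ≥0, ρ.HasBounds L M Λ := by
  choose M hM using hρ.a_bounded
  choose La hLa using hρ.a_lipschitz
  choose Lb hLb using hρ.b_lipschitz
  choose Ll hLl using hρ.lam_lipschitz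
  choose Lm hLm using hρ.mu_lipschitz
  have hle : ∀ (f : Fin K → ℝ≥0) k, f k ≤ ∑ i, f i := fun f k =>
    Finset.single_le_sum (fun i _ => zero_le) (Finset.mem_univ k)
  set L := ∑ k, (La k + Lb k + Ll k + Lm k) with hL
  have hk := hle fun k => La k + Lb k + Ll k + Lm k
  refine ⟨L, ∑ k, M k, L + ∑ k, ρ.lam k 0, fun k w v => (hM k w v).trans (hle M k),
    fun k => (hLa k).weaken (le_trans ?_ (hk k)), fun k => (hLb k).weaken (le_trans ?_ (hk k)),
    fun k => (hLl k).weaken (le_trans ?_ (hk k)), fun k => (hLm k).weaken (le_trans ?_ (hk k)),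
    fun k v => ?_⟩
  · exact le_add_right (le_add_right (le_add_right le_rfl))
  · exact le_add_right (le_add_right (le_add_left le_rfl))
  · exact le_add_right (le_add_left le_rfl)
  · exact le_add_left le_rfl
  · have h1 := ((hLl k).weaken (le_trans (by exact le_add_right (le_add_left le_rfl))
      (hk k))).dist_le_mul v 0
    rw [NNReal.dist_eq] at h1
    have h2 : (ρ.lam k 0 : ℝ) ≤ ∑ k, (ρ.lam k 0 : ℝ) := by
      have := hle (fun k => ρ.lam k 0) k
      exact_mod_cast this
    have h3 := (abs_le.1 h1).2
    have h4 : 0 ≤ ∑ k, (ρ.lam k 0 : ℝ) := by positivity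
    have h5 : (0 : ℝ) ≤ dist v 0 := dist_nonneg
    rw [← hL] at h3
    push_cast
    nlinarith [L.coe_nonneg]

lemma abs_sub_le_of_lipschitz {L : ℝ≥0} {f : ℝ≥0 → (Fin J → ℝ≥0) → ℝ≥0}
    (hf : LipschitzWith L (fun q : ℝ≥0 × (Fin J → ℝ≥0) => f q.1 q.2)) (x x' : ℝ)
    (v v' : Fin J → ℝ≥0) :
    |(f x.toNNReal v : ℝ) - f x'.toNNReal v'| ≤ L * (|x - x'| + dist v v') := by
  have h := hf.dist_le_mul (x.toNNReal, v) (x'.toNNReal, v')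
  rw [NNReal.dist_eq, Prod.dist_eq] at h
  refine h.trans (mul_le_mul_of_nonneg_left ?_ L.coe_nonneg)
  have h2 : dist x.toNNReal x'.toNNReal ≤ |x - x'| := by
    rw [NNReal.dist_eq, Real.coe_toNNReal', Real.coe_toNNReal']
    exact abs_max_sub_max_le_abs x x' 0
  have h3 : (0 : ℝ) ≤ dist v v' := dist_nonneg
  exact max_le (h2.trans (le_add_of_nonneg_right h3)) (le_add_of_nonneg_left (abs_nonneg _))

/-! ### The equation along one path -/

section Path

variable (ρ : Rates K J) (r : Fin K → ℝ) (u : ℝ≥0 → Fin J → ℝ≥0) (k : Fin K)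

/-- The rate at which points of the kind of `p` act on the state `x`, at the time of `p`. -/
def threshold (p : Pt) (x : ℝ) : ℝ≥0 :=
  if p.1 = 0 then ρ.lam k (u p.time) else if p.1 = 1 then ρ.b k x.toNNReal (u p.time)
  else ρ.mu k x.toNNReal (u p.time)

/-- The state `x` is one on which points of the kind of `p` can act: OFF for connections, ON for
losses and disconnections. -/
def Concerns (p : Pt) (x : ℝ) : Prop := if p.1 = 0 then x = -1 else 0 ≤ x

/-- The point `p` acts on the state `x`. -/
def Acts (p : Pt) (x : ℝ) : Prop :=
  Concerns p x ∧ 0 < p.height ∧ p.height < threshold ρ u k p x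

/-- The change of the state `x` if the point `p` acts on it. -/
def jumpSize (p : Pt) (x : ℝ) : ℝ :=
  if p.1 = 0 then 1 + (p.2.1 : ℝ) else if p.1 = 1 then -((1 - r k) * x) else -(1 + x)

open Classical in
/-- The change of the state `x` at the point `p`. -/
noncomputable def incr (p : Pt) (x : ℝ) : ℝ := if Acts ρ u k p x then jumpSize r k p x else 0

/-- The velocity at time `s` in the state `x`. -/
noncomputable def speed (s : ℝ≥0) (x : ℝ) : ℝ := if 0 ≤ x then (ρ.a k x.toNNReal (u s) : ℝ) else 0

/-- The path `x` started at `x₀` solves the equation of user `k` driven by the points `q`. -/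
structure PathSol (q : Measure Pt) (x₀ : ℝ) (x : ℝ≥0 → ℝ) : Prop where
  state : ∀ t, x t ∈ stateSpace
  cadlag : IsCadlag x
  integrable_drift : ∀ t, IntegrableOn (drift ρ u k x) (Ioc 0 t) leb
  integrable_incr : ∀ t, IntegrableOn (fun p => incr ρ r u k p (Function.leftLim x p.time))
    {p | p.time ∈ Ioc 0 t} q
  equation : ∀ t, x t = x₀ + ∫ p in {p | p.time ∈ Ioc 0 t},
    incr ρ r u k p (Function.leftLim x p.time) ∂q + ∫ s in Ioc 0 t, drift ρ u k x s ∂leb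

variable {ρ r u k}

lemma drift_eq_speed (x : ℝ≥0 → ℝ) (s : ℝ≥0) :
    drift ρ u k x s = speed ρ u k s (Function.leftLim x s) := rfl

lemma incr_conn (x : ℝ≥0 → ℝ) (p : ℝ≥0 × ℝ≥0 × ℝ≥0) :
    incr ρ r u k (conn p) (Function.leftLim x (conn p).time) = onJump ρ u k x p := by
  simp only [incr, Acts, Concerns, threshold, jumpSize, conn, if_true, onJump]
  rfl

lemma incr_plain_one (x : ℝ≥0 → ℝ) (p : ℝ≥0 × ℝ≥0) :
    incr ρ r u k (plain 1 p) (Function.leftLim x (plain 1 p).time) = -lossJump ρ r u k x p := by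
  simp only [incr, Acts, Concerns, threshold, jumpSize, plain, lossJump, one_ne_zero, if_false,
    if_true]
  rw [apply_ite Neg.neg, neg_zero]
  rfl

lemma incr_plain_two (x : ℝ≥0 → ℝ) (p : ℝ≥0 × ℝ≥0) :
    incr ρ r u k (plain 2 p) (Function.leftLim x (plain 2 p).time) = -offJump ρ u k x p := by
  have h0 : (2 : Fin 3) ≠ 0 := by decide
  have h1 : (2 : Fin 3) ≠ 1 := by decide
  simp only [incr, Acts, Concerns, threshold, jumpSize, plain, offJump, h0, h1, if_false]
  rw [apply_ite Neg.neg, neg_zero]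
  rfl

lemma integrableOn_incr_combine {a : Measure (ℝ≥0 × ℝ≥0 × ℝ≥0)} {n d : Measure (ℝ≥0 × ℝ≥0)}
    {x : ℝ≥0 → ℝ} {t : ℝ≥0} :
    IntegrableOn (fun p => incr ρ r u k p (Function.leftLim x p.time)) {p | p.time ∈ Ioc 0 t}
      (combine a n d) ↔
    IntegrableOn (onJump ρ u k x) {p | p.2.2 ∈ Ioc 0 t} a ∧
    IntegrableOn (lossJump ρ r u k x) {p | p.2 ∈ Ioc 0 t} n ∧
    IntegrableOn (offJump ρ u k x) {p | p.2 ∈ Ioc 0 t} d := by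
  have h1 : (fun p => incr ρ r u k p (Function.leftLim x p.time)) ∘ plain 1 =
      -lossJump ρ r u k x := funext fun p => incr_plain_one x p
  have h2 : (fun p => incr ρ r u k p (Function.leftLim x p.time)) ∘ plain 2 =
      -offJump ρ u k x := funext fun p => incr_plain_two x p
  have h0 : (fun p => incr ρ r u k p (Function.leftLim x p.time)) ∘ conn =
      onJump ρ u k x := funext fun p => incr_conn x p
  rw [combine, integrableOn_add_measure, integrableOn_add_measure,
    measurableEmbedding_conn.integrableOn_map_iff, h0,
    (measurableEmbedding_plain 1).integrableOn_map_iff, h1,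
    (measurableEmbedding_plain 2).integrableOn_map_iff, h2, and_assoc, IntegrableOn, IntegrableOn,
    IntegrableOn, integrable_neg_iff, integrable_neg_iff]
  rfl

lemma setIntegral_incr_combine {a : Measure (ℝ≥0 × ℝ≥0 × ℝ≥0)} {n d : Measure (ℝ≥0 × ℝ≥0)}
    {x : ℝ≥0 → ℝ} {t : ℝ≥0}
    (h : IntegrableOn (fun p => incr ρ r u k p (Function.leftLim x p.time))
      {p | p.time ∈ Ioc 0 t} (combine a n d)) :
    ∫ p in {p | p.time ∈ Ioc 0 t}, incr ρ r u k p (Function.leftLim x p.time) ∂combine a n d =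
      ∫ p in {p | p.2.2 ∈ Ioc 0 t}, onJump ρ u k x p ∂a
      - ∫ p in {p | p.2 ∈ Ioc 0 t}, lossJump ρ r u k x p ∂n
      - ∫ p in {p | p.2 ∈ Ioc 0 t}, offJump ρ u k x p ∂d := by
  rw [combine, integrableOn_add_measure, integrableOn_add_measure] at h
  rw [combine, Measure.restrict_add, Measure.restrict_add,
    integral_add_measure (Integrable.add_measure h.1.1 h.1.2) h.2, integral_add_measure h.1.1 h.1.2,
    measurableEmbedding_conn.setIntegral_map, (measurableEmbedding_plain 1).setIntegral_map,
    (measurableEmbedding_plain 2).setIntegral_map]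
  simp_rw [incr_conn, incr_plain_one, incr_plain_two, integral_neg]
  rfl

end Path

/-! ### Solutions path by path -/

section Solutions

variable {ρ : Rates K J} {r : Fin K → ℝ} {u : ℝ≥0 → Fin J → ℝ≥0} {Ω : Type*}
  {H : MeasurableSpace Ω} [mΩ : MeasurableSpace Ω] {P : Measure Ω} {η : Noise K Ω}
  {X₀ : Ω → Fin K → ℝ} {X : ℝ≥0 → Ω → Fin K → ℝ}

lemma IsSolution.ae_pathSol (h : IsSolution H P ρ r η u X₀ X) :
    ∀ᵐ ω ∂P, ∀ k, PathSol ρ r u k (η.points k ω) (X₀ ω k) (fun s => X s ω k) := by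
  filter_upwards [h.state, h.cadlag, h.integrable, h.equation] with ω h1 h2 h3 h4 k
  have hi : ∀ t, IntegrableOn (fun p => incr ρ r u k p
      (Function.leftLim (fun s => X s ω k) p.time)) {p | p.time ∈ Ioc 0 t} (η.points k ω) :=
    fun t => integrableOn_incr_combine.2 (h3 t k).2
  refine ⟨fun t => h1 t k, h2 k, fun t => (h3 t k).1, hi, fun t => ?_⟩
  have := setIntegral_incr_combine (hi t)
  rw [Noise.points, this, h4 t k]
  ring

lemma isSolution_of_ae_pathSol (hm : ∀ t, Measurable[mΩ] (X t))
    (ha : ∀ t, AEStronglyMeasurable[H ⊔ η.sigmaUpTo t] (X t) P)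
    (h : ∀ᵐ ω ∂P, ∀ k, PathSol ρ r u k (η.points k ω) (X₀ ω k) (fun s => X s ω k)) :
    IsSolution H P ρ r η u X₀ X where
  measurable := hm
  adapted := ha
  state := by filter_upwards [h] with ω hω t k using (hω k).state t
  cadlag := by filter_upwards [h] with ω hω k using (hω k).cadlag
  integrable := by
    filter_upwards [h] with ω hω t k
    exact ⟨(hω k).integrable_drift t, integrableOn_incr_combine.1 ((hω k).integrable_incr t)⟩
  equation := by
    filter_upwards [h] with ω hω t k
    have := setIntegral_incr_combine ((hω k).integrable_incr t)
    rw [(hω k).equation t, Noise.points, this]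
    ring

end Solutions

end OnOffNetwork

namespace OnOffNetwork

open Pt

/-! ### Integrals over the half-line -/

lemma map_coe_leb : leb.map ((↑) : ℝ≥0 → ℝ) = volume.restrict (Ici 0) := by
  have := (MeasurableEmbedding.subtype_coe (measurableSet_Ici (a := (0 : ℝ)))).map_comap volume
  rw [Subtype.range_coe] at this
  exact this

lemma setIntegral_leb (f : ℝ≥0 → ℝ) {a b : ℝ≥0} (hab : a ≤ b) :
    ∫ s in Ioc a b, f s ∂leb = ∫ τ in (a : ℝ)..b, f τ.toNNReal := by
  rw [intervalIntegral.integral_of_le (by exact_mod_cast hab)]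
  have h : ∫ τ in Ioc (a : ℝ) b, f τ.toNNReal ∂(leb.map ((↑) : ℝ≥0 → ℝ)) =
      ∫ s in Ioc a b, f (s : ℝ).toNNReal ∂leb :=
    (MeasurableEmbedding.subtype_coe (measurableSet_Ici (a := (0 : ℝ)))).setIntegral_map
      (μ := leb) (fun τ : ℝ => f τ.toNNReal) (Ioc (a : ℝ) b)
  rw [map_coe_leb, Measure.restrict_restrict measurableSet_Ioc, inter_eq_left.2] at h
  · rw [h]
    simp only [Real.toNNReal_coe]
  · exact fun x hx => a.coe_nonneg.trans hx.1.le

lemma leb_Ioc_lt_top (a b : ℝ≥0) : leb (Ioc a b) < ∞ := by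
  rw [leb_Ioc]; exact ENNReal.ofReal_lt_top

lemma integrableOn_leb_of_bounded {f : ℝ≥0 → ℝ} (hf : Measurable f) {C : ℝ} {a b : ℝ≥0}
    (hC : ∀ s ∈ Ioc a b, |f s| ≤ C) : IntegrableOn f (Ioc a b) leb :=
  IntegrableOn.of_bound (leb_Ioc_lt_top a b) hf.aestronglyMeasurable C
    ((ae_restrict_iff' measurableSet_Ioc).2 (Eventually.of_forall hC))

lemma setIntegral_leb_const (c : ℝ) {a b : ℝ≥0} (hab : a ≤ b) :
    ∫ _ in Ioc a b, c ∂leb = c * (b - a) := by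
  rw [setIntegral_leb _ hab]; simp; ring

lemma setIntegral_leb_add {f : ℝ≥0 → ℝ} {a b c : ℝ≥0} (hab : a ≤ b) (hbc : b ≤ c)
    (hf : IntegrableOn f (Ioc a c) leb) :
    ∫ s in Ioc a c, f s ∂leb = ∫ s in Ioc a b, f s ∂leb + ∫ s in Ioc b c, f s ∂leb := by
  rw [← Ioc_union_Ioc_eq_Ioc hab hbc]
  exact setIntegral_union (Ioc_disjoint_Ioc_of_le le_rfl) measurableSet_Ioc
    (hf.mono_set (Ioc_subset_Ioc_right hbc)) (hf.mono_set (Ioc_subset_Ioc_left hab))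

/-! ### Grönwall's inequality and real induction -/

lemma integral_gronwall {g δ : ℝ → ℝ} (hg : Continuous g) (hδ : Continuous δ) (hδ0 : ∀ τ, 0 ≤ δ τ)
    {c L t : ℝ} (hL : 0 ≤ L) (ht : 0 ≤ t)
    (h : ∀ τ ∈ Icc 0 t, g τ ≤ c + ∫ σ in (0 : ℝ)..τ, L * (g σ + δ σ)) :
    g t ≤ Real.exp (L * t) * (c + L * ∫ σ in (0 : ℝ)..t, δ σ) := by
  set V : ℝ → ℝ := fun τ => c + ∫ σ in (0 : ℝ)..τ, L * (g σ + δ σ) with hV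
  have hVd : ∀ τ, HasDerivAt V (L * (g τ + δ τ)) τ := fun τ =>
    (intervalIntegral.integral_hasDerivAt_right
      ((by fun_prop : Continuous fun σ => L * (g σ + δ σ)).intervalIntegrable _ _)
      ((by fun_prop : Continuous fun σ => L * (g σ + δ σ)).stronglyMeasurableAtFilter _ _)
      (by fun_prop : Continuous fun σ => L * (g σ + δ σ)).continuousAt).const_add c
  have hDd : ∀ τ, HasDerivAt (fun τ => ∫ σ in (0 : ℝ)..τ, δ σ) (δ τ) τ := fun τ =>
    intervalIntegral.integral_hasDerivAt_right (hδ.intervalIntegrable _ _)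
      (hδ.stronglyMeasurableAtFilter _ _) hδ.continuousAt
  set W : ℝ → ℝ := fun τ => Real.exp (-(L * τ)) * V τ - L * ∫ σ in (0 : ℝ)..τ, δ σ with hW
  have hWd : ∀ τ, HasDerivAt W (Real.exp (-(L * τ)) * (-L) * V τ +
      Real.exp (-(L * τ)) * (L * (g τ + δ τ)) - L * δ τ) τ := fun τ => by
    have h1 : HasDerivAt (fun τ : ℝ => -(L * τ)) (-L) τ := by
      simpa using ((hasDerivAt_id τ).const_mul L).fun_neg
    exact (h1.exp.mul (hVd τ)).sub ((hDd τ).const_mul L)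
  have hanti : AntitoneOn W (Icc 0 t) := by
    refine antitoneOn_of_deriv_nonpos (convex_Icc 0 t)
      (fun τ _ => (hWd τ).continuousAt.continuousWithinAt)
      (fun τ _ => (hWd τ).differentiableAt.differentiableWithinAt) fun τ hτ => ?_
    rw [interior_Icc] at hτ
    rw [(hWd τ).deriv]
    have h1 := h τ ⟨hτ.1.le, hτ.2.le⟩
    have h2 : Real.exp (-(L * τ)) ≤ 1 :=
      Real.exp_le_one_iff.2 (neg_nonpos.2 (mul_nonneg hL hτ.1.le))
    have h3 := Real.exp_pos (-(L * τ))
    have h4 : Real.exp (-(L * τ)) * L * (g τ - V τ) ≤ 0 :=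
      mul_nonpos_of_nonneg_of_nonpos (by positivity) (sub_nonpos.2 h1)
    have h5 : (Real.exp (-(L * τ)) - 1) * (L * δ τ) ≤ 0 :=
      mul_nonpos_of_nonpos_of_nonneg (by linarith) (mul_nonneg hL (hδ0 τ))
    linarith
  have h0 := hanti (left_mem_Icc.2 ht) (right_mem_Icc.2 ht) ht
  have hW0 : W 0 = c := by simp [hW, hV]
  rw [hW0] at h0
  have h1 := h t (right_mem_Icc.2 ht)
  have h2 : V t = Real.exp (L * t) * (Real.exp (-(L * t)) * V t) := by
    rw [← mul_assoc, ← Real.exp_add]; simp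
  calc g t ≤ V t := h1
    _ = Real.exp (L * t) * (Real.exp (-(L * t)) * V t) := h2
    _ ≤ Real.exp (L * t) * (c + L * ∫ σ in (0 : ℝ)..t, δ σ) := by
      refine mul_le_mul_of_nonneg_left ?_ (Real.exp_pos _).le
      simp only [hW] at h0
      linarith

/-- Induction along a half-line: a property that holds at `0`, passes to limits from the left and
propagates a little to the right holds throughout. -/
lemma real_induction {p : ℝ≥0 → Prop} {T : ℝ≥0} (h0 : p 0)
    (hl : ∀ t, 0 < t → t ≤ T → (∀ s < t, p s) → p t)
    (hr : ∀ t < T, (∀ s ≤ t, p s) → ∀ᶠ s in 𝓝[>] t, p s) : ∀ t ≤ T, p t := by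
  by_contra! hcon
  obtain ⟨t₁, ht₁, hp₁⟩ := hcon
  -- the infimum of the set of counterexamples
  set B := {t | t ≤ T ∧ ¬ p t} with hB
  have hne : B.Nonempty := ⟨t₁, ht₁, hp₁⟩
  set c := sInf B with hc
  have hcT : c ≤ T := (csInf_le (OrderBot.bddBelow _) hne.some_mem).trans hne.some_mem.1
  have hbelow : ∀ s < c, p s := fun s hs => by
    by_contra hps
    exact absurd (csInf_le (OrderBot.bddBelow _) (show s ∈ B from ⟨hs.le.trans hcT, hps⟩))
      (not_le.2 hs)
  have hpc : p c := by
    rcases eq_or_ne c 0 with h | h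
    · rw [h]; exact h0
    · exact hl c (pos_iff_ne_zero.2 h) hcT hbelow
  have hcT' : c < T := by
    refine lt_of_le_of_ne hcT fun h => ?_
    refine hp₁ ?_
    rcases lt_or_eq_of_le ht₁ with h' | h'
    · exact hbelow _ (h ▸ h')
    · rw [h', ← h]; exact hpc
  have hev := hr c hcT' fun s hs => (lt_or_eq_of_le hs).elim (hbelow s) fun h => h ▸ hpc
  obtain ⟨d, hd, hd'⟩ := (mem_nhdsGT_iff_exists_Ioo_subset' hcT').1 hev
  obtain ⟨s, hsB, hsd⟩ := exists_lt_of_csInf_lt hne (show sInf B < d from hd)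
  rcases lt_or_ge c s with h | h
  · exact hsB.2 (hd' ⟨h, hsd⟩)
  · exact hsB.2 ((lt_or_eq_of_le h).elim (hbelow s) fun h => h ▸ hpc)

/-! ### Separated point configurations -/

lemma exists_mem_cell {s : ℝ≥0} (hs : 0 < s) (j : ℕ) {N : ℕ} (hN : s ≤ N) :
    ∃ i < N * 2 ^ j, s ∈ cell j i := by
  have h2 : (0 : ℝ≥0) < 2 ^ j := by positivity
  have hpos : 0 < ⌈s * 2 ^ j⌉₊ := Nat.ceil_pos.2 (by positivity)
  refine ⟨⌈s * 2 ^ j⌉₊ - 1, ?_, ?_, ?_⟩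
  · have : ⌈s * 2 ^ j⌉₊ ≤ N * 2 ^ j := by
      rw [Nat.ceil_le]; push_cast; gcongr
    omega
  · exact gridBefore_lt hs
  · rw [Nat.sub_add_cancel hpos, le_div_iff₀ h2]
    exact Nat.le_ceil _

lemma measurableSet_height_time (R : ℝ≥0) {I : Set ℝ≥0} (hI : MeasurableSet I) :
    MeasurableSet {p : Pt | p.height ≤ R ∧ p.time ∈ I} :=
  (measurableSet_le measurable_height measurable_const : MeasurableSet {p | height p ≤ R}).inter
    (measurable_time hI)

namespace IsSeparated

variable {q : Measure Pt} (hq : IsSeparated q)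
include hq

lemma lt_top (R : ℝ≥0) (t : ℝ≥0) : q {p | p.height ≤ R ∧ p.time ∈ Ioc 0 t} < ∞ := by
  obtain ⟨R', hR⟩ := exists_nat_ge R
  obtain ⟨N, hN⟩ := exists_nat_ge t
  obtain ⟨j, hj⟩ := hq.cell_le R' N
  calc q {p | p.height ≤ R ∧ p.time ∈ Ioc 0 t}
      ≤ q (⋃ i ∈ Finset.range (N * 2 ^ j), {p | p.height ≤ R' ∧ p.time ∈ cell j i}) := by
        refine measure_mono fun p hp => ?_
        obtain ⟨i, hi, hi'⟩ := exists_mem_cell hp.2.1 j (hp.2.2.trans hN)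
        simp only [mem_iUnion, Finset.mem_range]
        exact ⟨i, hi, hp.1.trans hR, hi'⟩
    _ ≤ ∑ i ∈ Finset.range (N * 2 ^ j), 1 := (measure_biUnion_finset_le _ _).trans
        (Finset.sum_le_sum fun i hi => hj i (Finset.mem_range.1 hi))
    _ < ∞ := by
        rw [Finset.sum_const, nsmul_one]
        exact ENNReal.natCast_lt_top _

lemma slice_le (R : ℝ≥0) {t : ℝ≥0} (ht : 0 < t) :
    q {p | p.height ≤ R ∧ p.time ∈ ({t} : Set ℝ≥0)} ≤ 1 := by
  obtain ⟨R', hR⟩ := exists_nat_ge R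
  obtain ⟨N, hN⟩ := exists_nat_ge t
  obtain ⟨j, hj⟩ := hq.cell_le R' N
  obtain ⟨i, hi, hi'⟩ := exists_mem_cell ht j hN
  refine (measure_mono fun p hp => ?_).trans (hj i hi)
  have : p.time = t := hp.2
  exact ⟨hp.1.trans hR, by rw [mem_ofPred_eq] at *; exact this ▸ hi'⟩

lemma restrict_eq_zero_or_dirac {W : Set Pt} (hW : MeasurableSet W) (h : q W ≤ 1) :
    q.restrict W = 0 ∨ ∃ p ∈ W, q {p} = 1 ∧ q.restrict W = Measure.dirac p := by
  rcases (hq.integerValued.restrict hW).eq_zero_or_eq_dirac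
    (by rwa [Measure.restrict_apply_univ]) with h0 | ⟨p, hp⟩
  · exact Or.inl h0
  · right
    have hpW : p ∈ W := by
      by_contra hpW
      have h1 : q.restrict W Wᶜ = 0 := by rw [Measure.restrict_apply hW.compl]; simp
      rw [hp, Measure.dirac_apply' _ hW.compl] at h1
      simp [hpW] at h1
    refine ⟨p, hpW, ?_, hp⟩
    have h1 : q.restrict W {p} = 1 := by rw [hp]; simp
    rw [Measure.restrict_apply (measurableSet_singleton p)] at h1
    rwa [inter_eq_left.2 (singleton_subset_iff.2 hpW)] at h1

/-- Right after a given time there are no points of bounded height. -/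
lemma eventually_no_points (R t : ℝ≥0) :
    ∀ᶠ s in 𝓝[>] t, q {p | p.height ≤ R ∧ p.time ∈ Ioc t s} = 0 := by
  have hanti : Antitone fun n : ℕ =>
      {p : Pt | p.height ≤ R ∧ p.time ∈ Ioc t (t + 1 / (n + 1))} := by
    intro n m hnm p hp
    refine ⟨hp.1, hp.2.1, hp.2.2.trans ?_⟩
    gcongr
  have hinter : ⋂ n : ℕ, {p : Pt | p.height ≤ R ∧ p.time ∈ Ioc t (t + 1 / (n + 1))} = ∅ := by
    ext p
    simp only [mem_iInter, mem_ofPred_eq, mem_empty_iff_false, iff_false, not_forall]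
    by_cases hp : t < p.time
    · obtain ⟨n, hn⟩ := exists_nat_one_div_lt (show (0 : ℝ≥0) < p.time - t from tsub_pos_of_lt hp)
      refine ⟨n, fun h => absurd h.2.2 (not_le.2 ?_)⟩
      exact lt_tsub_iff_left.1 hn
    · exact ⟨0, fun h => hp h.2.1⟩
  have hlim := tendsto_measure_iInter_atTop (μ := q)
    (fun n => (measurableSet_height_time R measurableSet_Ioc).nullMeasurableSet) hanti
    ⟨0, ((measure_mono (t := {p : Pt | p.height ≤ R ∧ p.time ∈ Ioc 0 (t + 1 / ((0 : ℕ) + 1))})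
      fun p hp => ⟨hp.1, bot_le.trans_lt hp.2.1, hp.2.2⟩).trans_lt (hq.lt_top R _)).ne⟩
  rw [hinter, measure_empty] at hlim
  obtain ⟨n, hn⟩ := (hlim.eventually (gt_mem_nhds zero_lt_one)).exists
  have h0 := hq.integerValued.eq_zero_of_lt_one (measurableSet_height_time R measurableSet_Ioc) hn
  have hpos : t < t + 1 / ((n : ℝ≥0) + 1) := lt_add_of_pos_right _ (by positivity)
  filter_upwards [Ioo_mem_nhdsGT hpos] with s hs
  exact measure_mono_null
    (t := {p : Pt | p.height ≤ R ∧ p.time ∈ Ioc t (t + 1 / ((n : ℝ≥0) + 1))})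
    (fun p hp => ⟨hp.1, hp.2.1, hp.2.2.trans hs.2.le⟩) h0

end IsSeparated

end OnOffNetwork

namespace OnOffNetwork

open Pt

/-! ### Paths of solutions -/

lemma measurableSet_time {I : Set ℝ≥0} (hI : MeasurableSet I) :
    MeasurableSet {p : Pt | p.time ∈ I} := measurable_time hI

lemma IsSeparated.eq_of_time_eq {q : Measure Pt} (hq : IsSeparated q) {p p' : Pt}
    (hp : q {p} = 1) (hp' : q {p'} = 1) (h0 : 0 < p.time) (h : p.time = p'.time) : p = p' := by
  by_contra hne
  have h1 := hq.slice_le (max p.height p'.height) h0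
  have h2 : q ({p} ∪ {p'}) ≤ 1 := by
    refine (measure_mono fun z hz => ?_).trans h1
    rcases hz with hz | hz
    · rw [hz]; exact ⟨le_max_left _ _, rfl⟩
    · rw [hz]; exact ⟨le_max_right _ _, h.symm⟩
  rw [measure_union (disjoint_singleton.2 hne) (measurableSet_singleton p'), hp, hp'] at h2
  norm_num at h2

/-- Integrals over the times in `(s, t]` converge to the one over the time `t` as `s` increases
to `t` along the grids. -/
lemma tendsto_setIntegral_gridBefore {E : Type*} [MeasurableSpace E] {T : E → ℝ≥0}
    (hT : Measurable T) {ν : Measure E} {f : E → ℝ} {t : ℝ≥0} (ht : 0 < t)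
    (hf : IntegrableOn f {p | T p ∈ Ioc 0 t} ν) :
    Tendsto (fun n => ∫ p in {p | T p ∈ Ioc (gridBefore n t) t}, f p ∂ν) atTop
      (𝓝 (∫ p in {p | T p ∈ ({t} : Set ℝ≥0)}, f p ∂ν)) := by
  have hm : ∀ I : Set ℝ≥0, MeasurableSet I → MeasurableSet {p | T p ∈ I} := fun I hI => hT hI
  have hsub : ∀ I ⊆ Ioc 0 t, ∫ p in {p | T p ∈ I}, f p ∂ν =
      ∫ p in {p | T p ∈ I}, f p ∂(ν.restrict {p | T p ∈ Ioc 0 t}) := fun I hI => by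
    rw [Measure.restrict_restrict_of_subset (show {p | T p ∈ I} ⊆ {p | T p ∈ Ioc 0 t} from
      fun p hp => hI hp)]
  rw [hsub _ (singleton_subset_iff.2 ⟨ht, le_rfl⟩)]
  simp_rw [fun n => hsub (Ioc (gridBefore n t) t) (Ioc_subset_Ioc_left bot_le)]
  rw [← integral_indicator (hm _ (measurableSet_singleton t))]
  simp_rw [fun n => (integral_indicator (μ := ν.restrict {p | T p ∈ Ioc 0 t}) (f := f)
    (hm (Ioc (gridBefore n t) t) measurableSet_Ioc)).symm]
  refine tendsto_integral_of_dominated_convergence (fun p => ‖f p‖)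
    (fun n => (hf.1.indicator (hm _ measurableSet_Ioc))) hf.norm
    (fun n => Eventually.of_forall fun p => norm_indicator_le_norm_self _ _)
    (Eventually.of_forall fun p => ?_)
  refine tendsto_const_nhds.congr' ?_
  rcases lt_trichotomy (T p) t with h | h | h
  · filter_upwards [(tendsto_gridBefore t).eventually (lt_mem_nhds h)] with n hn
    rw [indicator_of_notMem, indicator_of_notMem]
    · exact fun h' => absurd h'.1 (not_lt.2 hn.le)
    · exact fun h' => h.ne h'
  · refine Eventually.of_forall fun n => ?_
    exact (indicator_of_mem (show p ∈ {p | T p ∈ ({t} : Set ℝ≥0)} from h) f).trans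
      (indicator_of_mem (show p ∈ {p | T p ∈ Ioc (gridBefore n t) t} from
        ⟨by rw [h]; exact gridBefore_lt ht, h.le⟩) f).symm
  · refine Eventually.of_forall fun n => ?_
    exact (indicator_of_notMem (show p ∉ {p | T p ∈ ({t} : Set ℝ≥0)} from h.ne') f).trans
      (indicator_of_notMem (show p ∉ {p | T p ∈ Ioc (gridBefore n t) t} from
        fun h' => absurd h'.2 (not_le.2 h)) f).symm

lemma isClosed_stateSpace : IsClosed stateSpace :=
  (isClosed_singleton (x := (-1 : ℝ))).union (isClosed_Ici (a := (0 : ℝ)))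

lemma neg_one_le_of_mem_stateSpace {x : ℝ} (hx : x ∈ stateSpace) : -1 ≤ x := by
  rcases hx with h | h <;> linarith

lemma eq_neg_one_of_mem_stateSpace {x : ℝ} (hx : x ∈ stateSpace) (h : ¬ 0 ≤ x) : x = -1 :=
  hx.resolve_right h

variable {K J : ℕ} {ρ : Rates K J} {r : Fin K → ℝ} {u u' : ℝ≥0 → Fin J → ℝ≥0} {k : Fin K}
  {L M Λ : ℝ≥0}

lemma exists_dist_le (hu : Continuous u) (t : ℝ≥0) : ∃ U : ℝ≥0, ∀ s ≤ t, dist (u s) 0 ≤ U := by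
  obtain ⟨C, hC⟩ := (isCompact_Icc (a := (0 : ℝ≥0)) (b := t)).exists_bound_of_continuousOn
    (f := fun s => dist (u s) 0) (by fun_prop)
  refine ⟨C.toNNReal, fun s hs => ?_⟩
  exact (le_abs_self _).trans ((hC s ⟨bot_le, hs⟩).trans (Real.le_coe_toNNReal C))

/-- On bounded time intervals, points above a certain height do not act on bounded states. -/
lemma Rates.HasBounds.exists_threshold_le (hb : ρ.HasBounds L M Λ) (hu : Continuous u) (k : Fin K)
    (t : ℝ≥0) (B : ℝ) : ∃ R : ℝ≥0, ∀ p x, p.time ≤ t → |x| ≤ B → threshold ρ u k p x ≤ R := by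
  obtain ⟨U, hU⟩ := exists_dist_le hu t
  have hgen : ∀ f : ℝ≥0 → (Fin J → ℝ≥0) → ℝ≥0,
      LipschitzWith L (fun q : ℝ≥0 × (Fin J → ℝ≥0) => f q.1 q.2) → ∀ s x, s ≤ t → |x| ≤ B →
      f x.toNNReal (u s) ≤ f 0 0 + L * (B.toNNReal + U) := fun f hf s x hs hx => by
    have h1 := (abs_le.1 (abs_sub_le_of_lipschitz hf x 0 (u s) 0)).2
    rw [sub_zero, Real.toNNReal_zero] at h1
    have h2 := mul_le_mul_of_nonneg_left
      (add_le_add (hx.trans (Real.le_coe_toNNReal B)) (hU s hs)) L.coe_nonneg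
    rw [← NNReal.coe_le_coe]
    push_cast
    linarith
  have hlam : ∀ s ≤ t, ρ.lam k (u s) ≤ Λ * (1 + U) := fun s hs => by
    rw [← NNReal.coe_le_coe]
    push_cast
    exact (hb.lam_le k (u s)).trans (mul_le_mul_of_nonneg_left
      (add_le_add_right (hU s hs) 1) Λ.coe_nonneg)
  refine ⟨Λ * (1 + U) + (ρ.b k 0 0 + L * (B.toNNReal + U)) +
    (ρ.mu k 0 0 + L * (B.toNNReal + U)), fun p x hp hx => ?_⟩
  unfold threshold
  split_ifs
  · exact le_add_right (le_add_right (hlam _ hp))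
  · exact le_add_right (le_add_left (hgen _ (hb.b_lip k) _ x hp hx))
  · exact le_add_left (hgen _ (hb.mu_lip k) _ x hp hx)

lemma incr_eq_zero_of_threshold_le {p : Pt} {x : ℝ} (h : threshold ρ u k p x ≤ p.height) :
    incr ρ r u k p x = 0 := if_neg fun ha => absurd ha.2.2 (not_lt.2 h)

lemma speed_nonneg (s : ℝ≥0) (x : ℝ) : 0 ≤ speed ρ u k s x := by
  unfold speed; split_ifs <;> positivity

lemma Rates.HasBounds.speed_le (hb : ρ.HasBounds L M Λ) (s : ℝ≥0) (x : ℝ) :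
    speed ρ u k s x ≤ M := by
  unfold speed
  split_ifs
  · exact_mod_cast hb.a_le k _ _
  · exact M.coe_nonneg

lemma add_incr_mem_stateSpace (hr : r k ∈ Icc (0 : ℝ) 1) {p : Pt} {x : ℝ} (hx : x ∈ stateSpace) :
    x + incr ρ r u k p x ∈ stateSpace := by
  unfold incr
  split_ifs with h
  · have h1 := h.1
    unfold Concerns at h1
    unfold jumpSize
    split_ifs at h1 ⊢ with h2 h3
    · right; rw [h1]; have := p.2.1.coe_nonneg; linarith
    · right
      have := mul_nonneg hr.1 h1
      linarith
    · left; ring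
  · rwa [add_zero]

namespace PathSol

variable {q : Measure Pt} {x₀ x₀' : ℝ} {x x' : ℝ≥0 → ℝ}

section Single

variable (hx : PathSol ρ r u k q x₀ x)
include hx

lemma apply_zero : x 0 = x₀ := by
  have := hx.equation 0
  simpa using this

lemma leftLim_mem (t : ℝ≥0) : Function.leftLim x t ∈ stateSpace :=
  isClosed_stateSpace.mem_of_tendsto (hx.cadlag.tendsto_gridBefore t)
    (Eventually.of_forall fun _ => hx.state _)

lemma integrableOn_incr (s t : ℝ≥0) :
    IntegrableOn (fun p => incr ρ r u k p (Function.leftLim x p.time)) {p | p.time ∈ Ioc s t} q :=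
  (hx.integrable_incr t).mono_set fun _ hp => ⟨bot_le.trans_lt hp.1, hp.2⟩

lemma integrableOn_drift (s t : ℝ≥0) : IntegrableOn (drift ρ u k x) (Ioc s t) leb :=
  (hx.integrable_drift t).mono_set (Ioc_subset_Ioc_left bot_le)

lemma increment {s t : ℝ≥0} (hst : s ≤ t) :
    x t = x s + ∫ p in {p | p.time ∈ Ioc s t}, incr ρ r u k p (Function.leftLim x p.time) ∂q
      + ∫ v in Ioc s t, drift ρ u k x v ∂leb := by
  have hset : {p : Pt | p.time ∈ Ioc 0 t} = {p | p.time ∈ Ioc 0 s} ∪ {p | p.time ∈ Ioc s t} := by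
    rw [← Ioc_union_Ioc_eq_Ioc (zero_le : 0 ≤ s) hst]; rfl
  have hdisj : Disjoint {p : Pt | p.time ∈ Ioc 0 s} {p | p.time ∈ Ioc s t} :=
    (Ioc_disjoint_Ioc_of_le le_rfl).preimage Pt.time
  rw [hx.equation t, hx.equation s, hset,
    setIntegral_union hdisj (measurableSet_time measurableSet_Ioc) (hx.integrableOn_incr 0 s)
      (hx.integrableOn_incr s t),
    setIntegral_leb_add (zero_le : 0 ≤ s) hst (hx.integrable_drift t)]
  ring

lemma sub_leftLim {t : ℝ≥0} (ht : 0 < t) :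
    x t = Function.leftLim x t +
      ∫ p in {p | p.time ∈ ({t} : Set ℝ≥0)}, incr ρ r u k p (Function.leftLim x p.time) ∂q := by
  have h1 := (hx.cadlag.tendsto_gridBefore t).add
    (tendsto_setIntegral_gridBefore measurable_time ht (hx.integrable_incr t))
  have h2 := h1.add (tendsto_setIntegral_gridBefore measurable_id ht (hx.integrable_drift t))
  have h3 : ∫ v in {v | id v ∈ ({t} : Set ℝ≥0)}, drift ρ u k x v ∂leb = 0 := by
    have : ({v | id v ∈ ({t} : Set ℝ≥0)} : Set ℝ≥0) = {t} := rfl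
    rw [this, Measure.restrict_eq_zero.2 (leb_singleton t), integral_zero_measure]
  rw [h3, add_zero] at h2
  refine tendsto_nhds_unique (tendsto_const_nhds.congr fun n => ?_) h2
  exact hx.increment (gridBefore_lt ht).le

/-- Right after time `t` the path follows the drift. -/
lemma eventually_eq_add_drift (hb : ρ.HasBounds L M Λ) (hu : Continuous u) (hq : IsSeparated q)
    (t : ℝ≥0) : ∀ᶠ s in 𝓝[>] t, x s = x t + ∫ v in Ioc t s, drift ρ u k x v ∂leb := by
  obtain ⟨R, hR⟩ := hb.exists_threshold_le hu k (t + 1) (|x t| + 1)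
  have hcont : ∀ᶠ s in 𝓝[>] t, |x s| ≤ |x t| + 1 :=
    ((hx.cadlag t).1.mono Ioi_subset_Ici_self).abs.eventually
      (eventually_le_nhds (lt_add_one |x t|))
  obtain ⟨e, he, he'⟩ := (mem_nhdsGT_iff_exists_Ioo_subset' (lt_add_one t)).1 hcont
  filter_upwards [hq.eventually_no_points R t, Ioo_mem_nhdsGT he,
    Ioo_mem_nhdsGT (lt_add_one t)] with s hs hse hs1
  rw [hx.increment hse.1.le]
  congr 1
  rw [add_eq_left]
  have hbound : ∀ v ∈ Ioc t s, |Function.leftLim x v| ≤ |x t| + 1 := fun v hv => by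
    refine le_of_tendsto (hx.cadlag.tendsto_gridBefore v).abs ?_
    filter_upwards [(OnOffNetwork.tendsto_gridBefore v).eventually (lt_mem_nhds hv.1)] with n hn
    exact he' ⟨hn, (gridBefore_lt (bot_le.trans_lt hv.1)).trans_le (hv.2.trans hse.2.le)⟩
  have hsplit : ∀ p ∈ {p : Pt | p.time ∈ Ioc t s} \ {p | p.height ≤ R ∧ p.time ∈ Ioc t s},
      incr ρ r u k p (Function.leftLim x p.time) = 0 := fun p hp => by
    refine incr_eq_zero_of_threshold_le ((hR p _ (hp.1.2.trans hs1.2.le) (hbound _ hp.1)).trans ?_)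
    by_contra hlt
    exact hp.2 ⟨(not_le.1 hlt).le, hp.1⟩
  rw [setIntegral_eq_of_subset_of_forall_sdiff_eq_zero (measurableSet_time measurableSet_Ioc)
    (fun p hp => hp.2) hsplit, Measure.restrict_eq_zero.2 hs, integral_zero_measure]

end Single

/-- At a given time, two solutions driven by the same points either both do not jump or jump
according to the same point. -/
lemma jump_cases (hx : PathSol ρ r u k q x₀ x) (hx' : PathSol ρ r u' k q x₀' x')
    (hb : ρ.HasBounds L M Λ) (hu : Continuous u) (hu' : Continuous u') (hq : IsSeparated q)
    {t : ℝ≥0} (ht : 0 < t) :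
    (x t = Function.leftLim x t ∧ x' t = Function.leftLim x' t) ∨
    ∃ p : Pt, p.time = t ∧ q {p} = 1 ∧
      x t = Function.leftLim x t + incr ρ r u k p (Function.leftLim x t) ∧
      x' t = Function.leftLim x' t + incr ρ r u' k p (Function.leftLim x' t) := by
  obtain ⟨R₁, hR₁⟩ := hb.exists_threshold_le hu k t |Function.leftLim x t|
  obtain ⟨R₂, hR₂⟩ := hb.exists_threshold_le hu' k t |Function.leftLim x' t|
  set W : Set Pt := {p | p.height ≤ max R₁ R₂ ∧ p.time ∈ ({t} : Set ℝ≥0)} with hW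
  have hWm : MeasurableSet W := measurableSet_height_time _ (measurableSet_singleton t)
  have key : ∀ {u : ℝ≥0 → Fin J → ℝ≥0} {x : ℝ≥0 → ℝ} {R : ℝ≥0}, R ≤ max R₁ R₂ →
      (∀ p y, p.time ≤ t → |y| ≤ |Function.leftLim x t| → threshold ρ u k p y ≤ R) →
      ∫ p in {p | p.time ∈ ({t} : Set ℝ≥0)}, incr ρ r u k p (Function.leftLim x p.time) ∂q =
      ∫ p in W, incr ρ r u k p (Function.leftLim x p.time) ∂q := by
    intro u x R hRm hR
    refine setIntegral_eq_of_subset_of_forall_sdiff_eq_zero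
      (measurableSet_time (measurableSet_singleton t)) (fun p hp => hp.2) fun p hp => ?_
    have hpt : p.time = t := hp.1
    refine incr_eq_zero_of_threshold_le ((hR p _ hpt.le (by rw [hpt])).trans ?_)
    by_contra hlt
    exact hp.2 ⟨(not_le.1 hlt).le.trans hRm, hp.1⟩
  have h1 := hx.sub_leftLim ht
  have h2 := hx'.sub_leftLim ht
  rw [key (le_max_left _ _) hR₁] at h1
  rw [key (le_max_right _ _) hR₂] at h2
  rcases hq.restrict_eq_zero_or_dirac hWm (hq.slice_le _ ht) with h | ⟨p, hpW, hp1, hp⟩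
  · left
    rw [h, integral_zero_measure, add_zero] at h1 h2
    exact ⟨h1, h2⟩
  · right
    rw [hp, integral_dirac] at h1 h2
    have hpt : p.time = t := hpW.2
    rw [hpt] at h1 h2
    exact ⟨p, hpt, hp1, h1, h2⟩

end PathSol

end OnOffNetwork

namespace OnOffNetwork

open Pt

lemma ofReal_integral_le_lintegral_ofReal {E : Type*} [MeasurableSpace E] {ν : Measure E}
    (f : E → ℝ) : ENNReal.ofReal (∫ p, f p ∂ν) ≤ ∫⁻ p, ENNReal.ofReal (f p) ∂ν := by
  by_cases hf : Integrable f ν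
  · rw [integral_eq_lintegral_pos_part_sub_lintegral_neg_part hf]
    exact (ENNReal.ofReal_le_ofReal (sub_le_self _ ENNReal.toReal_nonneg)).trans
      ENNReal.ofReal_toReal_le
  · rw [integral_undef hf, ENNReal.ofReal_zero]
    exact zero_le

variable {K J : ℕ} {ρ : Rates K J} {r : Fin K → ℝ} {u u' : ℝ≥0 → Fin J → ℝ≥0} {k : Fin K}
  {L M Λ : ℝ≥0}

/-! ### Growth of solutions -/

open Classical in
/-- The increment `1 + w` of an OFF user at a connection point that acts on it, and `0` at all
other points. -/
noncomputable def connMass (ρ : Rates K J) (u : ℝ≥0 → Fin J → ℝ≥0) (k : Fin K) (p : Pt) : ℝ≥0∞ :=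
  if p.1 = 0 ∧ p.height < ρ.lam k (u p.time) then 1 + (p.2.1 : ℝ≥0∞) else 0

open Classical in
/-- The increment `1 + w` at the connection points that act on OFF users for exactly one of the
parameter paths `u` and `u'`. -/
noncomputable def connGap (ρ : Rates K J) (u u' : ℝ≥0 → Fin J → ℝ≥0) (k : Fin K) (p : Pt) :
    ℝ≥0∞ :=
  if p.1 = 0 ∧ ¬ (p.height < ρ.lam k (u p.time) ↔ p.height < ρ.lam k (u' p.time)) then
    1 + (p.2.1 : ℝ≥0∞) else 0

lemma connMass_le_add_connGap (p : Pt) :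
    connMass ρ u' k p ≤ connMass ρ u k p + connGap ρ u u' k p := by
  unfold connMass connGap
  split_ifs <;> simp_all

lemma ofReal_one_add (w : ℝ≥0) : ENNReal.ofReal (1 + (w : ℝ)) = 1 + (w : ℝ≥0∞) := by
  rw [ENNReal.ofReal_add zero_le_one w.coe_nonneg, ENNReal.ofReal_one, ENNReal.ofReal_coe_nnreal]

lemma ofReal_incr_le_connMass (hr : r k ∈ Icc (0 : ℝ) 1) (p : Pt) (x : ℝ) :
    ENNReal.ofReal (incr ρ r u k p x) ≤ connMass ρ u k p := by
  unfold incr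
  split_ifs with h
  · obtain ⟨h1, -, h2⟩ := h
    unfold Concerns at h1
    unfold threshold at h2
    unfold jumpSize connMass
    by_cases h0 : p.1 = 0
    · simp only [h0, if_true] at h2 ⊢
      rw [if_pos ⟨trivial, h2⟩, ofReal_one_add]
    · simp only [h0, if_false] at h1 ⊢
      rw [ENNReal.ofReal_of_nonpos]
      · exact zero_le
      · split_ifs
        · have := mul_nonneg (sub_nonneg.2 hr.2) h1
          linarith
        · linarith
  · simp

namespace PathSol

variable {q : Measure Pt} {x₀ x₀' : ℝ} {x x' : ℝ≥0 → ℝ}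

lemma ofReal_add_one_le (hx : PathSol ρ r u k q x₀ x) (hb : ρ.HasBounds L M Λ)
    (hr : r k ∈ Icc (0 : ℝ) 1) {s t : ℝ≥0} (hst : s ≤ t) :
    ENNReal.ofReal (x t + 1) ≤ ENNReal.ofReal (x s + 1) + (M * t : ℝ≥0) +
      ∫⁻ p in {p | p.time ∈ Ioc s t}, connMass ρ u k p ∂q := by
  have h1 : ∫ v in Ioc s t, drift ρ u k x v ∂leb ≤ (M * t : ℝ≥0) := by
    calc ∫ v in Ioc s t, drift ρ u k x v ∂leb
        ≤ ∫ v in Ioc s t, (M : ℝ) ∂leb := by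
          refine setIntegral_mono (hx.integrableOn_drift s t) ?_ fun v => hb.speed_le _ _
          exact integrableOn_leb_of_bounded measurable_const (C := |(M : ℝ)|) fun _ _ => le_rfl
      _ = M * (t - s) := setIntegral_leb_const _ hst
      _ ≤ (M * t : ℝ≥0) := by
          rw [NNReal.coe_mul]
          exact mul_le_mul_of_nonneg_left (sub_le_self _ s.coe_nonneg) M.coe_nonneg
  have h2 := hx.increment hst
  calc ENNReal.ofReal (x t + 1)
      ≤ ENNReal.ofReal ((x s + 1) + (M * t : ℝ≥0) +
          ∫ p in {p | p.time ∈ Ioc s t}, incr ρ r u k p (Function.leftLim x p.time) ∂q) :=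
        ENNReal.ofReal_le_ofReal (by linarith)
    _ ≤ ENNReal.ofReal (x s + 1) + (M * t : ℝ≥0) + ENNReal.ofReal
          (∫ p in {p | p.time ∈ Ioc s t}, incr ρ r u k p (Function.leftLim x p.time) ∂q) := by
        refine ENNReal.ofReal_add_le.trans (add_le_add_left (ENNReal.ofReal_add_le.trans ?_) _)
        rw [ENNReal.ofReal_coe_nnreal]
    _ ≤ _ := by
        refine add_le_add_right ((ofReal_integral_le_lintegral_ofReal _).trans ?_) _
        exact lintegral_mono fun p => ofReal_incr_le_connMass hr p _

end PathSol

/-! ### Coupling of two solutions -/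

/-- Two states are of the same kind: both ON or both OFF. -/
def Coupled (x x' : ℝ) : Prop := 0 ≤ x ↔ 0 ≤ x'

/-- The bound that Grönwall's inequality gives for the distance at time `t` of two solutions that
have initial distance `D` and are always ON or OFF, and always jump, simultaneously. -/
noncomputable def gapBound (L : ℝ≥0) (u u' : ℝ≥0 → Fin J → ℝ≥0) (D : ℝ) (t : ℝ≥0) : ℝ :=
  Real.exp (L * t) * (D + L * ∫ s in Ioc 0 t, dist (u s) (u' s) ∂leb)

/-- The point `p` acts on exactly one of the states `x` and `x'`, which are of the same kind and
at distance at most `d`. The conditions on the states confine the heights of such points to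
an interval between two rates, the difference of which is at most a Lipschitz constant times the sum
of `d` and the distance of the parameters. -/
def Decouples (ρ : Rates K J) (u u' : ℝ≥0 → Fin J → ℝ≥0) (k : Fin K) (d : ℝ) (p : Pt)
    (x x' : ℝ) : Prop :=
  Coupled x x' ∧ |x - x'| ≤ d ∧ ¬ (Acts ρ u k p x ↔ Acts ρ u' k p x')

lemma integrableOn_dist (hu : Continuous u) (hu' : Continuous u') (s t : ℝ≥0) :
    IntegrableOn (fun v => dist (u v) (u' v)) (Ioc s t) leb := by
  have hc : Continuous fun v => dist (u v) (u' v) := hu.dist hu'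
  obtain ⟨C, hC⟩ := (isCompact_Icc (a := s) (b := t)).exists_bound_of_continuousOn hc.continuousOn
  exact integrableOn_leb_of_bounded hc.measurable fun v hv => hC v ⟨hv.1.le, hv.2⟩

lemma setIntegral_dist_mono (hu : Continuous u) (hu' : Continuous u') {s t : ℝ≥0} (hst : s ≤ t) :
    ∫ v in Ioc 0 s, dist (u v) (u' v) ∂leb ≤ ∫ v in Ioc 0 t, dist (u v) (u' v) ∂leb :=
  setIntegral_mono_set (integrableOn_dist hu hu' 0 t)
    (Eventually.of_forall fun _ => dist_nonneg) (Ioc_subset_Ioc_right hst).eventuallyLE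

lemma setIntegral_dist_nonneg (t : ℝ≥0) : 0 ≤ ∫ v in Ioc 0 t, dist (u v) (u' v) ∂leb :=
  integral_nonneg fun _ => dist_nonneg

lemma gapBound_mono (hu : Continuous u) (hu' : Continuous u') {D : ℝ} (hD : 0 ≤ D) {s t : ℝ≥0}
    (hst : s ≤ t) : gapBound L u u' D s ≤ gapBound L u u' D t := by
  have h := setIntegral_dist_mono hu hu' hst
  have h0 := setIntegral_dist_nonneg (u := u) (u' := u') s
  unfold gapBound
  have hst' : (s : ℝ) ≤ t := hst
  gcongr

lemma le_gapBound {D : ℝ} (hD : 0 ≤ D) (t : ℝ≥0) : D ≤ gapBound L u u' D t := by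
  have h0 := setIntegral_dist_nonneg (u := u) (u' := u') t
  have h1 : 1 ≤ Real.exp (L * t) := Real.one_le_exp (by positivity)
  unfold gapBound
  calc D = 1 * (D + 0) := by ring
    _ ≤ _ := by gcongr; positivity

lemma gapBound_nonneg {D : ℝ} (hD : 0 ≤ D) (t : ℝ≥0) : 0 ≤ gapBound L u u' D t :=
  hD.trans (le_gapBound hD t)

lemma Coupled.abs_speed_sub_le (hb : ρ.HasBounds L M Λ) {y y' : ℝ} (h : Coupled y y') (s : ℝ≥0) :
    |speed ρ u k s y - speed ρ u' k s y'| ≤ L * (|y - y'| + dist (u s) (u' s)) := by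
  unfold speed
  by_cases hy : 0 ≤ y
  · rw [if_pos hy, if_pos (h.1 hy)]
    exact abs_sub_le_of_lipschitz (hb.a_lip k) _ _ _ _
  · rw [if_neg hy, if_neg fun h' => hy (h.2 h'), sub_zero, abs_zero]
    have := dist_nonneg (x := u s) (y := u' s)
    positivity

/-- A point that acts on both of two states of the same kind, or on neither of them, keeps them of
the same kind and does not increase their distance. -/
lemma Coupled.add_incr (hr : r k ∈ Icc (0 : ℝ) 1) {y y' : ℝ} (h : Coupled y y') {p : Pt}
    (ha : Acts ρ u k p y ↔ Acts ρ u' k p y') :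
    Coupled (y + incr ρ r u k p y) (y' + incr ρ r u' k p y') ∧
      |(y + incr ρ r u k p y) - (y' + incr ρ r u' k p y')| ≤ |y - y'| := by
  by_cases hp : Acts ρ u k p y
  · have hp' := ha.1 hp
    rw [incr, incr, if_pos hp, if_pos hp']
    have h1 := hp.1
    have h1' := hp'.1
    unfold Concerns at h1 h1'
    unfold jumpSize
    split_ifs at h1 h1' ⊢ with h2 h3
    · rw [h1, h1']
      exact ⟨Iff.rfl, by simp⟩
    · have e1 : y + -((1 - r k) * y) = r k * y := by ring
      have e2 : y' + -((1 - r k) * y') = r k * y' := by ring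
      rw [e1, e2, ← mul_sub, abs_mul, abs_of_nonneg hr.1]
      exact ⟨iff_of_true (mul_nonneg hr.1 h1) (mul_nonneg hr.1 h1'),
        mul_le_of_le_one_left (abs_nonneg _) hr.2⟩
    · have e1 : y + -(1 + y) = -1 := by ring
      have e2 : y' + -(1 + y') = -1 := by ring
      rw [e1, e2]
      exact ⟨Iff.rfl, by simp⟩
  · rw [incr, incr, if_neg hp, if_neg fun h' => hp (ha.2 h'), add_zero, add_zero]
    exact ⟨h, le_rfl⟩

/-- The distance that the difference of the drifts can have caused until time `t`. -/
noncomputable def driftGap (ρ : Rates K J) (u u' : ℝ≥0 → Fin J → ℝ≥0) (k : Fin K)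
    (x x' : ℝ≥0 → ℝ) (t : ℝ≥0) : ℝ :=
  |x 0 - x' 0| + ∫ s in Ioc 0 t, |drift ρ u k x s - drift ρ u' k x' s| ∂leb

/-- Up to time `t` the distance of the two paths is accounted for by the drift. -/
def DriftCoupled (ρ : Rates K J) (u u' : ℝ≥0 → Fin J → ℝ≥0) (k : Fin K) (x x' : ℝ≥0 → ℝ)
    (t : ℝ≥0) : Prop :=
  Coupled (x t) (x' t) ∧ |x t - x' t| ≤ driftGap ρ u u' k x x' t

lemma Rates.HasBounds.measurable_drift (hb : ρ.HasBounds L M Λ) (hu : Continuous u)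
    {x : ℝ≥0 → ℝ} (hx : IsCadlag x) : Measurable (drift ρ u k x) := by
  have h1 := hx.measurable_leftLim
  refine Measurable.ite (measurableSet_le measurable_const h1) ?_ measurable_const
  exact measurable_coe_nnreal_real.comp
    ((hb.a_lip k).continuous.measurable.comp (h1.real_toNNReal.prodMk hu.measurable))

lemma abs_drift_sub_drift_le (hb : ρ.HasBounds L M Λ) (x x' : ℝ≥0 → ℝ) (s : ℝ≥0) :
    |drift ρ u k x s - drift ρ u' k x' s| ≤ M := by
  have h1 := hb.speed_le (u := u) (k := k) s (Function.leftLim x s)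
  have h2 := hb.speed_le (u := u') (k := k) s (Function.leftLim x' s)
  have h3 := speed_nonneg (ρ := ρ) (u := u) (k := k) s (Function.leftLim x s)
  have h4 := speed_nonneg (ρ := ρ) (u := u') (k := k) s (Function.leftLim x' s)
  rw [drift_eq_speed, drift_eq_speed, abs_le]
  constructor <;> linarith

lemma intervalIntegrable_abs_drift_sub (hb : ρ.HasBounds L M Λ) (hu : Continuous u)
    (hu' : Continuous u') {x x' : ℝ≥0 → ℝ} (hx : IsCadlag x) (hx' : IsCadlag x') (a b : ℝ) :
    IntervalIntegrable
      (fun τ : ℝ => |drift ρ u k x τ.toNNReal - drift ρ u' k x' τ.toNNReal|) volume a b := by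
  have hmeas : Measurable fun τ : ℝ =>
      |drift ρ u k x τ.toNNReal - drift ρ u' k x' τ.toNNReal| :=
    (((hb.measurable_drift hu hx).sub (hb.measurable_drift hu' hx')).comp
      measurable_real_toNNReal).abs
  rw [intervalIntegrable_iff]
  refine IntegrableOn.of_bound (by rw [uIoc]; exact measure_Ioc_lt_top) hmeas.aestronglyMeasurable M
    (Eventually.of_forall fun τ => ?_)
  rw [Real.norm_eq_abs, abs_abs]
  exact abs_drift_sub_drift_le hb x x' _

lemma continuous_driftGap (hb : ρ.HasBounds L M Λ) (hu : Continuous u)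
    (hu' : Continuous u') {x x' : ℝ≥0 → ℝ} (hx : IsCadlag x) (hx' : IsCadlag x') :
    Continuous fun τ : ℝ => driftGap ρ u u' k x x' τ.toNNReal := by
  have h1 := intervalIntegral.continuous_primitive
    (intervalIntegrable_abs_drift_sub (k := k) hb hu hu' hx hx') 0
  have h2 : (fun τ : ℝ => driftGap ρ u u' k x x' τ.toNNReal) = fun τ : ℝ => |x 0 - x' 0| +
      ∫ σ in (0 : ℝ)..(τ.toNNReal : ℝ),
        |drift ρ u k x σ.toNNReal - drift ρ u' k x' σ.toNNReal| := by
    funext τ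
    rw [driftGap, setIntegral_leb _ zero_le]
    rfl
  rw [h2]
  exact continuous_const.add (h1.comp (NNReal.continuous_coe.comp continuous_real_toNNReal))

namespace PathSol

variable {q : Measure Pt} {x₀ x₀' : ℝ} {x x' : ℝ≥0 → ℝ}
  (hx : PathSol ρ r u k q x₀ x) (hx' : PathSol ρ r u' k q x₀' x')
include hx hx'

lemma integrableOn_abs_drift_sub (s t : ℝ≥0) :
    IntegrableOn (fun v => |drift ρ u k x v - drift ρ u' k x' v|) (Ioc s t) leb :=
  ((hx.integrableOn_drift s t).sub (hx'.integrableOn_drift s t)).abs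

lemma driftGap_mono {s t : ℝ≥0} (hst : s ≤ t) :
    driftGap ρ u u' k x x' s ≤ driftGap ρ u u' k x x' t :=
  add_le_add_right (setIntegral_mono_set (hx.integrableOn_abs_drift_sub hx' 0 t)
    (Eventually.of_forall fun _ => abs_nonneg _) (Ioc_subset_Ioc_right hst).eventuallyLE) _

lemma coupled_leftLim {t : ℝ≥0} (ht : 0 < t) (h : ∀ s < t, DriftCoupled ρ u u' k x x' s) :
    Coupled (Function.leftLim x t) (Function.leftLim x' t) ∧
      |Function.leftLim x t - Function.leftLim x' t| ≤ driftGap ρ u u' k x x' t := by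
  have l1 := hx.cadlag.tendsto_gridBefore t
  have l2 := hx'.cadlag.tendsto_gridBefore t
  have hlim : ∀ {y : ℝ≥0 → ℝ} {l : ℝ}, (∀ s, y s ∈ stateSpace) →
      Tendsto (fun n => y (gridBefore n t)) atTop (𝓝 l) → 0 ≤ l →
      ∀ᶠ n in atTop, 0 ≤ y (gridBefore n t) := fun hy hl h0 => by
    filter_upwards [hl.eventually (lt_mem_nhds (show (-1 : ℝ) < _ by linarith))] with n hn
    exact (hy _).resolve_left hn.ne'
  refine ⟨⟨fun h0 => ge_of_tendsto l2 ?_, fun h0 => ge_of_tendsto l1 ?_⟩,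
    le_of_tendsto (l1.sub l2).abs (Eventually.of_forall fun n => ?_)⟩
  · filter_upwards [hlim hx.state l1 h0] with n hn
    exact (h _ (gridBefore_lt ht)).1.1 hn
  · filter_upwards [hlim hx'.state l2 h0] with n hn
    exact (h _ (gridBefore_lt ht)).1.2 hn
  · exact (h _ (gridBefore_lt ht)).2.trans (hx.driftGap_mono hx' (gridBefore_lt ht).le)

/-- The Grönwall estimate for the drift. -/
lemma driftGap_le_gapBound (hb : ρ.HasBounds L M Λ) (hu : Continuous u) (hu' : Continuous u')
    {t : ℝ≥0} (h : ∀ s < t, DriftCoupled ρ u u' k x x' s) :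
    driftGap ρ u u' k x x' t ≤ gapBound L u u' |x 0 - x' 0| t := by
  have hg := continuous_driftGap (k := k) hb hu hu' hx.cadlag hx'.cadlag
  have hδ : Continuous fun τ : ℝ => dist (u τ.toNNReal) (u' τ.toNNReal) :=
    (hu.comp continuous_real_toNNReal).dist (hu'.comp continuous_real_toNNReal)
  have key := integral_gronwall hg hδ (fun _ => dist_nonneg) (c := |x 0 - x' 0|) L.coe_nonneg
    t.coe_nonneg fun τ hτ => ?_
  · rw [Real.toNNReal_coe] at key
    rw [gapBound, setIntegral_leb _ zero_le]
    exact key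
  · rw [driftGap, setIntegral_leb _ zero_le, Real.coe_toNNReal _ hτ.1]
    refine add_le_add_right (intervalIntegral.integral_mono_on_of_le_Ioo hτ.1
      (intervalIntegrable_abs_drift_sub hb hu hu' hx.cadlag hx'.cadlag _ _)
      ((continuous_const.mul (hg.add hδ)).intervalIntegrable _ _) fun σ hσ => ?_) _
    have hσ' : σ.toNNReal < t := by
      rw [Real.toNNReal_lt_iff_lt_coe hσ.1.le]; exact hσ.2.trans_le hτ.2
    obtain ⟨hc, hd⟩ := hx.coupled_leftLim hx' (Real.toNNReal_pos.2 hσ.1)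
      fun s hs => h s (hs.trans hσ')
    refine (hc.abs_speed_sub_le hb _).trans (mul_le_mul_of_nonneg_left ?_ L.coe_nonneg)
    exact add_le_add_left hd _

/-- Two solutions that start in states of the same kind remain so, and their distance is governed
by the drift, as long as no point decouples them. -/
lemma driftCoupled_of_forall_not_decouples (hb : ρ.HasBounds L M Λ) (hr : r k ∈ Icc (0 : ℝ) 1)
    (hu : Continuous u) (hu' : Continuous u') (hq : IsSeparated q) {T : ℝ≥0}
    (h0 : Coupled (x 0) (x' 0))
    (hT : ∀ p : Pt, p.time ∈ Ioc 0 T → q {p} = 1 → ¬ Decouples ρ u u' k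
      (gapBound L u u' |x 0 - x' 0| p.time) p (Function.leftLim x p.time)
      (Function.leftLim x' p.time)) :
    ∀ t ≤ T, DriftCoupled ρ u u' k x x' t := by
  refine real_induction ⟨h0, ?_⟩ (fun t ht htT h => ?_) (fun t ht h => ?_)
  · simp [driftGap]
  · obtain ⟨hc, hd⟩ := hx.coupled_leftLim hx' ht h
    rcases hx.jump_cases hx' hb hu hu' hq ht with ⟨e1, e2⟩ | ⟨p, hpt, hp1, e1, e2⟩
    · exact ⟨by rw [e1, e2]; exact hc, by rw [e1, e2]; exact hd⟩
    · have hnot := hT p (by rw [hpt]; exact ⟨ht, htT⟩) hp1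
      rw [hpt] at hnot
      have ha : Acts ρ u k p (Function.leftLim x t) ↔ Acts ρ u' k p (Function.leftLim x' t) := by
        by_contra ha
        exact hnot ⟨hc, hd.trans (hx.driftGap_le_gapBound hx' hb hu hu' h), ha⟩
      obtain ⟨h1, h2⟩ := hc.add_incr hr ha
      exact ⟨by rw [e1, e2]; exact h1, by rw [e1, e2]; exact h2.trans hd⟩
  · have ht' := h t le_rfl
    -- right after time `t` neither path jumps: ON paths follow the drift upwards and stay ON, and
    -- OFF paths stay OFF by right-continuity
    have hneg : ∀ {y : ℝ≥0 → ℝ}, IsCadlag y → ¬ 0 ≤ y t → ∀ᶠ s in 𝓝[>] t, ¬ 0 ≤ y s :=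
      fun hy hn => by
        filter_upwards [((hy t).1.mono Ioi_subset_Ici_self).eventually
          (gt_mem_nhds (not_le.1 hn))] with s hs
        exact not_le.2 hs
    have hcoup : ∀ᶠ s in 𝓝[>] t, 0 ≤ x t ∨ (¬ 0 ≤ x s ∧ ¬ 0 ≤ x' s) := by
      by_cases hn : 0 ≤ x t
      · exact Eventually.of_forall fun s => Or.inl hn
      · filter_upwards [hneg hx.cadlag hn, hneg hx'.cadlag fun h' => hn (ht'.1.2 h')] with s h1 h2
        exact Or.inr ⟨h1, h2⟩
    filter_upwards [hx.eventually_eq_add_drift hb hu hq t, hx'.eventually_eq_add_drift hb hu' hq t,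
      hcoup, self_mem_nhdsWithin] with s e1 e2 hs hts
    have hts : t ≤ s := le_of_lt hts
    constructor
    · rcases hs with hs | hs
      · have i1 : 0 ≤ ∫ v in Ioc t s, drift ρ u k x v ∂leb :=
          integral_nonneg fun v => speed_nonneg _ _
        have i2 : 0 ≤ ∫ v in Ioc t s, drift ρ u' k x' v ∂leb :=
          integral_nonneg fun v => speed_nonneg _ _
        exact iff_of_true (by rw [e1]; exact add_nonneg hs i1)
          (by rw [e2]; exact add_nonneg (ht'.1.1 hs) i2)
      · exact iff_of_false hs.1 hs.2
    · have e3 : x s - x' s = (x t - x' t) +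
          ∫ v in Ioc t s, (drift ρ u k x v - drift ρ u' k x' v) ∂leb := by
        rw [integral_sub (hx.integrableOn_drift t s) (hx'.integrableOn_drift t s), e1, e2]
        ring
      have e4 : driftGap ρ u u' k x x' s = driftGap ρ u u' k x x' t +
          ∫ v in Ioc t s, |drift ρ u k x v - drift ρ u' k x' v| ∂leb := by
        rw [driftGap, driftGap, setIntegral_leb_add zero_le hts
          (hx.integrableOn_abs_drift_sub hx' 0 s)]
        ring
      rw [e3, e4]
      exact (abs_add_le _ _).trans (add_le_add ht'.2 (abs_integral_le_integral_abs))

end PathSol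

end OnOffNetwork

namespace OnOffNetwork

open Pt

variable {K J : ℕ} {ρ : Rates K J} {r : Fin K → ℝ} {u u' : ℝ≥0 → Fin J → ℝ≥0} {k : Fin K}
  {L M Λ : ℝ≥0}

/-! ### The distance of two solutions -/

lemma Rates.HasBounds.measurableSet_conn (hb : ρ.HasBounds L M Λ) (hu : Continuous u) (k : Fin K) :
    MeasurableSet {p : Pt | p.height < ρ.lam k (u p.time)} :=
  measurableSet_lt measurable_height
    ((hb.lam_lip k).continuous.measurable.comp (hu.measurable.comp measurable_time))

lemma measurable_one_add_weight : Measurable fun p : Pt => 1 + (p.2.1 : ℝ≥0∞) :=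
  measurable_const.add (measurable_coe_nnreal_ennreal.comp measurable_snd.fst)

lemma measurableSet_kind (i : Fin 3) : MeasurableSet {p : Pt | p.1 = i} :=
  measurable_fst (measurableSet_singleton i)

lemma Rates.HasBounds.measurable_connMass (hb : ρ.HasBounds L M Λ) (hu : Continuous u)
    (k : Fin K) : Measurable (connMass ρ u k) :=
  Measurable.ite ((measurableSet_kind 0).inter (hb.measurableSet_conn hu k))
    measurable_one_add_weight measurable_const

lemma Rates.HasBounds.measurable_connGap (hb : ρ.HasBounds L M Λ) (hu : Continuous u)
    (hu' : Continuous u') (k : Fin K) : Measurable (connGap ρ u u' k) := by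
  have h1 := hb.measurableSet_conn hu k
  have h2 := hb.measurableSet_conn hu' k
  have : {p : Pt | p.height < ρ.lam k (u p.time) ↔ p.height < ρ.lam k (u' p.time)} =
      ({p | p.height < ρ.lam k (u p.time)} ∩ {p | p.height < ρ.lam k (u' p.time)}) ∪
      ({p | p.height < ρ.lam k (u p.time)}ᶜ ∩ {p | p.height < ρ.lam k (u' p.time)}ᶜ) := by
    ext p
    simp only [mem_ofPred_eq, mem_union, mem_inter_iff, mem_compl_iff]
    tauto
  have h3 : MeasurableSet
      {p : Pt | p.height < ρ.lam k (u p.time) ↔ p.height < ρ.lam k (u' p.time)} := by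
    rw [this]
    exact (h1.inter h2).union (h1.compl.inter h2.compl)
  exact Measurable.ite ((measurableSet_kind 0).inter h3.compl) measurable_one_add_weight
    measurable_const

lemma connGap_comm (p : Pt) : connGap ρ u u' k p = connGap ρ u' u k p := by
  unfold connGap
  congr 1
  rw [iff_comm]

namespace Decouples

variable {d : ℝ} {p : Pt} {y y' : ℝ}

lemma symm (h : Decouples ρ u u' k d p y y') : Decouples ρ u' u k d p y' y :=
  ⟨Iff.symm h.1, by rw [abs_sub_comm]; exact h.2.1, fun h' => h.2.2 h'.symm⟩

/-- At a decoupling point the state can only grow by a connection whose height lies between the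
two connection rates. -/
lemma ofReal_incr_le_connGap (h : Decouples ρ u u' k d p y y') (hr : r k ∈ Icc (0 : ℝ) 1)
    (hy' : y' ∈ stateSpace) : ENNReal.ofReal (incr ρ r u k p y) ≤ connGap ρ u u' k p := by
  by_cases ha : Acts ρ u k p y
  · have hna : ¬ Acts ρ u' k p y' := fun h' => h.2.2 (iff_of_true ha h')
    by_cases h0 : p.1 = 0
    · have h1 : y = -1 := by
        have := ha.1
        rwa [Concerns, if_pos h0] at this
      have h2 : y' = -1 := eq_neg_one_of_mem_stateSpace hy' fun h' => by
        have := h.1.2 h'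
        rw [h1] at this
        norm_num at this
      have h3 := ha.2.2
      rw [threshold, if_pos h0] at h3
      have h4 : ¬ p.height < ρ.lam k (u' p.time) := fun h' => hna
        ⟨by rw [Concerns, if_pos h0]; exact h2, ha.2.1, by rw [threshold, if_pos h0]; exact h'⟩
      refine (ofReal_incr_le_connMass hr p y).trans (le_of_eq ?_)
      rw [connMass, connGap, if_pos ⟨h0, h3⟩, if_pos ⟨h0, fun h' => h4 (h'.1 h3)⟩]
    · refine (ofReal_incr_le_connMass hr p y).trans ?_
      rw [connMass, if_neg fun h' => h0 h'.1]
      exact zero_le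
  · rw [incr, if_neg ha, ENNReal.ofReal_zero]
    exact zero_le

end Decouples

lemma le_setLIntegral_of_atom {E : Type*} [MeasurableSpace E] [MeasurableSingletonClass E]
    {q : Measure E} {W : Set E} (f : E → ℝ≥0∞) {p : E} (hp : q {p} = 1) (hW : p ∈ W) :
    f p ≤ ∫⁻ z in W, f z ∂q := by
  calc f p = ∫⁻ z in {p}, f z ∂q := by rw [lintegral_singleton, hp, mul_one]
    _ ≤ ∫⁻ z in W, f z ∂q := lintegral_mono_set (singleton_subset_iff.2 hW)

lemma abs_sub_le_of_mem_stateSpace {y y' B : ℝ} (hy : y ∈ stateSpace) (hy' : y' ∈ stateSpace)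
    (h : y + 1 ≤ B) (h' : y' + 1 ≤ B) : |y - y'| ≤ B := by
  have h1 := neg_one_le_of_mem_stateSpace hy
  have h2 := neg_one_le_of_mem_stateSpace hy'
  rw [abs_le]
  constructor <;> linarith

lemma ofReal_abs_sub_le_of_mem_stateSpace {y y' : ℝ} {B : ℝ≥0∞} (hy : y ∈ stateSpace)
    (hy' : y' ∈ stateSpace) (h : ENNReal.ofReal (y + 1) ≤ B) (h' : ENNReal.ofReal (y' + 1) ≤ B) :
    ENNReal.ofReal |y - y'| ≤ B := by
  refine (ENNReal.ofReal_le_ofReal (abs_sub_le_of_mem_stateSpace hy hy' (le_max_left _ _)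
    (le_max_right _ _))).trans ?_
  rcases max_cases (y + 1) (y' + 1) with h1 | h1 <;> rw [h1.1] <;> assumption

open Classical in
/-- The indicator of the points that decouple two paths with initial distance `D`, where `xl` and
`xl'` are their left limits at the time of the point. -/
noncomputable def decoupling (ρ : Rates K J) (u u' : ℝ≥0 → Fin J → ℝ≥0) (k : Fin K) (L : ℝ≥0)
    (D : ℝ) (xl xl' : ℝ) (p : Pt) : ℝ≥0∞ :=
  if Decouples ρ u u' k (gapBound L u u' D p.time) p xl xl' then 1 else 0

namespace PathSol

variable {q : Measure Pt} {x₀ x₀' : ℝ} {x x' : ℝ≥0 → ℝ}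
  (hx : PathSol ρ r u k q x₀ x) (hx' : PathSol ρ r u' k q x₀' x')
include hx hx'

/-- At a decoupling point the state grows at most by a connection for exactly one of the parameter
paths; all other jumps are downwards. -/
lemma ofReal_add_one_le_of_decouples (hb : ρ.HasBounds L M Λ) (hr : r k ∈ Icc (0 : ℝ) 1)
    (hu : Continuous u) (hu' : Continuous u') (hq : IsSeparated q) {p : Pt} {d : ℝ}
    (h0 : 0 < p.time) (hp : q {p} = 1)
    (hd : Decouples ρ u u' k d p (Function.leftLim x p.time) (Function.leftLim x' p.time)) :
    ENNReal.ofReal (x p.time + 1) ≤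
      ENNReal.ofReal (Function.leftLim x p.time + 1) + connGap ρ u u' k p := by
  rcases hx.jump_cases hx' hb hu hu' hq h0 with ⟨e1, -⟩ | ⟨p₀, hpt, hp1, e1, -⟩
  · rw [e1]; exact le_self_add
  · obtain rfl := hq.eq_of_time_eq hp1 hp (hpt ▸ h0) hpt
    rw [e1, add_right_comm]
    exact ENNReal.ofReal_add_le.trans
      (add_le_add_right (hd.ofReal_incr_le_connGap hr (hx'.leftLim_mem _)) _)

/-- The distance of two solutions driven by the same points. The first term bounds it as long as
no point decouples them; afterwards it is bounded by the larger of the states, which is controlled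
by the state at the decoupling, the drift and the later connections. The function `W` stands for
the number of decoupling points strictly before a given time. All summands but the first and the
last have a factor that vanishes unless there was a decoupling or `x₀ ≠ x₀'`; if the initial states
are of different kinds, then `|x₀ - x₀'| ≥ 1` plays the role of a decoupling at time `0`. -/
lemma ofReal_abs_sub_le (hb : ρ.HasBounds L M Λ) (hr : r k ∈ Icc (0 : ℝ) 1)
    (hu : Continuous u) (hu' : Continuous u') (hq : IsSeparated q) {W : ℝ≥0 → ℝ≥0∞} {s t : ℝ≥0}
    (hW : ∀ p : Pt, 0 < p.time → q {p} = 1 →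
      Decouples ρ u u' k (gapBound L u u' |x₀ - x₀'| p.time) p (Function.leftLim x p.time)
        (Function.leftLim x' p.time) → ∀ σ, p.time < σ → σ ≤ t → 1 ≤ W σ)
    (hst : s ≤ t) :
    ENNReal.ofReal |x s - x' s| ≤ ENNReal.ofReal (gapBound L u u' |x₀ - x₀'| t)
      + ∫⁻ p in {p | p.time ∈ Ioc 0 t}, decoupling ρ u u' k L |x₀ - x₀'|
          (Function.leftLim x p.time) (Function.leftLim x' p.time) p *
            ENNReal.ofReal (Function.leftLim x p.time + 1) ∂q
      + (M * t : ℝ≥0) * (ENNReal.ofReal |x₀ - x₀'| + ∫⁻ p in {p | p.time ∈ Ioc 0 t},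
          decoupling ρ u u' k L |x₀ - x₀'| (Function.leftLim x p.time)
            (Function.leftLim x' p.time) p ∂q)
      + ∫⁻ p in {p | p.time ∈ Ioc 0 t},
          (ENNReal.ofReal |x₀ - x₀'| + W p.time) * connMass ρ u k p ∂q
      + 2 * ∫⁻ p in {p | p.time ∈ Ioc 0 t}, connGap ρ u u' k p ∂q := by
  set D := |x₀ - x₀'| with hD
  have hD0 : 0 ≤ D := abs_nonneg _
  set A : Set Pt := {p | p.time ∈ Ioc 0 t} with hA
  set I₁ := ∫⁻ p in A, decoupling ρ u u' k L D (Function.leftLim x p.time)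
    (Function.leftLim x' p.time) p * ENNReal.ofReal (Function.leftLim x p.time + 1) ∂q with hI₁
  set I₂ := ∫⁻ p in A, decoupling ρ u u' k L D (Function.leftLim x p.time)
    (Function.leftLim x' p.time) p ∂q with hI₂
  set I₃ := ∫⁻ p in A, (ENNReal.ofReal D + W p.time) * connMass ρ u k p ∂q with hI₃
  set I₄ := ∫⁻ p in A, connGap ρ u u' k p ∂q with hI₄
  have hx0 : x 0 = x₀ := hx.apply_zero
  have hx0' : x' 0 = x₀' := hx'.apply_zero
  have hMs : ((M * s : ℝ≥0) : ℝ≥0∞) ≤ (M * t : ℝ≥0) := by gcongr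
  -- the connections for `u'` are among those for `u` and those in the gap
  have hsum : ∀ τ, ∫⁻ p in {p | p.time ∈ Ioc τ s}, connMass ρ u' k p ∂q ≤
      ∫⁻ p in {p | p.time ∈ Ioc τ s}, connMass ρ u k p ∂q + I₄ := fun τ => by
    refine (lintegral_mono fun p => connMass_le_add_connGap (u := u) p).trans ?_
    rw [lintegral_add_left (hb.measurable_connMass hu k)]
    refine add_le_add_right (lintegral_mono_set ?_) _
    exact fun p hp => ⟨bot_le.trans_lt hp.1, hp.2.trans hst⟩
  by_cases hc : Coupled (x 0) (x' 0)
  · -- either some point has decoupled the paths by time `s`, or the drift accounts for the distance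
    by_cases hex : ∃ p : Pt, p.time ∈ Ioc 0 s ∧ q {p} = 1 ∧ Decouples ρ u u' k
      (gapBound L u u' D p.time) p (Function.leftLim x p.time) (Function.leftLim x' p.time)
    · obtain ⟨p, hps, hp1, hd⟩ := hex
      have hpA : p ∈ A := ⟨hps.1, hps.2.trans hst⟩
      have hone : decoupling ρ u u' k L D (Function.leftLim x p.time)
        (Function.leftLim x' p.time) p = 1 := if_pos hd
      have h1 : ENNReal.ofReal (Function.leftLim x p.time + 1) ≤ I₁ := by
        have := le_setLIntegral_of_atom (W := A) (fun p => decoupling ρ u u' k L D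
          (Function.leftLim x p.time) (Function.leftLim x' p.time) p *
          ENNReal.ofReal (Function.leftLim x p.time + 1)) hp1 hpA
        simpa only [hone, one_mul] using this
      have h2 : 1 ≤ I₂ := by
        have := le_setLIntegral_of_atom (W := A) (fun p => decoupling ρ u u' k L D
          (Function.leftLim x p.time) (Function.leftLim x' p.time) p) hp1 hpA
        simpa only [hone] using this
      have h3 : ∫⁻ p in {z | z.time ∈ Ioc p.time s}, connMass ρ u k p ∂q ≤ I₃ := by
        calc ∫⁻ p in {z | z.time ∈ Ioc p.time s}, connMass ρ u k p ∂q
            ≤ ∫⁻ p in {z | z.time ∈ Ioc p.time s},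
                (ENNReal.ofReal D + W p.time) * connMass ρ u k p ∂q := by
              refine setLIntegral_mono' (measurableSet_time measurableSet_Ioc) fun z hz => ?_
              exact le_mul_of_one_le_left zero_le
                ((hW p hps.1 hp1 hd z.time hz.1 (hz.2.trans hst)).trans le_add_self)
          _ ≤ I₃ := lintegral_mono_set fun z hz => ⟨bot_le.trans_lt hz.1, hz.2.trans hst⟩
      have h4 : connGap ρ u u' k p ≤ I₄ := le_setLIntegral_of_atom _ hp1 hpA
      have h5 : ((M * t : ℝ≥0) : ℝ≥0∞) ≤ (M * t : ℝ≥0) * (ENNReal.ofReal D + I₂) :=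
        le_mul_of_one_le_right zero_le (h2.trans le_add_self)
      refine ofReal_abs_sub_le_of_mem_stateSpace (hx.state s) (hx'.state s) ?_ ?_
      · calc ENNReal.ofReal (x s + 1) ≤ ENNReal.ofReal (x p.time + 1) + (M * s : ℝ≥0) +
              ∫⁻ p in {z | z.time ∈ Ioc p.time s}, connMass ρ u k p ∂q :=
            hx.ofReal_add_one_le hb hr hps.2
          _ ≤ (I₁ + I₄) + (M * t : ℝ≥0) * (ENNReal.ofReal D + I₂) + I₃ := by
            gcongr
            · exact (hx.ofReal_add_one_le_of_decouples hx' hb hr hu hu' hq hps.1 hp1 hd).trans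
                (add_le_add h1 h4)
            · exact hMs.trans h5
          _ ≤ (I₁ + I₄) + (M * t : ℝ≥0) * (ENNReal.ofReal D + I₂) + I₃ +
              (ENNReal.ofReal (gapBound L u u' D t) + I₄) := le_self_add
          _ = _ := by ring
      · have h6 : ENNReal.ofReal (Function.leftLim x' p.time + 1) ≤
            I₁ + ENNReal.ofReal (gapBound L u u' D t) := by
          calc ENNReal.ofReal (Function.leftLim x' p.time + 1)
              ≤ ENNReal.ofReal ((Function.leftLim x p.time + 1) + gapBound L u u' D t) := by
                refine ENNReal.ofReal_le_ofReal ?_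
                have := (abs_le.1 (hd.2.1.trans (gapBound_mono hu hu' hD0 hpA.2))).1
                linarith
            _ ≤ _ := ENNReal.ofReal_add_le.trans (add_le_add_left h1 _)
        calc ENNReal.ofReal (x' s + 1) ≤ ENNReal.ofReal (x' p.time + 1) + (M * s : ℝ≥0) +
              ∫⁻ p in {z | z.time ∈ Ioc p.time s}, connMass ρ u' k p ∂q :=
            hx'.ofReal_add_one_le hb hr hps.2
          _ ≤ (I₁ + ENNReal.ofReal (gapBound L u u' D t) + I₄) +
              (M * t : ℝ≥0) * (ENNReal.ofReal D + I₂) + (I₃ + I₄) := by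
            gcongr
            · refine (hx'.ofReal_add_one_le_of_decouples hx hb hr hu' hu hq hps.1 hp1
                hd.symm).trans (add_le_add h6 ?_)
              rwa [connGap_comm]
            · exact hMs.trans h5
            · exact (hsum _).trans (add_le_add_left h3 _)
          _ = _ := by ring
    · have h := hx.driftCoupled_of_forall_not_decouples hx' hb hr hu hu' hq (T := s) hc
        fun p hp hp1 hd => hex ⟨p, hp, hp1, by rwa [hx0, hx0'] at hd⟩
      have h1 : |x s - x' s| ≤ gapBound L u u' D t := by
        have := hx.driftGap_le_gapBound hx' hb hu hu' (t := s) fun v hv => h v hv.le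
        rw [hx0, hx0'] at this
        exact (h s le_rfl).2.trans (this.trans (gapBound_mono hu hu' hD0 hst))
      refine (ENNReal.ofReal_le_ofReal h1).trans ?_
      simp only [add_assoc]
      exact le_self_add
  · rw [hx0, hx0'] at hc
    -- one of the two users is OFF at time `0`
    have hm : x₀ ∈ stateSpace := hx0 ▸ hx.state 0
    have hm' : x₀' ∈ stateSpace := hx0' ▸ hx'.state 0
    have hcases : (x₀ = -1 ∧ 0 ≤ x₀') ∨ (0 ≤ x₀ ∧ x₀' = -1) := by
      unfold Coupled at hc
      by_cases h : 0 ≤ x₀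
      · exact Or.inr ⟨h, eq_neg_one_of_mem_stateSpace hm' fun h' => hc (iff_of_true h h')⟩
      · exact Or.inl ⟨eq_neg_one_of_mem_stateSpace hm h,
          by by_contra h'; exact hc (iff_of_false h h')⟩
    have hD1 : 1 ≤ D ∧ x₀ + 1 ≤ D ∧ x₀' + 1 ≤ D := by
      rcases hcases with ⟨h1, h2⟩ | ⟨h1, h2⟩
      · have : D = x₀' + 1 := by
          rw [hD, h1, abs_sub_comm, sub_neg_eq_add, abs_of_nonneg (by linarith)]
        refine ⟨?_, ?_, ?_⟩ <;> linarith
      · have : D = x₀ + 1 := by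
          rw [hD, h2, sub_neg_eq_add, abs_of_nonneg (by linarith)]
        refine ⟨?_, ?_, ?_⟩ <;> linarith
    have hD1' : 1 ≤ ENNReal.ofReal D := by
      rw [← ENNReal.ofReal_one]; exact ENNReal.ofReal_le_ofReal hD1.1
    have h3 : ∫⁻ p in {z | z.time ∈ Ioc 0 s}, connMass ρ u k p ∂q ≤ I₃ := by
      calc ∫⁻ p in {z | z.time ∈ Ioc 0 s}, connMass ρ u k p ∂q
          ≤ ∫⁻ p in A, connMass ρ u k p ∂q :=
            lintegral_mono_set fun z hz => ⟨hz.1, hz.2.trans hst⟩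
        _ ≤ I₃ := lintegral_mono fun p =>
            le_mul_of_one_le_left zero_le (hD1'.trans le_self_add)
    have h5 : ((M * t : ℝ≥0) : ℝ≥0∞) ≤ (M * t : ℝ≥0) * (ENNReal.ofReal D + I₂) :=
      le_mul_of_one_le_right zero_le (hD1'.trans le_self_add)
    refine ofReal_abs_sub_le_of_mem_stateSpace (hx.state s) (hx'.state s) ?_ ?_
    · calc ENNReal.ofReal (x s + 1) ≤ ENNReal.ofReal (x 0 + 1) + (M * s : ℝ≥0) +
            ∫⁻ p in {z | z.time ∈ Ioc 0 s}, connMass ρ u k p ∂q :=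
          hx.ofReal_add_one_le hb hr zero_le
        _ ≤ ENNReal.ofReal (gapBound L u u' D t) + (M * t : ℝ≥0) * (ENNReal.ofReal D + I₂) +
            I₃ := by
          gcongr
          · rw [hx0]; exact hD1.2.1.trans (le_gapBound hD0 t)
          · exact hMs.trans h5
        _ ≤ ENNReal.ofReal (gapBound L u u' D t) + (M * t : ℝ≥0) * (ENNReal.ofReal D + I₂) +
            I₃ + (I₁ + 2 * I₄) := le_self_add
        _ = _ := by ring
    · calc ENNReal.ofReal (x' s + 1) ≤ ENNReal.ofReal (x' 0 + 1) + (M * s : ℝ≥0) +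
            ∫⁻ p in {z | z.time ∈ Ioc 0 s}, connMass ρ u' k p ∂q :=
          hx'.ofReal_add_one_le hb hr zero_le
        _ ≤ ENNReal.ofReal (gapBound L u u' D t) + (M * t : ℝ≥0) * (ENNReal.ofReal D + I₂) +
            (I₃ + I₄) := by
          gcongr
          · rw [hx0']; exact hD1.2.2.trans (le_gapBound hD0 t)
          · exact hMs.trans h5
          · exact (hsum _).trans (add_le_add_left h3 _)
        _ ≤ ENNReal.ofReal (gapBound L u u' D t) + (M * t : ℝ≥0) * (ENNReal.ofReal D + I₂) +
            (I₃ + I₄) + (I₁ + I₄) := le_self_add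
        _ = _ := by ring

end PathSol

end OnOffNetwork

namespace OnOffNetwork

open Pt

/-! ### Predictable processes from grids -/

lemma gridBefore_le (n : ℕ) (s : ℝ≥0) : gridBefore n s ≤ s := by
  rcases eq_or_ne s 0 with rfl | hs
  · simp [gridBefore]
  · exact (gridBefore_lt (pos_iff_ne_zero.2 hs)).le

section Predictable

variable {Ω E : Type*} [mΩ : MeasurableSpace Ω] [mE : MeasurableSpace E]

/-- An adapted process, observed at the last grid time before the time of a point, is
predictable. -/
lemma measurable_comp_gridBefore {β : Type*} [MeasurableSpace β] {F : ℝ≥0 → MeasurableSpace Ω}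
    {T : E → ℝ≥0} (hT : Measurable T) {Y : ℝ≥0 → Ω → β} (hY : ∀ t, Measurable[F t] (Y t)) (n : ℕ) :
    Measurable[predSigma F T] (fun z : Ω × E => Y (gridBefore n (T z.2)) z.1) := by
  intro B hB
  set idx : E → ℕ := fun p => ⌈T p * 2 ^ n⌉₊ - 1 with hidx
  have hidxm : Measurable idx :=
    (Measurable.of_discrete (f := fun i : ℕ => i - 1)).comp
      (Nat.measurable_ceil.comp (hT.mul_const _))
  have heq : (fun z : Ω × E => Y (gridBefore n (T z.2)) z.1) ⁻¹' B =
      ⋃ i : ℕ, (Y ((i : ℝ≥0) / 2 ^ n) ⁻¹' B) ×ˢ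
        (idx ⁻¹' {i} ∩ after T ((i : ℝ≥0) / 2 ^ n)) := by
    ext ⟨ω, p⟩
    simp only [mem_preimage, mem_iUnion, mem_prod, mem_inter_iff, mem_singleton_iff]
    constructor
    · intro h
      refine ⟨idx p, h, rfl, ?_⟩
      rcases eq_or_ne (T p) 0 with h0 | h0
      · left
        simp [hidx, h0]
      · exact Or.inr (gridBefore_lt (pos_iff_ne_zero.2 h0))
    · rintro ⟨i, h, rfl, -⟩
      exact h
  rw [heq]
  refine MeasurableSet.iUnion fun i => MeasurableSpace.measurableSet_generateFrom
    ⟨_, _, _, hY _ hB, hidxm (measurableSet_singleton i), rfl⟩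

/-- The limit along the grids, from the left, of a process at the time of a point. -/
noncomputable def gridLimit (T : E → ℝ≥0) (Y : ℝ≥0 → Ω → ℝ) (z : Ω × E) : ℝ :=
  limsup (fun n => Y (gridBefore n (T z.2)) z.1) atTop

lemma measurable_gridLimit {F : ℝ≥0 → MeasurableSpace Ω} {T : E → ℝ≥0} (hT : Measurable T)
    {Y : ℝ≥0 → Ω → ℝ} (hY : ∀ t, Measurable[F t] (Y t)) :
    Measurable[predSigma F T] (gridLimit T Y) :=
  Measurable.limsup fun n => measurable_comp_gridBefore hT hY n

lemma gridLimit_eq_leftLim {T : E → ℝ≥0} {Y : ℝ≥0 → Ω → ℝ} {x : ℝ≥0 → ℝ} {ω : Ω} (hx : IsCadlag x)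
    (h : ∀ n i : ℕ, Y ((i : ℝ≥0) / 2 ^ n) ω = x ((i : ℝ≥0) / 2 ^ n)) (p : E) :
    gridLimit T Y (ω, p) = Function.leftLim x (T p) := by
  refine Tendsto.limsup_eq ((hx.tendsto_gridBefore (T p)).congr fun n => ?_)
  exact (h n _).symm

end Predictable

/-! ### Integrals against the intensity -/

lemma lintegral_strip_le {f : ℝ≥0 × ℝ≥0 → ℝ≥0∞} (hf : Measurable f) {c : ℝ≥0 → ℝ≥0∞}
    {I : Set ℝ≥0} (hI : MeasurableSet I) (h : ∀ s ∈ I, ∫⁻ z, f (z, s) ∂leb ≤ c s) :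
    ∫⁻ q in {q | q.2 ∈ I}, f q ∂(leb.prod leb) ≤ ∫⁻ s in I, c s ∂leb := by
  have hm : MeasurableSet {q : ℝ≥0 × ℝ≥0 | q.2 ∈ I} := measurable_snd hI
  rw [← lintegral_indicator hm, lintegral_prod_symm _ (hf.indicator hm).aemeasurable,
    ← lintegral_indicator hI]
  refine lintegral_mono fun s => ?_
  by_cases hs : s ∈ I
  · rw [indicator_of_mem hs]
    refine le_trans (lintegral_mono fun z => ?_) (h s hs)
    exact indicator_le_self _ _ _
  · rw [indicator_of_notMem hs]
    refine le_of_eq ((lintegral_congr fun z => ?_).trans lintegral_zero)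
    exact indicator_of_notMem (show (z, s) ∉ {q : ℝ≥0 × ℝ≥0 | q.2 ∈ I} from hs) _

/-- If, for each kind, mark and time, the integral of `f` over the heights is bounded by a function
of the kind and the mark times a function of the time, then its integral against the intensity is
bounded by the product of the integrals. -/
lemma setLIntegral_intensity_le {α : Measure ℝ≥0} [SFinite α] {f : Pt → ℝ≥0∞} (hf : Measurable f)
    {b : Fin 3 → ℝ≥0 → ℝ≥0∞} (hb : ∀ i, Measurable (b i)) {c : ℝ≥0 → ℝ≥0∞} (hc : Measurable c)
    {I : Set ℝ≥0} (hI : MeasurableSet I)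
    (h : ∀ i w, ∀ s ∈ I, ∫⁻ z, f (i, w, z, s) ∂leb ≤ b i w * c s) :
    ∫⁻ p in {p | p.time ∈ I}, f p ∂intensity α ≤
      (∫⁻ w, b 0 w ∂α + b 1 0 + b 2 0) * ∫⁻ s in I, c s ∂leb := by
  have hm : MeasurableSet {p : Pt | p.time ∈ I} := measurableSet_time hI
  have hm₂ : MeasurableSet {q : ℝ≥0 × ℝ≥0 | q.2 ∈ I} := measurable_snd hI
  have hstrip : ∀ i w, ∫⁻ q in {q : ℝ≥0 × ℝ≥0 | q.2 ∈ I}, f (i, w, q) ∂(leb.prod leb) ≤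
      b i w * ∫⁻ s in I, c s ∂leb := fun i w => by
    rw [← lintegral_const_mul _ hc]
    exact lintegral_strip_le (f := fun q => f (i, w, q))
      (hf.comp (measurable_prodMk_left.comp measurable_prodMk_left)) hI (h i w)
  rw [← lintegral_indicator hm, intensity, lintegral_combine _ _ _ (hf.indicator hm), add_mul,
    add_mul]
  have hplain : ∀ i, ∫⁻ q, {p : Pt | p.time ∈ I}.indicator f (plain i q) ∂(leb.prod leb) ≤
      b i 0 * ∫⁻ s in I, c s ∂leb := fun i => by
    refine le_trans (le_of_eq ?_) (hstrip i 0)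
    rw [← lintegral_indicator hm₂]
    rfl
  refine add_le_add (add_le_add ?_ (hplain 1)) (hplain 2)
  have hconn : Measurable fun q => {p : Pt | p.time ∈ I}.indicator f (conn q) :=
    (hf.indicator hm).comp measurable_conn
  rw [lintegral_prod _ hconn.aemeasurable,
    ← lintegral_mul_const _ (hb 0)]
  refine lintegral_mono fun w => le_trans (le_of_eq ?_) (hstrip 0 w)
  rw [← lintegral_indicator hm₂]
  rfl

lemma leb_Iio (a : ℝ≥0) : leb (Iio a) = a := by
  rw [← leb_Iic a, measure_congr Iio_ae_eq_Iic]

lemma lintegral_indicator_le_one {S : Set ℝ≥0} (f : ℝ≥0 → ℝ≥0∞) {c : ℝ≥0∞}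
    (h0 : ∀ z ∉ S, f z = 0) (h1 : ∀ z ∈ S, f z ≤ c) (hS : MeasurableSet S) :
    ∫⁻ z, f z ∂leb ≤ c * leb S := by
  calc ∫⁻ z, f z ∂leb ≤ ∫⁻ z, S.indicator (fun _ => c) z ∂leb := by
        refine lintegral_mono fun z => ?_
        by_cases hz : z ∈ S
        · rw [indicator_of_mem hz]; exact h1 z hz
        · rw [indicator_of_notMem hz, h0 z hz]
    _ = c * leb S := lintegral_indicator_const hS c

lemma leb_between_le (a b : ℝ≥0) :
    leb (Ico (min a b) (max a b)) ≤ ENNReal.ofReal |(a : ℝ) - b| := by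
  rw [measure_congr (Ico_ae_eq_Ioc (μ := leb)), leb_Ioc]
  refine ENNReal.ofReal_le_ofReal ?_
  rw [NNReal.coe_max, NNReal.coe_min, max_sub_min_eq_abs']

/-- The heights that exactly one of two rates accepts lie between the rates. -/
lemma mem_between {a b z : ℝ≥0} (h : ¬ (z < a ↔ z < b)) : z ∈ Ico (min a b) (max a b) := by
  rw [mem_Ico, min_le_iff, lt_max_iff]
  by_cases ha : z < a
  · by_cases hb : z < b
    · exact absurd (iff_of_true ha hb) h
    · exact ⟨Or.inr (not_lt.1 hb), Or.inl ha⟩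
  · by_cases hb : z < b
    · exact ⟨Or.inl (not_lt.1 ha), Or.inr hb⟩
    · exact absurd (iff_of_false ha hb) h

variable {K J : ℕ} {ρ : Rates K J} {r : Fin K → ℝ} {u u' : ℝ≥0 → Fin J → ℝ≥0} {k : Fin K}
  {L M Λ : ℝ≥0}

/-- The rate of decoupling points at a given time, for states at distance at most `d`. -/
lemma lintegral_decoupling_le (hb : ρ.HasBounds L M Λ) {D : ℝ} {i : Fin 3} {w s : ℝ≥0} {y y' : ℝ}
    (hy : y ∈ stateSpace) (hy' : y' ∈ stateSpace) {d : ℝ} (hd : gapBound L u u' D s ≤ d)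
    (hd0 : 0 ≤ d) :
    ∫⁻ z, decoupling ρ u u' k L D y y' (i, w, z, s) ∂leb ≤
      ENNReal.ofReal (L * (d + dist (u s) (u' s))) := by
  by_cases hcd : Coupled y y' ∧ |y - y'| ≤ gapBound L u u' D s
  · obtain ⟨hc, hdist⟩ := hcd
    set a := threshold ρ u k (i, w, 0, s) y with ha
    set a' := threshold ρ u' k (i, w, 0, s) y' with ha'
    have hδ : (0 : ℝ) ≤ dist (u s) (u' s) := dist_nonneg
    have haa : |(a : ℝ) - a'| ≤ L * (d + dist (u s) (u' s)) := by
      have hgen : |y - y'| + dist (u s) (u' s) ≤ d + dist (u s) (u' s) :=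
        add_le_add_left (hdist.trans hd) _
      simp only [ha, ha', threshold]
      split_ifs
      · have := (hb.lam_lip k).dist_le_mul (u s) (u' s)
        rw [NNReal.dist_eq] at this
        exact this.trans (mul_le_mul_of_nonneg_left (le_add_of_nonneg_left hd0) L.coe_nonneg)
      · exact (abs_sub_le_of_lipschitz (hb.b_lip k) _ _ _ _).trans
          (mul_le_mul_of_nonneg_left hgen L.coe_nonneg)
      · exact (abs_sub_le_of_lipschitz (hb.mu_lip k) _ _ _ _).trans
          (mul_le_mul_of_nonneg_left hgen L.coe_nonneg)
    have hconc : Concerns (i, w, 0, s) y ↔ Concerns (i, w, 0, s) y' := by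
      have hneg : ∀ {v : ℝ}, v ∈ stateSpace → (v = -1 ↔ ¬ 0 ≤ v) := fun hv =>
        ⟨fun h => by rw [h]; norm_num, fun h => eq_neg_one_of_mem_stateSpace hv h⟩
      unfold Concerns
      split_ifs
      · rw [hneg hy, hneg hy']; exact not_congr hc
      · exact hc
    refine (lintegral_indicator_le_one (S := Ico (min a a') (max a a')) _ (c := 1)
      (fun z hz => ?_) (fun z _ => ?_) measurableSet_Ico).trans ?_
    · refine if_neg fun h => h.2.2 ?_
      have hiff : z < a ↔ z < a' := by
        by_contra hn; exact hz (mem_between hn)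
      exact and_congr hconc (and_congr Iff.rfl hiff)
    · unfold decoupling; split_ifs <;> simp
    · rw [one_mul]
      exact (leb_between_le a a').trans (ENNReal.ofReal_le_ofReal haa)
  · refine le_trans (le_of_eq ((lintegral_congr fun z => ?_).trans lintegral_zero)) zero_le
    exact if_neg fun h => hcd ⟨h.1, h.2.1⟩

lemma lintegral_connMass_le (i : Fin 3) (w s : ℝ≥0) :
    ∫⁻ z, connMass ρ u k (i, w, z, s) ∂leb ≤
      (if i = 0 then 1 + (w : ℝ≥0∞) else 0) * (ρ.lam k (u s) : ℝ≥0∞) := by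
  by_cases hi : i = 0
  · rw [if_pos hi, ← leb_Iio (ρ.lam k (u s))]
    refine lintegral_indicator_le_one _ (fun z (hz : ¬ z < _) => ?_) (fun z _ => ?_)
      measurableSet_Iio
    · exact if_neg fun h => hz h.2
    · unfold connMass; split_ifs <;> simp
  · refine le_trans (le_of_eq ((lintegral_congr fun z => ?_).trans lintegral_zero)) zero_le
    exact if_neg fun h => hi h.1

lemma lintegral_connGap_le (hb : ρ.HasBounds L M Λ) (i : Fin 3) (w s : ℝ≥0) :
    ∫⁻ z, connGap ρ u u' k (i, w, z, s) ∂leb ≤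
      (if i = 0 then 1 + (w : ℝ≥0∞) else 0) * ENNReal.ofReal (L * dist (u s) (u' s)) := by
  by_cases hi : i = 0
  · rw [if_pos hi]
    refine (lintegral_indicator_le_one
      (S := Ico (min (ρ.lam k (u s)) (ρ.lam k (u' s))) (max (ρ.lam k (u s)) (ρ.lam k (u' s)))) _
      (c := 1 + (w : ℝ≥0∞)) (fun z hz => ?_) (fun z _ => ?_) measurableSet_Ico).trans ?_
    · exact if_neg fun h => hz (mem_between h.2)
    · unfold connGap; split_ifs <;> simp
    · gcongr
      refine (leb_between_le _ _).trans (ENNReal.ofReal_le_ofReal ?_)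
      have := (hb.lam_lip k).dist_le_mul (u s) (u' s)
      rwa [NNReal.dist_eq] at this
  · refine le_trans (le_of_eq ((lintegral_congr fun z => ?_).trans lintegral_zero)) zero_le
    exact if_neg fun h => hi h.1

lemma lintegral_mark {α : Measure ℝ≥0} [IsProbabilityMeasure α] {m : ℝ≥0}
    (hm : ∫⁻ w, (w : ℝ≥0∞) ∂α = m) : ∫⁻ w, (1 + (w : ℝ≥0∞)) ∂α = 1 + m := by
  rw [lintegral_add_left measurable_const, hm]
  simp

lemma ofReal_setIntegral_dist (hu : Continuous u) (hu' : Continuous u') (t : ℝ≥0) :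
    ENNReal.ofReal (∫ s in Ioc 0 t, dist (u s) (u' s) ∂leb) =
      ∫⁻ s in Ioc 0 t, ENNReal.ofReal (dist (u s) (u' s)) ∂leb :=
  ofReal_integral_eq_lintegral_ofReal (integrableOn_dist hu hu' 0 t)
    (Eventually.of_forall fun _ => dist_nonneg)

section Bounds

variable {α : Measure ℝ≥0} [IsProbabilityMeasure α] {m : ℝ≥0}

lemma setLIntegral_connMass_le (hb : ρ.HasBounds L M Λ) (hu : Continuous u)
    (hm : ∫⁻ w, (w : ℝ≥0∞) ∂α = m) {t U : ℝ≥0} (hU : ∀ s ≤ t, dist (u s) 0 ≤ U) :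
    ∫⁻ p in {p | p.time ∈ Ioc 0 t}, connMass ρ u k p ∂intensity α ≤
      ((1 + m) * (Λ * (1 + U) * t) : ℝ≥0) := by
  have hlam : Measurable fun s => (ρ.lam k (u s) : ℝ≥0∞) :=
    measurable_coe_nnreal_ennreal.comp ((hb.lam_lip k).continuous.measurable.comp hu.measurable)
  have h := setLIntegral_intensity_le (α := α) (hb.measurable_connMass hu k)
    (b := fun i w => if i = 0 then 1 + (w : ℝ≥0∞) else 0) (fun i => by split_ifs <;> fun_prop)
    hlam (measurableSet_Ioc (a := 0) (b := t)) fun i w s _ => lintegral_connMass_le i w s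
  refine h.trans ?_
  have e0 : (1 : Fin 3) ≠ 0 := by decide
  have e1 : (2 : Fin 3) ≠ 0 := by decide
  simp only [if_true, e0, e1, if_false, add_zero]
  rw [lintegral_mark hm]
  have h2 : ∫⁻ s in Ioc 0 t, (ρ.lam k (u s) : ℝ≥0∞) ∂leb ≤ (Λ * (1 + U) * t : ℝ≥0) := by
    calc ∫⁻ s in Ioc 0 t, (ρ.lam k (u s) : ℝ≥0∞) ∂leb
        ≤ ∫⁻ _ in Ioc 0 t, ((Λ * (1 + U) : ℝ≥0) : ℝ≥0∞) ∂leb := by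
          refine setLIntegral_mono' measurableSet_Ioc fun s hs => ?_
          rw [ENNReal.coe_le_coe, ← NNReal.coe_le_coe]
          push_cast
          exact (hb.lam_le k (u s)).trans (mul_le_mul_of_nonneg_left
            (add_le_add_right (hU s hs.2) 1) Λ.coe_nonneg)
      _ = (Λ * (1 + U) * t : ℝ≥0) := by
          rw [setLIntegral_const, leb_Ioc]
          simp
  refine (mul_le_mul_right h2 _).trans (le_of_eq ?_)
  push_cast
  rfl

lemma setLIntegral_connGap_le (hb : ρ.HasBounds L M Λ) (hu : Continuous u) (hu' : Continuous u')
    (hm : ∫⁻ w, (w : ℝ≥0∞) ∂α = m) (t : ℝ≥0) :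
    ∫⁻ p in {p | p.time ∈ Ioc 0 t}, connGap ρ u u' k p ∂intensity α ≤
      ENNReal.ofReal ((1 + m) * (L * ∫ s in Ioc 0 t, dist (u s) (u' s) ∂leb)) := by
  have hδ : Measurable fun s => ENNReal.ofReal (L * dist (u s) (u' s)) := by
    have := (hu.dist hu').measurable
    fun_prop
  have h := setLIntegral_intensity_le (α := α) (hb.measurable_connGap hu hu' k)
    (b := fun i w => if i = 0 then 1 + (w : ℝ≥0∞) else 0) (fun i => by split_ifs <;> fun_prop)
    hδ (measurableSet_Ioc (a := 0) (b := t)) fun i w s _ => lintegral_connGap_le hb i w s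
  refine h.trans (le_of_eq ?_)
  have e0 : (1 : Fin 3) ≠ 0 := by decide
  have e1 : (2 : Fin 3) ≠ 0 := by decide
  simp only [if_true, e0, e1, if_false, add_zero]
  rw [lintegral_mark hm, ENNReal.ofReal_mul (by positivity), ofReal_one_add,
    ENNReal.ofReal_mul L.coe_nonneg, ofReal_setIntegral_dist hu hu', ENNReal.ofReal_coe_nnreal]
  congr 1
  simp_rw [ENNReal.ofReal_mul L.coe_nonneg, ENNReal.ofReal_coe_nnreal]
  exact lintegral_const_mul _ (by have := (hu.dist hu').measurable; fun_prop)

/-- The expected number of decoupling points given the left limits of the two paths. -/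
lemma setLIntegral_decoupling_le (hb : ρ.HasBounds L M Λ) (hu : Continuous u)
    (hu' : Continuous u') {D : ℝ} (hD : 0 ≤ D) {y y' : ℝ≥0 → ℝ} (hy : ∀ s, y s ∈ stateSpace)
    (hy' : ∀ s, y' s ∈ stateSpace)
    (hmeas : Measurable fun p : Pt => decoupling ρ u u' k L D (y p.time) (y' p.time) p) (t : ℝ≥0) :
    ∫⁻ p in {p | p.time ∈ Ioc 0 t}, decoupling ρ u u' k L D (y p.time) (y' p.time) p ∂intensity α ≤
      ENNReal.ofReal (3 * (L * (gapBound L u u' D t * t +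
        ∫ s in Ioc 0 t, dist (u s) (u' s) ∂leb))) := by
  set d := gapBound L u u' D t with hd
  have hd0 : 0 ≤ d := gapBound_nonneg hD t
  have hδm := (hu.dist hu').measurable
  have hδ : Measurable fun s => ENNReal.ofReal (L * (d + dist (u s) (u' s))) := by fun_prop
  have h := setLIntegral_intensity_le (α := α) hmeas (b := fun _ _ => 1)
    (fun i => measurable_const) hδ (measurableSet_Ioc (a := 0) (b := t)) fun i w s hs => by
      rw [one_mul]
      exact lintegral_decoupling_le hb (hy s) (hy' s) (gapBound_mono hu hu' hD hs.2) hd0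
  refine h.trans (le_of_eq ?_)
  have hI := setIntegral_dist_nonneg (u := u) (u' := u') t
  rw [lintegral_const, measure_univ, mul_one, ENNReal.ofReal_mul (by norm_num),
    ENNReal.ofReal_mul L.coe_nonneg, ENNReal.ofReal_add (by positivity) hI,
    ofReal_setIntegral_dist hu hu']
  congr 1
  · norm_num
  · simp_rw [ENNReal.ofReal_mul L.coe_nonneg]
    rw [lintegral_const_mul _ (by fun_prop)]
    congr 1
    simp_rw [ENNReal.ofReal_add hd0 dist_nonneg]
    rw [lintegral_add_left measurable_const, setLIntegral_const, leb_Ioc, ENNReal.ofReal_mul hd0]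
    simp

end Bounds

end OnOffNetwork

namespace OnOffNetwork

open Pt

variable {K J : ℕ} {ρ : Rates K J} {r : Fin K → ℝ} {u u' : ℝ≥0 → Fin J → ℝ≥0} {k : Fin K}
  {L M Λ : ℝ≥0}

/-! ### The expected distance of two solutions -/

lemma measurableSet_iff {E : Type*} [MeasurableSpace E] {p q : E → Prop}
    (hp : MeasurableSet {z | p z}) (hq : MeasurableSet {z | q z}) :
    MeasurableSet {z | p z ↔ q z} := by
  have : {z | p z ↔ q z} = ({z | p z} ∩ {z | q z}) ∪ ({z | p z}ᶜ ∩ {z | q z}ᶜ) := by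
    ext z
    simp only [mem_ofPred_eq, mem_union, mem_inter_iff, mem_compl_iff]
    tauto
  rw [this]
  exact (hp.inter hq).union (hp.compl.inter hq.compl)

lemma Rates.HasBounds.measurable_threshold (hb : ρ.HasBounds L M Λ) (hu : Continuous u)
    (k : Fin K) : Measurable fun z : ℝ × Pt => threshold ρ u k z.2 z.1 := by
  have ht : Measurable fun z : ℝ × Pt => u z.2.time :=
    hu.measurable.comp (measurable_time.comp measurable_snd)
  have hy : Measurable fun z : ℝ × Pt => z.1.toNNReal := measurable_fst.real_toNNReal
  have hk : ∀ i, MeasurableSet {z : ℝ × Pt | z.2.1 = i} := fun i =>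
    measurable_snd (measurableSet_kind i)
  refine Measurable.ite (hk 0) ((hb.lam_lip k).continuous.measurable.comp ht)
    (Measurable.ite (hk 1) ?_ ?_)
  · exact (hb.b_lip k).continuous.measurable.comp (hy.prodMk ht)
  · exact (hb.mu_lip k).continuous.measurable.comp (hy.prodMk ht)

lemma Rates.HasBounds.measurableSet_acts (hb : ρ.HasBounds L M Λ) (hu : Continuous u)
    (k : Fin K) : MeasurableSet {z : ℝ × Pt | Acts ρ u k z.2 z.1} := by
  have hh : Measurable fun z : ℝ × Pt => z.2.height := measurable_height.comp measurable_snd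
  have hc : MeasurableSet {z : ℝ × Pt | Concerns z.2 z.1} := by
    have h1 : MeasurableSet {z : ℝ × Pt | z.2.1 = 0} := measurable_snd (measurableSet_kind 0)
    have h2 : MeasurableSet {z : ℝ × Pt | z.1 = -1} := measurable_fst (measurableSet_singleton _)
    have h3 : MeasurableSet {z : ℝ × Pt | 0 ≤ z.1} := measurable_fst measurableSet_Ici
    have : {z : ℝ × Pt | Concerns z.2 z.1} = ({z | z.2.1 = 0} ∩ {z | z.1 = -1}) ∪
        ({z | z.2.1 = 0}ᶜ ∩ {z | 0 ≤ z.1}) := by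
      ext z
      simp only [Concerns, mem_ofPred_eq, mem_union, mem_inter_iff, mem_compl_iff]
      split_ifs with h <;> simp [h]
    rw [this]
    exact (h1.inter h2).union (h1.compl.inter h3)
  have h0 : MeasurableSet {z : ℝ × Pt | 0 < z.2.height} := measurableSet_lt measurable_const hh
  have h1 : MeasurableSet {z : ℝ × Pt | z.2.height < threshold ρ u k z.2 z.1} :=
    measurableSet_lt hh (hb.measurable_threshold hu k)
  exact hc.inter (h0.inter h1)

lemma measurable_gapBound (hu : Continuous u) (hu' : Continuous u') (L : ℝ≥0) :
    Measurable fun z : ℝ × ℝ≥0 => gapBound L u u' z.1 z.2 := by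
  have hI : Measurable fun t : ℝ≥0 => ∫ s in Ioc 0 t, dist (u s) (u' s) ∂leb :=
    Monotone.measurable fun s t hst => setIntegral_dist_mono hu hu' hst
  have hI' : Measurable fun z : ℝ × ℝ≥0 => ∫ s in Ioc 0 z.2, dist (u s) (u' s) ∂leb :=
    hI.comp measurable_snd
  have he : Measurable fun z : ℝ × ℝ≥0 => Real.exp (L * z.2) := by fun_prop
  exact he.mul (measurable_fst.add (hI'.const_mul _))

lemma Rates.HasBounds.measurable_decoupling (hb : ρ.HasBounds L M Λ) (hu : Continuous u)
    (hu' : Continuous u') (k : Fin K) : Measurable fun z : ℝ × ℝ × ℝ × Pt =>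
      decoupling ρ u u' k L z.1 z.2.1 z.2.2.1 z.2.2.2 := by
  have hy : Measurable fun z : ℝ × ℝ × ℝ × Pt => z.2.1 := measurable_snd.fst
  have hy' : Measurable fun z : ℝ × ℝ × ℝ × Pt => z.2.2.1 := measurable_snd.snd.fst
  have hp : Measurable fun z : ℝ × ℝ × ℝ × Pt => z.2.2.2 := measurable_snd.snd.snd
  have h1 : MeasurableSet {z : ℝ × ℝ × ℝ × Pt | Coupled z.2.1 z.2.2.1} :=
    measurableSet_iff (hy measurableSet_Ici) (hy' measurableSet_Ici)
  have h2 : MeasurableSet {z : ℝ × ℝ × ℝ × Pt |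
      |z.2.1 - z.2.2.1| ≤ gapBound L u u' z.1 z.2.2.2.time} :=
    measurableSet_le (hy.sub hy').abs
      ((measurable_gapBound hu hu' L).comp (measurable_fst.prodMk (measurable_time.comp hp)))
  have h3 : MeasurableSet {z : ℝ × ℝ × ℝ × Pt |
      Acts ρ u k z.2.2.2 z.2.1 ↔ Acts ρ u' k z.2.2.2 z.2.2.1} :=
    measurableSet_iff ((hy.prodMk hp) (hb.measurableSet_acts hu k))
      ((hy'.prodMk hp) (hb.measurableSet_acts hu' k))
  exact Measurable.ite (h1.inter (h2.inter h3.compl)) measurable_const measurable_const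

lemma PathSol.ofReal_leftLim_add_one_le {q : Measure Pt} {x₀ : ℝ} {x : ℝ≥0 → ℝ}
    (hx : PathSol ρ r u k q x₀ x) (hb : ρ.HasBounds L M Λ) (hr : r k ∈ Icc (0 : ℝ) 1) {s t : ℝ≥0}
    (hst : s ≤ t) : ENNReal.ofReal (Function.leftLim x s + 1) ≤ ENNReal.ofReal (x₀ + 1) +
      (M * t : ℝ≥0) + ∫⁻ p in {p | p.time ∈ Ioc 0 t}, connMass ρ u k p ∂q := by
  refine le_of_tendsto (ENNReal.tendsto_ofReal ((hx.cadlag.tendsto_gridBefore s).add_const 1))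
    (Eventually.of_forall fun n => ?_)
  have hn : gridBefore n s ≤ t := (gridBefore_le n s).trans hst
  have h := hx.ofReal_add_one_le hb hr (zero_le : 0 ≤ gridBefore n s)
  rw [hx.apply_zero] at h
  refine h.trans ?_
  gcongr

section Expectation

variable {Ω : Type*} [mΩ : MeasurableSpace Ω] {F : ℝ≥0 → MeasurableSpace Ω} {P : Measure Ω}
  {Q : Ω → Measure Pt} {α : Measure ℝ≥0}

/-- A bound for the expected number of decoupling points until time `t`; the factor `3` is the
number of kinds of points. -/
noncomputable def decouplingBound (L : ℝ≥0) (u u' : ℝ≥0 → Fin J → ℝ≥0) (t : ℝ≥0) (D : ℝ) : ℝ≥0∞ :=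
  ENNReal.ofReal (3 * (L * (gapBound L u u' D t * t + ∫ s in Ioc 0 t, dist (u s) (u' s) ∂leb)))

/-- The bound for the expected growth of the distance of two solutions; `ζ` is the expected total
increment by connections, `ξ` the expected total increment by the connections that concern only one
of the parameter paths, `x₀` is the first one of the initial values, and `D` is their distance. -/
noncomputable def distBound (L M : ℝ≥0) (u u' : ℝ≥0 → Fin J → ℝ≥0) (t : ℝ≥0) (ζ ξ : ℝ≥0∞)
    (x₀ D : ℝ) : ℝ≥0∞ :=
  ENNReal.ofReal (gapBound L u u' D t - D)
    + decouplingBound L u u' t D * (ENNReal.ofReal (x₀ + 1) + (M * t : ℝ≥0) + ζ)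
    + (M * t : ℝ≥0) * (ENNReal.ofReal D + decouplingBound L u u' t D)
    + (ENNReal.ofReal D + decouplingBound L u u' t D) * ζ + 2 * ξ

/-- The estimate for one user: until time `t` the distance of two solutions exceeds its initial
value at most by a random variable the expectation of which is bounded by `distBound`. -/
theorem exists_abs_sub_le_add [IsFiniteMeasure P] [IsProbabilityMeasure α]
    (hC : HasCompensator F time box Q (intensity α) P) (hsep : ∀ᵐ ω ∂P, IsSeparated (Q ω))
    (hb : ρ.HasBounds L M Λ) (hr : r k ∈ Icc (0 : ℝ) 1) (hu : Continuous u) (hu' : Continuous u')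
    {X₀ X₀' : Ω → ℝ} (hX₀ : Measurable[F 0] X₀) (hX₀' : Measurable[F 0] X₀')
    {x x' : ℝ≥0 → Ω → ℝ} (hxa : ∀ t, AEStronglyMeasurable[F t] (x t) P)
    (hxa' : ∀ t, AEStronglyMeasurable[F t] (x' t) P)
    (hx : ∀ᵐ ω ∂P, PathSol ρ r u k (Q ω) (X₀ ω) fun t => x t ω)
    (hx' : ∀ᵐ ω ∂P, PathSol ρ r u' k (Q ω) (X₀' ω) fun t => x' t ω) (t : ℝ≥0) :
    ∃ R : Ω → ℝ≥0∞, AEMeasurable R P ∧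
      (∀ᵐ ω ∂P, ∀ s ≤ t, ENNReal.ofReal |x s ω - x' s ω| ≤
        ENNReal.ofReal |X₀ ω - X₀' ω| + R ω) ∧
      ∫⁻ ω, R ω ∂P ≤ ∫⁻ ω, distBound L M u u' t
        (∫⁻ p in {p | p.time ∈ Ioc 0 t}, connMass ρ u k p ∂intensity α)
        (∫⁻ p in {p | p.time ∈ Ioc 0 t}, connGap ρ u u' k p ∂intensity α)
        (X₀ ω) |X₀ ω - X₀' ω| ∂P := by
  -- adapted versions and their left limits
  choose Y hYm hY using hxa
  choose Y' hYm' hY' using hxa'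
  set A : Set Pt := {p | p.time ∈ Ioc 0 t} with hA
  set D : Ω → ℝ := fun ω => |X₀ ω - X₀' ω| with hD
  set y : Ω × Pt → ℝ := gridLimit time Y with hy
  set y' : Ω × Pt → ℝ := gridLimit time Y' with hy'
  set f : Ω × Pt → ℝ≥0∞ := fun z => decoupling ρ u u' k L (D z.1) (y z) (y' z) z.2 with hf
  -- `V v` counts the decoupling points until time `v`, and `W` those strictly before a given point;
  -- the cutoff makes `V` adapted and `W` predictable
  set V : ℝ≥0 → Ω → ℝ≥0∞ := fun v ω => ∫⁻ p, (Prod.snd ⁻¹' {p | p.time ∈ Ioi 0}).indicator f (ω, p)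
    ∂cutoff time box Q v ω with hV
  set W : Ω × Pt → ℝ≥0∞ := fun z => ⨆ n, V (gridBefore n z.2.time) z.1 with hW
  set β : Ω → ℝ≥0∞ := fun ω => decouplingBound L u u' t (D ω) with hβ
  set ζ := ∫⁻ p in A, connMass ρ u k p ∂intensity α with hζ
  set ξ := ∫⁻ p in A, connGap ρ u u' k p ∂intensity α with hξ
  set κ : Ω × Pt → ℝ≥0∞ := fun z => connMass ρ u k z.2 with hκ
  have hD0 : ∀ ω, 0 ≤ D ω := fun ω => abs_nonneg _
  have hDm : Measurable[F 0] D :=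
    (by fun_prop : Measurable fun z : ℝ × ℝ => |z.1 - z.2|).comp (Measurable.prodMk hX₀ hX₀')
  have hsnd := measurable_snd_predSigma F time
  have hym : Measurable[predSigma F time] y :=
    measurable_gridLimit measurable_time fun t => (hYm t).measurable
  have hym' : Measurable[predSigma F time] y' :=
    measurable_gridLimit measurable_time fun t => (hYm' t).measurable
  have hDp : Measurable[predSigma F time] fun z : Ω × Pt => D z.1 :=
    measurable_comp_fst_predSigma time hDm
  have hfm : Measurable[predSigma F time] f :=
    (hb.measurable_decoupling hu hu' k).comp
      (Measurable.prodMk hDp (Measurable.prodMk hym (Measurable.prodMk hym' hsnd)))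
  have hVm : ∀ v, Measurable[F v] (V v) := fun v =>
    hC.measurable_lintegral_cutoff_of_pred
      (hfm.indicator (hsnd (measurableSet_time measurableSet_Ioi))) v
  have hWm : Measurable[predSigma F time] W :=
    Measurable.iSup fun n => measurable_comp_gridBefore measurable_time hVm n
  have hκm : Measurable[predSigma F time] κ := (hb.measurable_connMass hu k).comp hsnd
  have hgm : Measurable[predSigma F time] fun z : Ω × Pt => connGap ρ u u' k z.2 :=
    (hb.measurable_connGap hu hu' k).comp hsnd
  have hβm : Measurable[F 0] β := by
    have h1 : Measurable fun d : ℝ => gapBound L u u' d t :=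
      (measurable_gapBound hu hu' L).comp (measurable_id.prodMk measurable_const)
    have : Measurable fun d : ℝ => decouplingBound L u u' t d := by
      unfold decouplingBound; fun_prop
    exact this.comp hDm
  have hβp : Measurable[predSigma F time] fun z : Ω × Pt => β z.1 :=
    measurable_comp_fst_predSigma time hβm
  -- the good event
  have hae : ∀ᵐ ω ∂P, IsSeparated (Q ω) ∧ PathSol ρ r u k (Q ω) (X₀ ω) (fun t => x t ω) ∧
      PathSol ρ r u' k (Q ω) (X₀' ω) (fun t => x' t ω) ∧
      (∀ p, y (ω, p) = Function.leftLim (fun t => x t ω) p.time) ∧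
      (∀ p, y' (ω, p) = Function.leftLim (fun t => x' t ω) p.time) ∧
      (∀ v, V v ω = ∫⁻ p in {p | p.time ∈ Ioc 0 v}, f (ω, p) ∂Q ω) := by
    filter_upwards [hsep, hx, hx', hC.ae_box_lt_top,
      ae_all_iff.2 fun n : ℕ => ae_all_iff.2 fun i : ℕ => hY ((i : ℝ≥0) / 2 ^ n),
      ae_all_iff.2 fun n : ℕ => ae_all_iff.2 fun i : ℕ => hY' ((i : ℝ≥0) / 2 ^ n)]
      with ω h1 h2 h3 h4 h5 h6
    refine ⟨h1, h2, h3, fun p => gridLimit_eq_leftLim h2.cadlag (fun n i => (h5 n i).symm) p,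
      fun p => gridLimit_eq_leftLim h3.cadlag (fun n i => (h6 n i).symm) p, fun v => ?_⟩
    rw [hV]
    simp only
    rw [cutoff_eq h4, ← Measure.restrict_restrict_of_subset (s := {p | time p ∈ Ioc 0 v})
      (t := {p | time p ≤ v}) fun p hp => hp.2,
      ← lintegral_indicator (measurableSet_time measurableSet_Ioc)]
    refine setLIntegral_congr_fun
      (measurable_time measurableSet_Iic : MeasurableSet {p | time p ≤ v}) fun p hp => ?_
    by_cases h0 : 0 < p.time
    · rw [indicator_of_mem (show p ∈ {p : Pt | time p ∈ Ioc 0 v} from ⟨h0, hp⟩)]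
      exact indicator_of_mem (show (ω, p) ∈ Prod.snd ⁻¹' {p : Pt | p.time ∈ Ioi 0} from h0) _
    · rw [indicator_of_notMem (show p ∉ {p : Pt | time p ∈ Ioc 0 v} from fun h => h0 h.1)]
      exact indicator_of_notMem (show (ω, p) ∉ Prod.snd ⁻¹' {p : Pt | p.time ∈ Ioi 0} from h0) _
  set G₀ : Ω → ℝ≥0∞ := fun ω => ENNReal.ofReal (gapBound L u u' (D ω) t - D ω) with hG₀
  set D' : Ω → ℝ≥0∞ := fun ω => ENNReal.ofReal (D ω) with hD'
  set T₁ : Ω → ℝ≥0∞ := fun ω => ∫⁻ p in A, f (ω, p) * ENNReal.ofReal (y (ω, p) + 1) ∂Q ω with hT₁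
  set T₂ : Ω → ℝ≥0∞ := fun ω => ∫⁻ p in A, f (ω, p) ∂Q ω with hT₂
  set T₃ : Ω → ℝ≥0∞ := fun ω => ∫⁻ p in A, (D' ω + W (ω, p)) * κ (ω, p) ∂Q ω with hT₃
  set T₄ : Ω → ℝ≥0∞ := fun ω => ∫⁻ p in A, connGap ρ u u' k p ∂Q ω with hT₄
  set Z : Ω → ℝ≥0∞ := fun ω => ∫⁻ p in A, κ (ω, p) ∂Q ω with hZ
  have hD'm : Measurable[F 0] D' := ENNReal.measurable_ofReal.comp hDm
  have hD'p : Measurable[predSigma F time] fun z : Ω × Pt => D' z.1 :=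
    measurable_comp_fst_predSigma time hD'm
  have hm₁ : Measurable[predSigma F time] fun z => f z * ENNReal.ofReal (y z + 1) :=
    Measurable.mul hfm (ENNReal.measurable_ofReal.comp
      ((by fun_prop : Measurable fun v : ℝ => v + 1).comp hym))
  have hm₃ : Measurable[predSigma F time] fun z => (D' z.1 + W z) * κ z :=
    Measurable.mul (Measurable.add hD'p hWm) hκm
  have hT₁m : AEMeasurable T₁ P := hC.aemeasurable_setLIntegral hm₁ t
  have hT₂m : AEMeasurable T₂ P := hC.aemeasurable_setLIntegral hfm t
  have hT₃m : AEMeasurable T₃ P := hC.aemeasurable_setLIntegral hm₃ t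
  have hT₄m : AEMeasurable T₄ P := hC.aemeasurable_setLIntegral hgm t
  have hZm : AEMeasurable Z P := hC.aemeasurable_setLIntegral hκm t
  have hDm' : Measurable D' := hD'm.mono (hC.le 0) le_rfl
  have hβm' : Measurable β := hβm.mono (hC.le 0) le_rfl
  have hDT : AEMeasurable (fun ω => D' ω + T₂ ω) P := hDm'.aemeasurable.add hT₂m
  have hDβ : Measurable fun ω => D' ω + β ω := hDm'.add hβm'
  have hβZm : AEMeasurable (fun ω => β ω * Z ω) P := hβm'.aemeasurable.mul hZm
  -- given the past, decoupling points come at most at the rate of `decouplingBound`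
  have hrate : ∀ᵐ ω ∂P, ∫⁻ p in A, f (ω, p) ∂intensity α ≤ β ω := by
    filter_upwards [hae] with ω ⟨_, h2, h3, h4, h5, _⟩
    have hmeas : Measurable fun p : Pt => decoupling ρ u u' k L (D ω)
        (Function.leftLim (fun t => x t ω) p.time)
        (Function.leftLim (fun t => x' t ω) p.time) p :=
      (hb.measurable_decoupling hu hu' k).comp (measurable_const.prodMk
        ((h2.cadlag.measurable_leftLim.comp measurable_time).prodMk
          ((h3.cadlag.measurable_leftLim.comp measurable_time).prodMk measurable_id)))
    have := setLIntegral_decoupling_le (α := α) hb hu hu' (hD0 ω) h2.leftLim_mem h3.leftLim_mem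
      hmeas t
    simp only [hf, h4, h5]
    exact this
  -- expectations of the random terms
  have e₂ : ∫⁻ ω, T₂ ω ∂P ≤ ∫⁻ ω, β ω ∂P := by
    rw [hC.lintegral_setLIntegral_eq hfm measurableSet_Ioc]
    exact lintegral_mono_ae hrate
  have e₁ : ∫⁻ ω, T₁ ω ∂P ≤
      ∫⁻ ω, β ω * (ENNReal.ofReal (X₀ ω + 1) + (M * t : ℝ≥0) + ζ) ∂P := by
    -- `β` is known at time `0`, so the mass `Z` of the connections may be replaced by its mean `ζ`
    have hβZ : ∫⁻ ω, β ω * Z ω ∂P = ∫⁻ ω, β ω * ζ ∂P := by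
      have h1 := hC.lintegral_setLIntegral_eq (f := fun z => β z.1 * κ z)
        (Measurable.mul hβp hκm) (measurableSet_Ioc (a := 0) (b := t))
      have hκ' : Measurable fun p => connMass ρ u k p := hb.measurable_connMass hu k
      simp only [hκ, lintegral_const_mul _ hκ'] at h1
      exact h1
    rw [hC.lintegral_setLIntegral_eq hm₁ measurableSet_Ioc]
    calc ∫⁻ ω, ∫⁻ p in A, f (ω, p) * ENNReal.ofReal (y (ω, p) + 1) ∂intensity α ∂P
        ≤ ∫⁻ ω, (β ω * (ENNReal.ofReal (X₀ ω + 1) + (M * t : ℝ≥0)) + β ω * Z ω) ∂P := by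
          refine lintegral_mono_ae ?_
          filter_upwards [hae, hrate] with ω ⟨_, h2, _, h4, _⟩ hω
          have hfω : Measurable fun p => f (ω, p) :=
            (hfm.mono (predSigma_le hC.le measurable_time) le_rfl).comp measurable_prodMk_left
          calc ∫⁻ p in A, f (ω, p) * ENNReal.ofReal (y (ω, p) + 1) ∂intensity α
              ≤ ∫⁻ p in A, f (ω, p) * (ENNReal.ofReal (X₀ ω + 1) + (M * t : ℝ≥0) + Z ω)
                  ∂intensity α := by
                refine setLIntegral_mono' (measurableSet_time measurableSet_Ioc) fun p hp => ?_
                rw [h4]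
                gcongr
                exact h2.ofReal_leftLim_add_one_le hb hr hp.2
            _ = (∫⁻ p in A, f (ω, p) ∂intensity α) *
                  (ENNReal.ofReal (X₀ ω + 1) + (M * t : ℝ≥0) + Z ω) :=
                lintegral_mul_const _ hfω
            _ ≤ β ω * (ENNReal.ofReal (X₀ ω + 1) + (M * t : ℝ≥0) + Z ω) := by gcongr
            _ = _ := mul_add _ _ _
      _ = ∫⁻ ω, β ω * (ENNReal.ofReal (X₀ ω + 1) + (M * t : ℝ≥0)) ∂P +
            ∫⁻ ω, β ω * ζ ∂P := by
          rw [lintegral_add_right' _ hβZm, hβZ]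
      _ = _ := by
          rw [← lintegral_add_right _ (hβm'.mul_const ζ)]
          simp only [mul_add]
  have e₃ : ∫⁻ ω, T₃ ω ∂P ≤ ∫⁻ ω, (D' ω + β ω) * ζ ∂P := by
    rw [hC.lintegral_setLIntegral_eq hm₃ measurableSet_Ioc]
    calc ∫⁻ ω, ∫⁻ p in A, (D' ω + W (ω, p)) * κ (ω, p) ∂intensity α ∂P
        ≤ ∫⁻ ω, (D' ω + T₂ ω) * ζ ∂P := by
          refine lintegral_mono_ae ?_
          filter_upwards [hae] with ω ⟨_, _, _, _, _, h6⟩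
          rw [← lintegral_const_mul _ (hb.measurable_connMass hu k)]
          refine setLIntegral_mono' (measurableSet_time measurableSet_Ioc) fun p hp => ?_
          gcongr
          refine iSup_le fun n => ?_
          rw [h6]
          refine lintegral_mono_set fun z hz => ⟨hz.1, hz.2.trans ((gridBefore_le _ _).trans hp.2)⟩
      _ = (∫⁻ ω, D' ω ∂P + ∫⁻ ω, T₂ ω ∂P) * ζ := by
          rw [lintegral_mul_const'' _ hDT, lintegral_add_left hDm']
      _ ≤ (∫⁻ ω, D' ω ∂P + ∫⁻ ω, β ω ∂P) * ζ := by gcongr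
      _ = _ := by
          rw [← lintegral_add_left hDm', lintegral_mul_const _ hDβ]
  have e₄ : ∫⁻ ω, T₄ ω ∂P = ∫⁻ _, ξ ∂P := hC.lintegral_setLIntegral_eq hgm measurableSet_Ioc
  -- the pathwise estimate
  have hpath : ∀ᵐ ω ∂P, ∀ s ≤ t, ENNReal.ofReal |x s ω - x' s ω| ≤
      D' ω + (G₀ ω + T₁ ω + (M * t : ℝ≥0) * (D' ω + T₂ ω) + T₃ ω + 2 * T₄ ω) := by
    filter_upwards [hae] with ω ⟨h1, h2, h3, h4, h5, h6⟩ s hs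
    have hsplit : ENNReal.ofReal (gapBound L u u' (D ω) t) = D' ω + G₀ ω := by
      rw [hD', hG₀, ← ENNReal.ofReal_add (hD0 ω) (sub_nonneg.2 (le_gapBound (hD0 ω) t)),
        add_sub_cancel]
    simp only [← add_assoc]
    rw [← hsplit]
    have := h2.ofReal_abs_sub_le h3 hb hr hu hu' h1
      (W := fun σ => ⨆ n, V (gridBefore n σ) ω) (fun p h0 hp hd σ hσ _ => ?_) hs
    · simpa only [hT₁, hT₂, hT₃, hT₄, hf, h4, h5] using this
    · obtain ⟨n, hn⟩ := ((tendsto_gridBefore σ).eventually (lt_mem_nhds hσ)).exists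
      refine le_iSup_of_le n ?_
      rw [h6]
      refine le_trans (le_of_eq ?_) (le_setLIntegral_of_atom (fun p => f (ω, p)) hp
        (show p ∈ {p : Pt | p.time ∈ Ioc 0 (gridBefore n σ)} from ⟨h0, hn.le⟩))
      simp only [hf, h4, h5]
      exact (if_pos hd).symm
  have hG₀m : Measurable G₀ := by
    have h1 : Measurable fun d : ℝ => gapBound L u u' d t :=
      (measurable_gapBound hu hu' L).comp (measurable_id.prodMk measurable_const)
    have h2 : Measurable D := hDm.mono (hC.le 0) le_rfl
    exact ENNReal.measurable_ofReal.comp ((h1.comp h2).sub h2)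
  have hS : AEMeasurable (fun ω => (M * t : ℝ≥0) * (D' ω + T₂ ω)) P := hDT.const_mul _
  refine ⟨fun ω => G₀ ω + T₁ ω + (M * t : ℝ≥0) * (D' ω + T₂ ω) + T₃ ω + 2 * T₄ ω,
    (((hG₀m.aemeasurable.add hT₁m).add hS).add hT₃m).add (hT₄m.const_mul 2), hpath, ?_⟩
  calc ∫⁻ ω, (G₀ ω + T₁ ω + (M * t : ℝ≥0) * (D' ω + T₂ ω) + T₃ ω + 2 * T₄ ω) ∂P
      = ∫⁻ ω, G₀ ω ∂P + ∫⁻ ω, T₁ ω ∂P + (M * t : ℝ≥0) * (∫⁻ ω, D' ω ∂P + ∫⁻ ω, T₂ ω ∂P) +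
          ∫⁻ ω, T₃ ω ∂P + 2 * ∫⁻ ω, T₄ ω ∂P := by
        rw [lintegral_add_right' _ (hT₄m.const_mul 2), lintegral_add_right' _ hT₃m,
          lintegral_add_right' _ hS, lintegral_add_right' _ hT₁m, lintegral_const_mul'' _ hT₄m,
          lintegral_const_mul'' _ hDT, lintegral_add_right' _ hT₂m]
    _ ≤ ∫⁻ ω, G₀ ω ∂P +
          ∫⁻ ω, β ω * (ENNReal.ofReal (X₀ ω + 1) + (M * t : ℝ≥0) + ζ) ∂P +
          (M * t : ℝ≥0) * (∫⁻ ω, D' ω ∂P + ∫⁻ ω, β ω ∂P) +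
          ∫⁻ ω, (D' ω + β ω) * ζ ∂P + 2 * ∫⁻ _, ξ ∂P := by
        rw [e₄]
        gcongr
    _ = ∫⁻ ω, (G₀ ω + β ω * (ENNReal.ofReal (X₀ ω + 1) + (M * t : ℝ≥0) + ζ) +
          (M * t : ℝ≥0) * (D' ω + β ω) + (D' ω + β ω) * ζ + 2 * ξ) ∂P := by
        rw [lintegral_add_right _ measurable_const,
          lintegral_add_right _ (hDβ.mul_const ζ), lintegral_add_right _ (hDβ.const_mul _),
          lintegral_add_left hG₀m, lintegral_const_mul _ hDβ,
          lintegral_add_left hDm', lintegral_const, lintegral_const, mul_assoc]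

end Expectation

end OnOffNetwork

namespace OnOffNetwork

open Pt

/-! ### Elementary inequalities -/

/-- The part of the bound that is proportional to the initial distance. -/
lemma initial_coeff_le {L M q t U n : ℝ} (hL : 0 ≤ L) (hM : 0 ≤ M) (hq : 0 ≤ q) (ht : 0 ≤ t)
    (hU : 0 ≤ U) (hn : 0 ≤ n) :
    (Real.exp (L * t) - 1) + 3 * L * Real.exp (L * t) * t * (n + 1 + 2 * M * t + q * ((1 + U) * t))
      + M * t + q * ((1 + U) * t) ≤
    t * (1 + t + U + n) * (L + 3 * L * (1 + 2 * M) + M + q) *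
      Real.exp ((L + q) * (t * (1 + t + U + n))) := by
  set y := t * (1 + t + U + n) with hy
  have hty : t ≤ y := by rw [hy]; nlinarith [mul_nonneg ht ht, mul_nonneg ht hU, mul_nonneg ht hn]
  have hy0 : 0 ≤ y := ht.trans hty
  have hUy : (1 + U) * t ≤ y := by rw [hy]; nlinarith [mul_nonneg ht ht, mul_nonneg ht hn]
  have hny : t * (n + 1) ≤ y := by rw [hy]; nlinarith [mul_nonneg ht ht, mul_nonneg ht hU]
  have htty : t * t ≤ y := by rw [hy]; nlinarith [mul_nonneg ht hU, mul_nonneg ht hn]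
  have ha1 : Real.exp (L * t) - 1 ≤ L * t * Real.exp (L * t) := by
    have h1 := Real.add_one_le_exp (-(L * t))
    have h2 := mul_le_mul_of_nonneg_left h1 (Real.exp_pos (L * t)).le
    rw [← Real.exp_add, add_neg_cancel, Real.exp_zero] at h2
    linarith
  have hay : Real.exp (L * t) ≤ Real.exp (L * y) := Real.exp_le_exp.2 (by gcongr)
  have hqy : 1 + q * y ≤ Real.exp (q * y) := by
    have := Real.add_one_le_exp (q * y); linarith
  have hS : t * (n + 1 + 2 * M * t + q * ((1 + U) * t)) ≤ y * ((1 + 2 * M) * Real.exp (q * y)) := by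
    calc t * (n + 1 + 2 * M * t + q * ((1 + U) * t))
        = t * (n + 1) + 2 * M * (t * t) + q * (t * ((1 + U) * t)) := by ring
      _ ≤ y + 2 * M * y + q * (y * y) := by gcongr
      _ ≤ y * ((1 + 2 * M) * (1 + q * y)) := by
          have : 0 ≤ 2 * M * (q * y) * y := by positivity
          nlinarith
      _ ≤ _ := by gcongr
  have he : Real.exp ((L + q) * y) = Real.exp (L * y) * Real.exp (q * y) := by
    rw [← Real.exp_add]; ring_nf
  have h1L : 1 ≤ Real.exp (L * y) := Real.one_le_exp (by positivity)
  have h1q : 1 ≤ Real.exp (q * y) := Real.one_le_exp (by positivity)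
  have h1 : 1 ≤ Real.exp (L * y) * Real.exp (q * y) := one_le_mul_of_one_le_of_one_le h1L h1q
  have h2 : Real.exp (L * y) ≤ Real.exp (L * y) * Real.exp (q * y) :=
    le_mul_of_one_le_right (Real.exp_pos _).le h1q
  rw [he]
  set E := Real.exp (L * y) * Real.exp (q * y) with hE
  calc (Real.exp (L * t) - 1) +
        3 * L * Real.exp (L * t) * t * (n + 1 + 2 * M * t + q * ((1 + U) * t))
        + M * t + q * ((1 + U) * t)
      ≤ L * t * Real.exp (L * t) +
        3 * L * Real.exp (L * t) * (t * (n + 1 + 2 * M * t + q * ((1 + U) * t)))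
        + M * t + q * ((1 + U) * t) := by linarith
    _ ≤ L * y * E + 3 * L * Real.exp (L * y) * (y * ((1 + 2 * M) * Real.exp (q * y)))
        + M * y * E + q * y * E := by
        have e1 : L * t * Real.exp (L * t) ≤ L * y * E := by
          gcongr; exact hay.trans h2
        have e2 : M * t ≤ M * y * E :=
          (mul_le_mul_of_nonneg_left hty hM).trans (le_mul_of_one_le_right (by positivity) h1)
        have e3 : q * ((1 + U) * t) ≤ q * y * E :=
          (mul_le_mul_of_nonneg_left hUy hq).trans (le_mul_of_one_le_right (by positivity) h1)
        have e4 : 3 * L * Real.exp (L * t) * (t * (n + 1 + 2 * M * t + q * ((1 + U) * t))) ≤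
            3 * L * Real.exp (L * y) * (y * ((1 + 2 * M) * Real.exp (q * y))) := by gcongr
        linarith
    _ = _ := by rw [hE]; ring

/-- The part of the bound that is proportional to the distance of the parameter paths. -/
lemma param_coeff_le {L M q m t U n : ℝ} (hL : 0 ≤ L) (hM : 0 ≤ M) (hq : 0 ≤ q) (hm : 0 ≤ m)
    (ht : 0 ≤ t) (hU : 0 ≤ U) (hn : 0 ≤ n) :
    Real.exp (L * t) * L + 3 * L * (Real.exp (L * t) * L * t + 1) *
      (n + 1 + 2 * M * t + q * ((1 + U) * t)) + 2 * ((1 + m) * L) ≤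
    (1 + n) * (L + 3 * L + 2 * ((1 + m) * L)) *
      Real.exp ((2 * L + 2 * M + q) * (t * (1 + t + U + n))) := by
  set y := t * (1 + t + U + n) with hy
  have hty : t ≤ y := by rw [hy]; nlinarith [mul_nonneg ht ht, mul_nonneg ht hU, mul_nonneg ht hn]
  have hy0 : 0 ≤ y := ht.trans hty
  have hUy : (1 + U) * t ≤ y := by rw [hy]; nlinarith [mul_nonneg ht ht, mul_nonneg ht hn]
  have hay : Real.exp (L * t) ≤ Real.exp (L * y) := Real.exp_le_exp.2 (by gcongr)
  have h1L : 1 ≤ Real.exp (L * y) := Real.one_le_exp (by positivity)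
  have h1Lt : 1 ≤ Real.exp (L * t) := Real.one_le_exp (by positivity)
  have h1q : 1 ≤ Real.exp ((2 * M + q) * y) := Real.one_le_exp (by positivity)
  have hS : n + 1 + 2 * M * t + q * ((1 + U) * t) ≤ (1 + n) * Real.exp ((2 * M + q) * y) := by
    have h := Real.add_one_le_exp ((2 * M + q) * y)
    calc n + 1 + 2 * M * t + q * ((1 + U) * t) ≤ (1 + n) + 2 * M * y + q * y := by
          have e1 : 2 * M * t ≤ 2 * M * y := by gcongr
          have e2 : q * ((1 + U) * t) ≤ q * y := by gcongr
          linarith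
      _ ≤ (1 + n) * ((2 * M + q) * y + 1) := by
          have : 0 ≤ n * ((2 * M + q) * y) := by positivity
          linarith
      _ ≤ _ := by gcongr
  have hLt : Real.exp (L * t) * L * t + 1 ≤ Real.exp (L * y) * Real.exp (L * y) := by
    calc Real.exp (L * t) * L * t + 1 ≤ Real.exp (L * t) * L * t + Real.exp (L * t) := by linarith
      _ = Real.exp (L * t) * (L * t + 1) := by ring
      _ ≤ Real.exp (L * t) * Real.exp (L * t) := by
          gcongr; exact Real.add_one_le_exp _
      _ ≤ _ := by gcongr
  have he : Real.exp ((2 * L + 2 * M + q) * y) =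
      Real.exp (L * y) * Real.exp (L * y) * Real.exp ((2 * M + q) * y) := by
    rw [← Real.exp_add, ← Real.exp_add]; ring_nf
  have hE1 : Real.exp (L * y) ≤ Real.exp ((2 * L + 2 * M + q) * y) :=
    Real.exp_le_exp.2 (mul_le_mul_of_nonneg_right (by linarith) hy0)
  have hE2 : 1 ≤ Real.exp ((2 * L + 2 * M + q) * y) := Real.one_le_exp (by positivity)
  have hn1 : 1 ≤ 1 + n := by linarith
  set E := Real.exp ((2 * L + 2 * M + q) * y) with hE
  calc Real.exp (L * t) * L + 3 * L * (Real.exp (L * t) * L * t + 1) *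
        (n + 1 + 2 * M * t + q * ((1 + U) * t)) + 2 * ((1 + m) * L)
      ≤ E * L + 3 * L * (Real.exp (L * y) * Real.exp (L * y)) *
        ((1 + n) * Real.exp ((2 * M + q) * y)) + 2 * ((1 + m) * L) * E := by
        have e1 : Real.exp (L * t) * L ≤ E * L :=
          mul_le_mul_of_nonneg_right (hay.trans hE1) hL
        have e2 : 2 * ((1 + m) * L) ≤ 2 * ((1 + m) * L) * E :=
          le_mul_of_one_le_right (by positivity) hE2
        refine add_le_add (add_le_add e1 ?_) e2
        gcongr
    _ = E * L + 3 * L * (1 + n) * E + 2 * ((1 + m) * L) * E := by rw [he]; ring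
    _ ≤ (1 + n) * (E * L) + 3 * L * (1 + n) * E + (1 + n) * (2 * ((1 + m) * L) * E) := by
        have e1 : E * L ≤ (1 + n) * (E * L) := le_mul_of_one_le_left (by positivity) hn1
        have e2 : 2 * ((1 + m) * L) * E ≤ (1 + n) * (2 * ((1 + m) * L) * E) :=
          le_mul_of_one_le_left (by positivity) hn1
        linarith
    _ = _ := by ring

/-- The constant of the estimate for `N` users. -/
noncomputable def rateConst (N L M Λ m : ℝ≥0) : ℝ≥0 :=
  N * (L + 3 * L * (1 + 2 * M) + M + 2 * (1 + m) * Λ) + (L + 2 * (1 + m) * Λ) +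
    N * (L + 3 * L + 2 * ((1 + m) * L)) + (2 * L + 2 * M + 2 * (1 + m) * Λ)

/-- The sum of the bounds for `N` users is dominated by the bound in the theorem. Here `D` and `n`
stand for the distance and the size of the initial values, `U` for the size of the parameter path
and `I` for the integral of the distance of the parameter paths; `b`, `z` and `w` bound the numbers
of decouplings, connections and connections for one parameter path only. -/
lemma add_mul_bound_le {N L M Λ m t : ℝ≥0} {U n D I : ℝ} (hU : 0 ≤ U) (hn : 0 ≤ n) (hD : 0 ≤ D)
    (hI : 0 ≤ I) {g b z w : ℝ} (hg : g = Real.exp (L * t) * (D + L * I))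
    (hb : b = 3 * (L * (g * t + I))) (hz : z = (1 + m) * (Λ * (1 + U) * t))
    (hw : w = (1 + m) * (L * I)) :
    D + N * (g - D + b * (n + 1 + M * t + z) + M * t * (D + b) + (D + b) * z + 2 * w) ≤
      (D + rateConst N L M Λ m * (1 + n) * I) *
        Real.exp (rateConst N L M Λ m * (t * (1 + t + U + n))) := by
  set q : ℝ := 2 * (1 + m) * Λ with hq
  set y : ℝ := t * (1 + t + U + n) with hy
  set B : ℝ := L + 3 * L * (1 + 2 * M) + M + q with hB
  set B' : ℝ := L + 3 * L + 2 * ((1 + m) * L) with hB'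
  set A : ℝ := (rateConst N L M Λ m : ℝ) with hA
  have hAe : A = N * B + (L + q) + N * B' + (2 * L + 2 * M + q) := by
    rw [hA, rateConst]; push_cast; rw [hB, hB', hq]
  have hq0 : 0 ≤ q := by positivity
  have hB0 : 0 ≤ B := by positivity
  have hB0' : 0 ≤ B' := by positivity
  have hy0 : 0 ≤ y := by positivity
  have h1 := initial_coeff_le L.coe_nonneg M.coe_nonneg hq0 t.coe_nonneg hU hn
  have h2 := param_coeff_le L.coe_nonneg M.coe_nonneg hq0 m.coe_nonneg t.coe_nonneg hU hn
  rw [← hy, ← hB] at h1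
  rw [← hy, ← hB'] at h2
  set c₁ : ℝ := (Real.exp (L * t) - 1) +
    3 * L * Real.exp (L * t) * t * (n + 1 + 2 * M * t + q * ((1 + U) * t))
      + M * t + q * ((1 + U) * t) with hc₁
  set c₂ : ℝ := Real.exp (L * t) * L + 3 * L * (Real.exp (L * t) * L * t + 1) *
      (n + 1 + 2 * M * t + q * ((1 + U) * t)) + 2 * ((1 + m) * L) with hc₂
  have hsplit : g - D + b * (n + 1 + M * t + z) + M * t * (D + b) + (D + b) * z + 2 * w ≤
      D * c₁ + I * c₂ := by
    have hzq : 2 * z = q * ((1 + U) * t) := by rw [hz, hq]; ring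
    have hz0 : 0 ≤ z := by rw [hz]; positivity
    have : D * c₁ + I * c₂ - (g - D + b * (n + 1 + M * t + z) + M * t * (D + b) + (D + b) * z +
        2 * w) = D * z := by
      rw [hc₁, hc₂, ← hzq, hb, hg, hw]; ring
    have h0 : 0 ≤ D * z := mul_nonneg hD hz0
    linarith
  have hDpart : D + N * (D * c₁) ≤ D * Real.exp (A * y) := by
    have e1 : 1 + N * B * y ≤ Real.exp (N * B * y) := by
      have := Real.add_one_le_exp (N * B * y); linarith
    have e2 : 1 ≤ Real.exp ((L + q) * y) := Real.one_le_exp (by positivity)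
    calc D + N * (D * c₁) ≤ D + N * (D * (y * B * Real.exp ((L + q) * y))) := by gcongr
      _ ≤ D * Real.exp ((L + q) * y) + N * (D * (y * B * Real.exp ((L + q) * y))) := by
          have := le_mul_of_one_le_right hD e2; linarith
      _ = D * ((1 + N * B * y) * Real.exp ((L + q) * y)) := by ring
      _ ≤ D * (Real.exp (N * B * y) * Real.exp ((L + q) * y)) := by gcongr
      _ = D * Real.exp ((N * B + (L + q)) * y) := by rw [← Real.exp_add]; ring_nf
      _ ≤ D * Real.exp (A * y) := by
          refine mul_le_mul_of_nonneg_left (Real.exp_le_exp.2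
            (mul_le_mul_of_nonneg_right ?_ hy0)) hD
          have : 0 ≤ N * B' + (2 * L + 2 * M + q) := by positivity
          linarith
  have hIpart : N * (I * c₂) ≤ A * (1 + n) * I * Real.exp (A * y) := by
    calc N * (I * c₂) ≤ N * (I * ((1 + n) * B' * Real.exp ((2 * L + 2 * M + q) * y))) := by gcongr
      _ = N * B' * (1 + n) * I * Real.exp ((2 * L + 2 * M + q) * y) := by ring
      _ ≤ A * (1 + n) * I * Real.exp (A * y) := by
          have h3 : 0 ≤ N * B + (L + q) := by positivity
          have h4 : (0 : ℝ) ≤ 2 * L + 2 * M + q := by positivity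
          have h5 : 0 ≤ N * B' := by positivity
          have e1 : N * B' ≤ A := by linarith
          have e2 : 2 * L + 2 * M + q ≤ A := by linarith
          gcongr
  calc D + N * (g - D + b * (n + 1 + M * t + z) + M * t * (D + b) + (D + b) * z + 2 * w)
      ≤ D + N * (D * c₁ + I * c₂) := by gcongr
    _ = (D + N * (D * c₁)) + N * (I * c₂) := by ring
    _ ≤ D * Real.exp (A * y) + A * (1 + n) * I * Real.exp (A * y) := add_le_add hDpart hIpart
    _ = _ := by ring

/-! ### From the users to the network -/

variable {K J : ℕ} {ρ : Rates K J} {r : Fin K → ℝ} {u u' : ℝ≥0 → Fin J → ℝ≥0} {k : Fin K}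
  {L M Λ : ℝ≥0}

lemma distBound_le {t : ℝ≥0} {ζ ξ : ℝ≥0∞} {x₀ D D₁ n z w g b : ℝ} (hD : 0 ≤ D) (hD₁ : D ≤ D₁)
    (hn : 0 ≤ n) (hx : x₀ ≤ n) (hz : 0 ≤ z) (hw : 0 ≤ w) (hζ : ζ ≤ ENNReal.ofReal z)
    (hξ : ξ ≤ ENNReal.ofReal w) (hg : g = gapBound L u u' D₁ t)
    (hb : b = 3 * (L * (g * t + ∫ s in Ioc 0 t, dist (u s) (u' s) ∂leb))) :
    distBound L M u u' t ζ ξ x₀ D ≤ ENNReal.ofReal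
      (g - D₁ + b * (n + 1 + M * t + z) + M * t * (D₁ + b) + (D₁ + b) * z + 2 * w) := by
  have hI := setIntegral_dist_nonneg (u := u) (u' := u') t
  have hD₁0 : 0 ≤ D₁ := hD.trans hD₁
  have hg0 : 0 ≤ g := by rw [hg]; exact gapBound_nonneg hD₁0 t
  have hb0 : 0 ≤ b := by rw [hb]; positivity
  have h1 : 0 ≤ g - D₁ := by rw [hg]; exact sub_nonneg.2 (le_gapBound hD₁0 t)
  have hexp : 1 ≤ Real.exp (L * t) := Real.one_le_exp (by positivity)
  have e1 : gapBound L u u' D t - D ≤ g - D₁ := by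
    rw [hg]
    unfold gapBound
    have := mul_le_mul_of_nonneg_left hD₁ (sub_nonneg.2 hexp)
    linarith
  have hgD : gapBound L u u' D t ≤ g := by linarith
  have e2 : decouplingBound L u u' t D ≤ ENNReal.ofReal b := by
    rw [hb]
    unfold decouplingBound
    refine ENNReal.ofReal_le_ofReal ?_
    gcongr
  have eM : ((M * t : ℝ≥0) : ℝ≥0∞) = ENNReal.ofReal (M * t) := by
    rw [← NNReal.coe_mul, ENNReal.ofReal_coe_nnreal]
  have hMt : (0 : ℝ) ≤ M * t := by positivity
  have e3 : ENNReal.ofReal (x₀ + 1) ≤ ENNReal.ofReal (n + 1) :=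
    ENNReal.ofReal_le_ofReal (by linarith)
  have e4 : ENNReal.ofReal D ≤ ENNReal.ofReal D₁ := ENNReal.ofReal_le_ofReal hD₁
  rw [ENNReal.ofReal_add (by positivity) (by positivity),
    ENNReal.ofReal_add (by positivity) (by positivity),
    ENNReal.ofReal_add (by positivity) (by positivity),
    ENNReal.ofReal_add (by positivity) (by positivity),
    ENNReal.ofReal_mul hb0, ENNReal.ofReal_add (by positivity) hz,
    ENNReal.ofReal_add (by positivity) hMt, ENNReal.ofReal_mul hMt,
    ENNReal.ofReal_mul (by positivity : 0 ≤ D₁ + b), ENNReal.ofReal_add hD₁0 hb0,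
    ENNReal.ofReal_mul zero_le_two, ← eM]
  unfold distBound
  gcongr
  norm_num

section SupNorm

variable {N : ℕ} {v : ℝ≥0 → Fin N → ℝ}

lemma supNorm_mono (v : ℝ≥0 → Fin N → ℝ) : Monotone (supNorm v) := fun _ _ hst =>
  biSup_mono fun _ hs => ⟨hs.1, hs.2.trans hst⟩

lemma supNorm_lt_top (hv : Continuous v) (t : ℝ≥0) : supNorm v t < ∞ := by
  obtain ⟨C, hC⟩ := (isCompact_Icc (a := 0) (b := t)).exists_bound_of_continuousOn hv.continuousOn
  refine lt_of_le_of_lt (iSup₂_le fun s hs => ?_) (ENNReal.ofReal_lt_top (r := C))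
  rw [← ofReal_norm]
  exact ENNReal.ofReal_le_ofReal (hC s hs)

lemma toReal_supNorm_mono (hv : Continuous v) : Monotone fun t => (supNorm v t).toReal :=
  fun _ t hst => ENNReal.toReal_mono (supNorm_lt_top hv t).ne (supNorm_mono v hst)

lemma norm_le_toReal_supNorm (hv : Continuous v) {s t : ℝ≥0} (hst : s ≤ t) :
    ‖v s‖ ≤ (supNorm v t).toReal := by
  rw [← ENNReal.ofReal_le_iff_le_toReal (supNorm_lt_top hv t).ne, ofReal_norm]
  exact le_iSup₂_of_le s ⟨zero_le, hst⟩ le_rfl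

lemma continuous_realPath (hu : Continuous u) : Continuous (realPath u) :=
  continuous_pi fun j => NNReal.continuous_coe.comp ((continuous_apply j).comp hu)

lemma dist_eq_norm_realPath (u u' : ℝ≥0 → Fin J → ℝ≥0) (s : ℝ≥0) :
    dist (u s) (u' s) = ‖(realPath u - realPath u') s‖ := by
  rw [Pi.sub_apply, ← dist_eq_norm]
  rfl

lemma dist_zero_eq_norm_realPath (u : ℝ≥0 → Fin J → ℝ≥0) (s : ℝ≥0) :
    dist (u s) 0 = ‖realPath u s‖ := by
  rw [← dist_zero_right]
  rfl

end SupNorm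

lemma rateC_nonneg (A : ℝ≥0) (u : ℝ≥0 → Fin J → ℝ≥0) (x x' : Fin K → ℝ) (t : ℝ≥0) :
    0 ≤ rateC A u x x' t := by
  unfold rateC; positivity

/-- The integral in the estimate dominates the integral of the distance of the parameter paths. -/
lemma mul_setIntegral_dist_le (hu : Continuous u) (hu' : Continuous u') (A : ℝ≥0)
    (x x' : Fin K → ℝ) (t : ℝ≥0) :
    A * (1 + (‖x‖ + ‖x'‖)) * ∫ s in Ioc 0 t, dist (u s) (u' s) ∂leb ≤
      ∫ s in Ioc 0 t, rateC A u x x' s * (supNorm (realPath u - realPath u') s).toReal ∂leb := by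
  have hc := continuous_realPath hu
  have hc' := hc.sub (continuous_realPath hu')
  have hm1 : Monotone fun s => rateC A u x x' s := fun s s' hss => by
    have := toReal_supNorm_mono hc hss
    have h2 : (s : ℝ) ≤ s' := hss
    unfold rateC
    refine mul_le_mul_of_nonneg_left ?_ A.coe_nonneg
    simp only at this
    linarith
  have hm2 := toReal_supNorm_mono hc'
  rw [← integral_const_mul]
  refine setIntegral_mono_on ((integrableOn_dist hu hu' 0 t).const_mul _) ?_ measurableSet_Ioc
    fun s hs => ?_
  · refine integrableOn_leb_of_bounded (hm1.measurable.mul hm2.measurable)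
      (C := rateC A u x x' t * (supNorm (realPath u - realPath u') t).toReal) fun s hs => ?_
    rw [Pi.mul_apply, abs_of_nonneg (mul_nonneg (rateC_nonneg _ _ _ _ _) ENNReal.toReal_nonneg)]
    exact mul_le_mul (hm1 hs.2) (hm2 hs.2) ENNReal.toReal_nonneg (rateC_nonneg _ _ _ _ _)
  · rw [dist_eq_norm_realPath]
    refine mul_le_mul ?_ (norm_le_toReal_supNorm hc' le_rfl) (norm_nonneg _)
      (rateC_nonneg _ _ _ _ _)
    unfold rateC
    refine mul_le_mul_of_nonneg_left ?_ A.coe_nonneg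
    have h1 : (0 : ℝ) ≤ s := s.coe_nonneg
    have h2 : 0 ≤ (supNorm (realPath u) s).toReal := ENNReal.toReal_nonneg
    linarith

end OnOffNetwork

namespace OnOffNetwork

open Pt

variable {K J : ℕ} {ρ : Rates K J} {r : Fin K → ℝ} {u u' : ℝ≥0 → Fin J → ℝ≥0}
  {L M Λ : ℝ≥0}

/-- The bound for the expected distance of two solutions until time `t`, given their initial
values `x` and `x'`. -/
noncomputable def expectedBound (A : ℝ≥0) (u u' : ℝ≥0 → Fin J → ℝ≥0) (t : ℝ≥0)
    (x x' : Fin K → ℝ) : ℝ :=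
  (‖x - x'‖ + A * (1 + (‖x‖ + ‖x'‖)) * ∫ s in Ioc 0 t, dist (u s) (u' s) ∂leb) *
    Real.exp (A * (t * (1 + t + (supNorm (realPath u) t).toReal + (‖x‖ + ‖x'‖))))

lemma expectedBound_le (hu : Continuous u) (hu' : Continuous u') (A : ℝ≥0) (t : ℝ≥0)
    (x x' : Fin K → ℝ) :
    expectedBound A u u' t x x' ≤ (‖x - x'‖ + ∫ s in Ioc 0 t, rateC A u x x' s *
      (supNorm (realPath u - realPath u') s).toReal ∂leb) * Real.exp (t * rateC A u x x' t) := by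
  have h := mul_setIntegral_dist_le hu hu' A x x' t
  have he : A * (t * (1 + t + (supNorm (realPath u) t).toReal + (‖x‖ + ‖x'‖))) =
      t * rateC A u x x' t := by unfold rateC; ring
  unfold expectedBound
  rw [he]
  gcongr

lemma measurable_expectedBound (A : ℝ≥0) (u u' : ℝ≥0 → Fin J → ℝ≥0) (t : ℝ≥0) :
    Measurable fun z : (Fin K → ℝ) × (Fin K → ℝ) => expectedBound A u u' t z.1 z.2 := by
  unfold expectedBound
  exact (by fun_prop : Continuous fun z : (Fin K → ℝ) × (Fin K → ℝ) =>
    (‖z.1 - z.2‖ + A * (1 + (‖z.1‖ + ‖z.2‖)) * ∫ s in Ioc 0 t, dist (u s) (u' s) ∂leb) *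
    Real.exp (A * (t * (1 + t + (supNorm (realPath u) t).toReal + (‖z.1‖ + ‖z.2‖))))).measurable

variable {α : Fin K → Measure ℝ≥0} {m : Fin K → ℝ≥0}

/-- The bounds of the single users add up to the bound for the network. -/
lemma add_sum_distBound_le [∀ k, IsProbabilityMeasure (α k)] (hb : ρ.HasBounds L M Λ)
    (hm : ∀ k, ∫⁻ w, (w : ℝ≥0∞) ∂(α k) = m k) (hu : Continuous u) (hu' : Continuous u')
    (t : ℝ≥0) (x x' : Fin K → ℝ) :
    ENNReal.ofReal ‖x - x'‖ + ∑ k, distBound L M u u' t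
        (∫⁻ p in {p | p.time ∈ Ioc 0 t}, connMass ρ u k p ∂intensity (α k))
        (∫⁻ p in {p | p.time ∈ Ioc 0 t}, connGap ρ u u' k p ∂intensity (α k))
        (x k) |x k - x' k| ≤
      ENNReal.ofReal (expectedBound (rateConst K L M Λ (∑ k, m k)) u u' t x x') := by
  set n : ℝ := ‖x‖ + ‖x'‖ with hn
  set D : ℝ := ‖x - x'‖ with hD
  set U : ℝ := (supNorm (realPath u) t).toReal with hU
  set I : ℝ := ∫ s in Ioc 0 t, dist (u s) (u' s) ∂leb with hI
  set μ : ℝ≥0 := ∑ k, m k with hμ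
  have hU0 : 0 ≤ U := ENNReal.toReal_nonneg
  have hI0 : 0 ≤ I := setIntegral_dist_nonneg t
  have hD0 : 0 ≤ D := norm_nonneg _
  set g : ℝ := Real.exp (L * t) * (D + L * I) with hg
  set b : ℝ := 3 * (L * (g * t + I)) with hbd
  set z : ℝ := (1 + μ) * (Λ * (1 + U) * t) with hz
  set w : ℝ := (1 + μ) * (L * I) with hw
  have hmk : ∀ k, m k ≤ μ := fun k =>
    Finset.single_le_sum (fun i _ => zero_le) (Finset.mem_univ k)
  have hUs : ∀ s ≤ t, dist (u s) 0 ≤ U.toNNReal := fun s hs => by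
    rw [Real.coe_toNNReal _ hU0, dist_zero_eq_norm_realPath]
    exact norm_le_toReal_supNorm (continuous_realPath hu) hs
  have hk : ∀ k, distBound L M u u' t
        (∫⁻ p in {p | p.time ∈ Ioc 0 t}, connMass ρ u k p ∂intensity (α k))
        (∫⁻ p in {p | p.time ∈ Ioc 0 t}, connGap ρ u u' k p ∂intensity (α k))
        (x k) |x k - x' k| ≤ ENNReal.ofReal
          (g - D + b * (n + 1 + M * t + z) + M * t * (D + b) + (D + b) * z + 2 * w) := fun k => by
    refine distBound_le (abs_nonneg _) ?_ (by positivity) ?_ (by positivity) (by positivity)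
      ?_ ?_ rfl rfl
    · exact norm_le_pi_norm (x - x') k
    · exact (le_abs_self _).trans ((norm_le_pi_norm x k).trans
        (le_add_of_nonneg_right (norm_nonneg _)))
    · refine (setLIntegral_connMass_le hb hu (hm k) hUs).trans ?_
      rw [← ENNReal.ofReal_coe_nnreal]
      refine ENNReal.ofReal_le_ofReal ?_
      push_cast
      rw [Real.coe_toNNReal _ hU0, hz]
      have : (m k : ℝ) ≤ μ := hmk k
      gcongr
    · refine (setLIntegral_connGap_le hb hu hu' (hm k) t).trans (ENNReal.ofReal_le_ofReal ?_)
      have : (m k : ℝ) ≤ μ := hmk k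
      rw [hw]
      gcongr
  have hnn : 0 ≤ g - D + b * (n + 1 + M * t + z) + M * t * (D + b) + (D + b) * z + 2 * w := by
    have h1 : 0 ≤ g - D := sub_nonneg.2 (le_gapBound (u := u) (u' := u') hD0 t)
    positivity
  calc _ ≤ ENNReal.ofReal D + ∑ _k : Fin K, ENNReal.ofReal
          (g - D + b * (n + 1 + M * t + z) + M * t * (D + b) + (D + b) * z + 2 * w) := by
        gcongr with k _
        exact hk k
    _ = ENNReal.ofReal (D + (K : ℝ≥0) *
          (g - D + b * (n + 1 + M * t + z) + M * t * (D + b) + (D + b) * z + 2 * w)) := by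
        rw [ENNReal.ofReal_add hD0 (by positivity), ENNReal.ofReal_mul (by positivity)]
        simp
    _ ≤ _ := by
        refine ENNReal.ofReal_le_ofReal ?_
        exact add_mul_bound_le hU0 (by positivity) hD0 hI0 rfl rfl rfl rfl

variable {Ω : Type*} {H : MeasurableSpace Ω} [mΩ : MeasurableSpace Ω] {P : Measure Ω}
  {η : Noise K Ω}

/-- The estimate for two solutions on an event `G` of the initial information. A user of the network
does not influence the others, so the distance of the solutions grows at most by the sum of the
growths for the single users. -/
theorem setLIntegral_supNorm_le [IsProbabilityMeasure P] [∀ k, IsProbabilityMeasure (α k)]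
    (hb : ρ.HasBounds L M Λ) (hr : ∀ k, r k ∈ Icc (0 : ℝ) 1)
    (hm : ∀ k, ∫⁻ w, (w : ℝ≥0∞) ∂(α k) = m k) (hη : η.IsPoisson α P) (hH : H ≤ mΩ)
    (hHη : Indep H η.sigma P) (hu : Continuous u) (hu' : Continuous u')
    {X₀ X₀' : Ω → Fin K → ℝ} {X X' : ℝ≥0 → Ω → Fin K → ℝ}
    (hX₀ : Measurable[H] X₀) (hX₀' : Measurable[H] X₀')
    (hX : IsSolution H P ρ r η u X₀ X) (hX' : IsSolution H P ρ r η u' X₀' X') (t : ℝ≥0)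
    {G : Set Ω} (hG : MeasurableSet[H] G) :
    ∫⁻ ω in G, supNorm (fun s => X s ω - X' s ω) t ∂P ≤ ∫⁻ ω in G,
      ENNReal.ofReal (expectedBound (rateConst K L M Λ (∑ k, m k)) u u' t (X₀ ω) (X₀' ω)) ∂P := by
  set B : Ω → ℝ≥0∞ := fun ω =>
    ENNReal.ofReal (expectedBound (rateConst K L M Λ (∑ k, m k)) u u' t (X₀ ω) (X₀' ω)) with hB
  have hH0 : H ≤ filt H η 0 := le_sup_left
  -- apply the estimate for one user under the restriction of the law to the event `G`
  have hc : ∀ k, Measurable fun y : Fin K → ℝ => y k := fun k => measurable_pi_apply k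
  have hpath := ae_restrict_of_ae (s := G) hX.ae_pathSol
  have hpath' := ae_restrict_of_ae (s := G) hX'.ae_pathSol
  have hR := fun k => exists_abs_sub_le_add (P := P.restrict G) (F := filt H η)
    (Q := η.points k) (α := α k) (r := r) (k := k) (ρ := ρ) (u := u) (u' := u')
    ((hη.hasCompensator (fun k => inferInstance) hH hHη k).restrict (hH0 _ hG))
    (ae_restrict_of_ae (hη.ae_isSeparated (fun k => inferInstance) k)) hb (hr k) hu hu'
    (X₀ := fun ω => X₀ ω k) (X₀' := fun ω => X₀' ω k)
    (((hc k).comp hX₀).mono hH0 le_rfl) (((hc k).comp hX₀').mono hH0 le_rfl)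
    (x := fun s ω => X s ω k) (x' := fun s ω => X' s ω k)
    (fun s => ((continuous_apply k).comp_aestronglyMeasurable (hX.adapted s)).restrict)
    (fun s => ((continuous_apply k).comp_aestronglyMeasurable (hX'.adapted s)).restrict)
    (hpath.mono fun ω h => h k) (hpath'.mono fun ω h => h k) t
  choose R hRm hRle hRint using hR
  have hsup : ∀ᵐ ω ∂P.restrict G, supNorm (fun s => X s ω - X' s ω) t ≤
      ENNReal.ofReal ‖X₀ ω - X₀' ω‖ + ∑ k, R k ω := by
    filter_upwards [ae_all_iff.2 hRle] with ω hω
    refine iSup₂_le fun s hs => ?_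
    rw [← enorm_norm, enorm_eq_nnnorm, nnnorm_norm]
    rw [Pi.nnnorm_def, ENNReal.coe_finset_sup]
    refine Finset.sup_le fun k _ => ?_
    have h1 := hω k s hs.2
    have e1 : ((‖(X s ω - X' s ω) k‖₊ : ℝ≥0) : ℝ≥0∞) = ENNReal.ofReal |X s ω k - X' s ω k| := by
      rw [← enorm_eq_nnnorm, ← ofReal_norm]; rfl
    refine e1.le.trans (h1.trans (add_le_add (ENNReal.ofReal_le_ofReal ?_) ?_))
    · exact norm_le_pi_norm (X₀ ω - X₀' ω) k
    · exact Finset.single_le_sum (f := fun k => R k ω) (fun i _ => zero_le) (Finset.mem_univ k)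
  have hDm : Measurable fun ω => ENNReal.ofReal ‖X₀ ω - X₀' ω‖ :=
    ((hX₀.mono hH le_rfl).sub (hX₀'.mono hH le_rfl)).norm.ennreal_ofReal
  have hsum : ∀ ω, ENNReal.ofReal ‖X₀ ω - X₀' ω‖ + ∑ k, distBound L M u u' t
        (∫⁻ p in {p | p.time ∈ Ioc 0 t}, connMass ρ u k p ∂intensity (α k))
        (∫⁻ p in {p | p.time ∈ Ioc 0 t}, connGap ρ u u' k p ∂intensity (α k))
        (X₀ ω k) |X₀ ω k - X₀' ω k| ≤ B ω := fun ω =>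
    add_sum_distBound_le hb hm hu hu' t (X₀ ω) (X₀' ω)
  calc ∫⁻ ω in G, supNorm (fun s => X s ω - X' s ω) t ∂P
      ≤ ∫⁻ ω in G, (ENNReal.ofReal ‖X₀ ω - X₀' ω‖ + ∑ k, R k ω) ∂P := lintegral_mono_ae hsup
    _ = ∫⁻ ω in G, ENNReal.ofReal ‖X₀ ω - X₀' ω‖ ∂P + ∑ k, ∫⁻ ω in G, R k ω ∂P := by
        rw [lintegral_add_left hDm, lintegral_finsetSum' _ fun k _ => hRm k]
    _ ≤ ∫⁻ ω in G, ENNReal.ofReal ‖X₀ ω - X₀' ω‖ ∂P + ∑ k, ∫⁻ ω in G, distBound L M u u' t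
        (∫⁻ p in {p | p.time ∈ Ioc 0 t}, connMass ρ u k p ∂intensity (α k))
        (∫⁻ p in {p | p.time ∈ Ioc 0 t}, connGap ρ u u' k p ∂intensity (α k))
        (X₀ ω k) |X₀ ω k - X₀' ω k| ∂P := by
        exact add_le_add le_rfl (Finset.sum_le_sum fun k _ => hRint k)
    _ ≤ ∫⁻ ω in G, B ω ∂P := by
        refine le_trans ?_ (lintegral_mono hsum)
        rw [lintegral_add_left hDm]
        gcongr
        -- a sum of integrals is at most the integral of the sum
        induction (Finset.univ : Finset (Fin K)) using Finset.induction_on with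
        | empty => simp
        | insert k s hk ih =>
          simp only [Finset.sum_insert hk]
          exact (add_le_add le_rfl ih).trans (le_lintegral_add _ _)

/-- The estimate for two solutions, given their initial values. -/
theorem condLExp_supNorm_le [IsProbabilityMeasure P] [∀ k, IsProbabilityMeasure (α k)]
    (hb : ρ.HasBounds L M Λ) (hr : ∀ k, r k ∈ Icc (0 : ℝ) 1)
    (hm : ∀ k, ∫⁻ w, (w : ℝ≥0∞) ∂(α k) = m k) (hη : η.IsPoisson α P) (hH : H ≤ mΩ)
    (hHη : Indep H η.sigma P) (hu : Continuous u) (hu' : Continuous u')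
    {X₀ X₀' : Ω → Fin K → ℝ} {X X' : ℝ≥0 → Ω → Fin K → ℝ}
    (hX₀ : Measurable[H] X₀) (hX₀' : Measurable[H] X₀')
    (hX : IsSolution H P ρ r η u X₀ X) (hX' : IsSolution H P ρ r η u' X₀' X') (t : ℝ≥0) :
    ∀ᵐ ω ∂P, condLExp (MeasurableSpace.comap (fun ω => (X₀ ω, X₀' ω)) inferInstance) P
        (fun ω => supNorm (fun s => X s ω - X' s ω) t) ω ≤
      ENNReal.ofReal (expectedBound (rateConst K L M Λ (∑ k, m k)) u u' t (X₀ ω) (X₀' ω)) := by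
  set m₀ : MeasurableSpace Ω := MeasurableSpace.comap (fun ω => (X₀ ω, X₀' ω)) inferInstance
    with hm₀
  have hm₀H : m₀ ≤ H := by
    have : Measurable[H] fun ω => (X₀ ω, X₀' ω) := hX₀.prodMk hX₀'
    exact this.comap_le
  have hm₀Ω : m₀ ≤ mΩ := hm₀H.trans hH
  set B : Ω → ℝ≥0∞ := fun ω =>
    ENNReal.ofReal (expectedBound (rateConst K L M Λ (∑ k, m k)) u u' t (X₀ ω) (X₀' ω)) with hB
  have hBm : Measurable[m₀] B := by
    have h1 : Measurable[m₀] fun ω => (X₀ ω, X₀' ω) := comap_measurable _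
    have h2 := (measurable_expectedBound (K := K) (rateConst K L M Λ (∑ k, m k)) u u' t).comp h1
    exact ENNReal.measurable_ofReal.comp h2
  refine ae_le_of_ae_le_trim (hm := hm₀Ω) (ae_le_of_forall_setLIntegral_le_of_sigmaFinite
    (measurable_condLExp _ _ _) fun G hG _ => ?_)
  rw [setLIntegral_condLExp_trim hm₀Ω P _ hG, setLIntegral_trim hm₀Ω hBm hG]
  exact setLIntegral_supNorm_le (mΩ := mΩ) hb hr hm hη hH hHη hu hu' hX₀ hX₀' hX hX' t (hm₀H _ hG)

end OnOffNetwork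

namespace OnOffNetwork

open Pt

/-! ### The flow of the drift -/

/-- A continuous, bounded, nonnegative velocity field on the line that depends on time and is
Lipschitz in space. -/
structure IsVelocity (w : ℝ≥0 → ℝ → ℝ) (L M : ℝ≥0) : Prop where
  continuous : Continuous (Function.uncurry w)
  lipschitz : ∀ v, LipschitzWith L (w v)
  nonneg : ∀ v x, 0 ≤ w v x
  le : ∀ v x, w v x ≤ M

/-- The curve `c` follows the velocity field from `x` at time `s` until time `t`. -/
structure IsTraj (w : ℝ≥0 → ℝ → ℝ) (s t x : ℝ) (c : ℝ → ℝ) : Prop where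
  start : c s = x
  deriv : ∀ τ ∈ Icc s t, HasDerivWithinAt c (w τ.toNNReal (c τ)) (Icc s t) τ

variable {w : ℝ≥0 → ℝ → ℝ} {L M : ℝ≥0}

namespace IsTraj

variable {s t v x x' : ℝ} {c c' : ℝ → ℝ}

lemma continuousOn (h : IsTraj w s t x c) : ContinuousOn c (Icc s t) :=
  fun τ hτ => (h.deriv τ hτ).continuousWithinAt

lemma hasDerivWithinAt_Ici (h : IsTraj w s t x c) {τ : ℝ} (hτ : τ ∈ Ico s t) :
    HasDerivWithinAt c (w τ.toNNReal (c τ)) (Ici τ) τ :=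
  (h.deriv τ ⟨hτ.1, hτ.2.le⟩).mono_of_mem_nhdsWithin
    (mem_of_superset (Icc_mem_nhdsGE hτ.2) (Icc_subset_Icc_left hτ.1))

lemma left (h : IsTraj w s t x c) (hvt : v ≤ t) : IsTraj w s v x c :=
  ⟨h.start, fun τ hτ => (h.deriv τ ⟨hτ.1, hτ.2.trans hvt⟩).mono (Icc_subset_Icc_right hvt)⟩

lemma right (h : IsTraj w s t x c) (hsv : s ≤ v) : IsTraj w v t (c v) c :=
  ⟨rfl, fun τ hτ => (h.deriv τ ⟨hsv.trans hτ.1, hτ.2⟩).mono (Icc_subset_Icc_left hsv)⟩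

lemma abs_sub_le (hw : IsVelocity w L M) (h : IsTraj w s t x c) (h' : IsTraj w s t x' c')
    (hst : s ≤ t) : |c t - c' t| ≤ |x - x'| * Real.exp (L * (t - s)) := by
  refine dist_le_of_trajectories_ODE (v := fun τ y => w τ.toNNReal y) (a := s)
    (fun τ => hw.lipschitz _) h.continuousOn (fun τ hτ => h.hasDerivWithinAt_Ici hτ)
    h'.continuousOn (fun τ hτ => h'.hasDerivWithinAt_Ici hτ) ?_ t ⟨hst, le_rfl⟩
  rw [h.start, h'.start, Real.dist_eq]

lemma eq_of_start_eq (hw : IsVelocity w L M) (h : IsTraj w s t x c) (h' : IsTraj w s t x c')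
    (hst : s ≤ t) : c t = c' t := by
  have := h.abs_sub_le hw h' hst
  rw [sub_self, abs_zero, zero_mul] at this
  exact sub_eq_zero.1 (abs_nonpos_iff.1 this)

lemma continuousOn_velocity (hw : IsVelocity w L M) (h : IsTraj w s t x c) :
    ContinuousOn (fun τ => w τ.toNNReal (c τ)) (Icc s t) :=
  hw.continuous.comp_continuousOn
    (continuous_real_toNNReal.continuousOn.prodMk h.continuousOn)

lemma integral_eq (hw : IsVelocity w L M) (h : IsTraj w s t x c) (hst : s ≤ t) :
    c t = x + ∫ τ in s..t, w τ.toNNReal (c τ) := by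
  rw [intervalIntegral.integral_eq_sub_of_hasDeriv_right_of_le hst h.continuousOn
    (fun τ hτ => (h.hasDerivWithinAt_Ici ⟨hτ.1.le, hτ.2⟩).mono Ioi_subset_Ici_self)
    ((h.continuousOn_velocity hw).intervalIntegrable_of_Icc hst), h.start]
  ring

end IsTraj

lemma IsVelocity.exists_isTraj (hw : IsVelocity w L M) {s t : ℝ} (hst : s ≤ t) (x : ℝ) :
    ∃ c, IsTraj w s t x c := by
  have hpl : IsPicardLindelof (fun τ y => w τ.toNNReal y) (tmin := s) (tmax := t)
      ⟨s, le_rfl, hst⟩ x (M * (t - s).toNNReal) 0 M L := {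
    lipschitzOnWith := fun τ _ => (hw.lipschitz _).lipschitzOnWith
    continuousOn := fun y _ => (hw.continuous.comp
      (continuous_real_toNNReal.prodMk continuous_const)).continuousOn
    norm_le := fun τ _ y _ => by
      rw [Real.norm_of_nonneg (hw.nonneg _ _)]; exact hw.le _ _
    mul_max_le := by
      have h1 : (0 : ℝ) ≤ t - s := sub_nonneg.2 hst
      simp [max_eq_left h1] }
  obtain ⟨c, h1, h2⟩ := hpl.exists_eq_forall_mem_Icc_hasDerivWithinAt₀
  exact ⟨c, h1, h2⟩

open Classical in
/-- The position at time `t` after following the velocity field from `x` at time `s`. Negative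
states, which stand for OFF, do not move; nor does anything for `t < s`. -/
noncomputable def flow (w : ℝ≥0 → ℝ → ℝ) (s t : ℝ≥0) (x : ℝ) : ℝ :=
  if h : (0 ≤ x ∧ s ≤ t) ∧ ∃ c, IsTraj w s t x c then h.2.choose t else x

section Flow

variable {s t v : ℝ≥0} {x x' : ℝ}

lemma flow_of_neg (hx : ¬ 0 ≤ x) : flow w s t x = x := dif_neg fun h => hx h.1.1

lemma flow_of_lt (h : t < s) : flow w s t x = x := dif_neg fun h' => absurd h'.1.2 (not_le.2 h)

variable (hw : IsVelocity w L M)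
include hw

lemma IsTraj.flow_eq {c : ℝ → ℝ} (h : IsTraj w s t x c) (hx : 0 ≤ x) (hst : s ≤ t) :
    flow w s t x = c t := by
  have h' : (0 ≤ x ∧ s ≤ t) ∧ ∃ c, IsTraj w s t x c := ⟨⟨hx, hst⟩, c, h⟩
  rw [flow, dif_pos h']
  exact h'.2.choose_spec.eq_of_start_eq hw h (by exact_mod_cast hst)

lemma flow_self (s : ℝ≥0) (x : ℝ) : flow w s s x = x := by
  by_cases hx : 0 ≤ x
  · obtain ⟨c, hc⟩ := hw.exists_isTraj (le_refl (s : ℝ)) x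
    rw [hc.flow_eq hw hx le_rfl, hc.start]
  · exact flow_of_neg hx

/-- The flow solves the integrated equation. -/
lemma flow_eq_add_integral (hst : s ≤ t) (x : ℝ) :
    flow w s t x = x + ∫ v in Ioc s t, (if 0 ≤ x then w v (flow w s v x) else 0) ∂leb := by
  by_cases hx : 0 ≤ x
  · have hst' : (s : ℝ) ≤ t := by exact_mod_cast hst
    obtain ⟨c, hc⟩ := hw.exists_isTraj hst' x
    simp only [hx, if_true]
    rw [hc.flow_eq hw hx hst, hc.integral_eq hw hst', setIntegral_leb _ hst]
    congr 1
    refine intervalIntegral.integral_congr fun τ hτ => ?_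
    rw [uIcc_of_le hst'] at hτ
    have hsτ : s ≤ τ.toNNReal := by
      rw [← NNReal.coe_le_coe, Real.coe_toNNReal τ (s.coe_nonneg.trans hτ.1)]; exact hτ.1
    have e : ((τ.toNNReal : ℝ≥0) : ℝ) = τ := Real.coe_toNNReal τ (s.coe_nonneg.trans hτ.1)
    have hc' : IsTraj w s (τ.toNNReal : ℝ≥0) x c := hc.left (by rw [e]; exact hτ.2)
    change w τ.toNNReal (c τ) = w τ.toNNReal (flow w s τ.toNNReal x)
    rw [hc'.flow_eq hw hx hsτ, e]
  · simp [hx, flow_of_neg hx]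

lemma le_flow (s t : ℝ≥0) (x : ℝ) : x ≤ flow w s t x := by
  rcases lt_or_ge t s with h | h
  · rw [flow_of_lt h]
  rw [flow_eq_add_integral hw h, le_add_iff_nonneg_right]
  refine integral_nonneg fun v => ?_
  simp only [Pi.zero_apply]
  split_ifs
  · exact hw.nonneg _ _
  · exact le_rfl

lemma flow_nonneg_iff : 0 ≤ flow w s t x ↔ 0 ≤ x := by
  refine ⟨fun h => ?_, fun h => h.trans (le_flow hw s t x)⟩
  by_contra hx
  rw [flow_of_neg hx] at h
  exact hx h

/-- The flow property. -/
lemma flow_flow (hsv : s ≤ v) (hvt : v ≤ t) (x : ℝ) :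
    flow w v t (flow w s v x) = flow w s t x := by
  by_cases hx : 0 ≤ x
  · have hsv' : (s : ℝ) ≤ v := by exact_mod_cast hsv
    have hvt' : (v : ℝ) ≤ t := by exact_mod_cast hvt
    obtain ⟨c, hc⟩ := hw.exists_isTraj (hsv'.trans hvt') x
    have h0 : 0 ≤ flow w s v x := (flow_nonneg_iff hw).2 hx
    rw [(hc.left hvt').flow_eq hw hx hsv] at h0 ⊢
    rw [hc.flow_eq hw hx (hsv.trans hvt), (hc.right hsv').flow_eq hw h0 hvt]
  · rw [flow_of_neg hx, flow_of_neg hx, flow_of_neg hx]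

lemma flow_le (hst : s ≤ t) (x : ℝ) : flow w s t x ≤ x + M * (t - s) := by
  have hst' : (s : ℝ) ≤ t := by exact_mod_cast hst
  rw [flow_eq_add_integral hw hst]
  gcongr
  have := norm_setIntegral_le_of_norm_le_const (μ := leb) (s := Ioc s t) (C := M)
    (f := fun v => if 0 ≤ x then w v (flow w s v x) else 0) (leb_Ioc_lt_top s t) fun v _ => by
      split_ifs
      · rw [Real.norm_of_nonneg (hw.nonneg _ _)]; exact hw.le _ _
      · simp
  refine (le_abs_self _).trans (this.trans (le_of_eq ?_))
  rw [Measure.real, leb_Ioc, ENNReal.toReal_ofReal (sub_nonneg.2 hst')]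

lemma flow_mem_stateSpace (hx : x ∈ stateSpace) : flow w s t x ∈ stateSpace := by
  by_cases h : 0 ≤ x
  · exact Or.inr ((flow_nonneg_iff hw).2 h)
  · rwa [flow_of_neg h]

lemma abs_flow_sub_le (hx : 0 ≤ x) (hx' : 0 ≤ x') :
    |flow w s t x - flow w s t x'| ≤ Real.exp (L * t) * |x - x'| := by
  rcases lt_or_ge t s with h | h
  · rw [flow_of_lt h, flow_of_lt h]
    exact le_mul_of_one_le_left (abs_nonneg _) (Real.one_le_exp (by positivity))
  have h' : (s : ℝ) ≤ t := by exact_mod_cast h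
  obtain ⟨c, hc⟩ := hw.exists_isTraj h' x
  obtain ⟨c', hc'⟩ := hw.exists_isTraj h' x'
  rw [hc.flow_eq hw hx h, hc'.flow_eq hw hx' h, mul_comm]
  refine (hc.abs_sub_le hw hc' h').trans (mul_le_mul_of_nonneg_left (Real.exp_le_exp.2
    (mul_le_mul_of_nonneg_left ?_ L.coe_nonneg)) (abs_nonneg _))
  linarith [s.coe_nonneg]

lemma abs_flow_sub_flow_right_le (s : ℝ≥0) (x : ℝ) (t t' : ℝ≥0) :
    |flow w s t x - flow w s t' x| ≤ M * |(t : ℝ) - t'| := by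
  wlog htt : t ≤ t' generalizing t t'
  · rw [abs_sub_comm, abs_sub_comm (t : ℝ)]
    exact this t' t (le_of_not_ge htt)
  have htt' : (t : ℝ) ≤ t' := by exact_mod_cast htt
  rw [abs_sub_comm, abs_sub_comm (t : ℝ), abs_of_nonneg (sub_nonneg.2 htt')]
  rcases lt_or_ge t s with h | h
  · rw [flow_of_lt h, abs_of_nonneg (sub_nonneg.2 (le_flow hw _ _ _))]
    rcases lt_or_ge t' s with h2 | h2
    · rw [flow_of_lt h2, sub_self]
      exact mul_nonneg M.coe_nonneg (sub_nonneg.2 htt')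
    · have h1 := flow_le hw h2 x
      have h3 : (t : ℝ) ≤ s := by exact_mod_cast h.le
      have := mul_le_mul_of_nonneg_left (sub_le_sub_left h3 (t' : ℝ)) M.coe_nonneg
      linarith
  · rw [← flow_flow hw h htt x, abs_of_nonneg (sub_nonneg.2 (le_flow hw _ _ _))]
    linarith [flow_le hw htt (flow w s t x)]

lemma abs_flow_sub_flow_left_le (s s' t : ℝ≥0) (x : ℝ) :
    |flow w s t x - flow w s' t x| ≤ Real.exp (L * t) * (M * |(s : ℝ) - s'|) := by
  wlog hss : s ≤ s' generalizing s s'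
  · rw [abs_sub_comm, abs_sub_comm (s : ℝ)]
    exact this s' s (le_of_not_ge hss)
  by_cases hx : 0 ≤ x
  swap
  · rw [flow_of_neg hx, flow_of_neg hx, sub_self, abs_zero]
    positivity
  have hexp : 1 ≤ Real.exp (L * t) := Real.one_le_exp (by positivity)
  rcases lt_or_ge t s' with h | h
  · rw [flow_of_lt h]
    refine le_trans ?_ (le_mul_of_one_le_left (by positivity) hexp)
    rcases lt_or_ge t s with h2 | h2
    · rw [flow_of_lt h2, sub_self, abs_zero]; positivity
    · have h3 : (t : ℝ) ≤ s' := by exact_mod_cast h.le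
      have h4 : (s : ℝ) ≤ s' := by exact_mod_cast hss
      rw [abs_of_nonneg (sub_nonneg.2 (le_flow hw _ _ _)), abs_sub_comm,
        abs_of_nonneg (sub_nonneg.2 h4)]
      have h1 := flow_le hw h2 x
      have := mul_le_mul_of_nonneg_left (sub_le_sub_right h3 (s : ℝ)) M.coe_nonneg
      linarith
  · rw [← flow_flow hw hss h x]
    refine (abs_flow_sub_le hw ((flow_nonneg_iff hw).2 hx) hx).trans ?_
    gcongr
    have := abs_flow_sub_flow_right_le hw s x s' s
    rwa [flow_self hw, abs_sub_comm (s' : ℝ)] at this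

lemma continuous_flow_right (s : ℝ≥0) (x : ℝ) : Continuous fun t => flow w s t x := by
  refine (LipschitzWith.of_dist_le_mul (K := M) fun t t' => ?_).continuous
  rw [Real.dist_eq, NNReal.dist_eq]
  exact abs_flow_sub_flow_right_le hw s x t t'

lemma continuous_flow_left (t : ℝ≥0) (x : ℝ) : Continuous fun s => flow w s t x := by
  refine (LipschitzWith.of_dist_le_mul (K := (Real.exp (L * t)).toNNReal * M)
    fun s s' => ?_).continuous
  rw [Real.dist_eq, NNReal.dist_eq, NNReal.coe_mul, Real.coe_toNNReal _ (Real.exp_pos _).le,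
    mul_assoc]
  exact abs_flow_sub_flow_left_le hw s s' t x

lemma measurable_flow (s t : ℝ≥0) : Measurable (flow w s t) := by
  have h1 : Continuous ((Ici (0 : ℝ)).domRestrict (flow w s t)) := by
    refine (LipschitzWith.of_dist_le_mul (K := (Real.exp (L * t)).toNNReal)
      fun x x' => ?_).continuous
    rw [Real.coe_toNNReal _ (Real.exp_pos _).le]
    exact abs_flow_sub_le hw x.2 x'.2
  refine measurable_of_measurable_union_cover (Ici 0) (Ici 0)ᶜ measurableSet_Ici
    measurableSet_Ici.compl (fun x _ => (em (x ∈ Ici 0))) h1.measurable ?_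
  have : ((Ici (0 : ℝ))ᶜ.domRestrict (flow w s t)) = Subtype.val :=
    funext fun x => flow_of_neg x.2
  change Measurable ((Ici (0 : ℝ))ᶜ.domRestrict (flow w s t))
  rw [this]
  exact measurable_subtype_coe

lemma measurable_flow_right (s : ℝ≥0) : Measurable fun z : ℝ≥0 × ℝ => flow w s z.1 z.2 :=
  measurable_uncurry_of_continuous_of_measurable (u := fun t x => flow w s t x)
    (fun x => continuous_flow_right hw s x) fun t => measurable_flow hw s t

lemma measurable_flow_left (t : ℝ≥0) : Measurable fun z : ℝ≥0 × ℝ => flow w z.1 t z.2 :=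
  measurable_uncurry_of_continuous_of_measurable (u := fun s x => flow w s t x)
    (fun x => continuous_flow_left hw t x) fun s => measurable_flow hw s t

end Flow

end OnOffNetwork

namespace OnOffNetwork

open Pt

/-! ### Paths that consist of segments -/

variable {K J : ℕ} (ρ : Rates K J) (r : Fin K → ℝ) (u : ℝ≥0 → Fin J → ℝ≥0) (k : Fin K)

/-- The velocity of user `k`, extended to the whole line. -/
noncomputable def velocity (v : ℝ≥0) (x : ℝ) : ℝ := ρ.a k x.toNNReal (u v)

/-- The motion of user `k` in the absence of jumps. -/
noncomputable def driftFlow : ℝ≥0 → ℝ≥0 → ℝ → ℝ := flow (velocity ρ u k)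

/-- On the time interval `[s, t]` the path `x` follows the drift, except for a possible jump at
time `t`. The acting points have height at most `R`. -/
structure IsSegment (q : Measure Pt) (x : ℝ≥0 → ℝ) (s t R : ℝ≥0) : Prop where
  lt : s < t
  eq_flow : ∀ v ∈ Ico s t, x v = driftFlow ρ u k s v (x s)
  threshold_le : ∀ p, p.time ∈ Ioc s t →
    threshold ρ u k p (driftFlow ρ u k s p.time (x s)) ≤ R
  jump : (q.restrict {p | p.height ≤ R ∧ p.time ∈ Ioc s t} = 0 ∧
      x t = driftFlow ρ u k s t (x s)) ∨
    ∃ p, p.time = t ∧ q.restrict {p | p.height ≤ R ∧ p.time ∈ Ioc s t} = Measure.dirac p ∧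
      x t = driftFlow ρ u k s t (x s) + incr ρ r u k p (driftFlow ρ u k s t (x s))

variable {ρ r u k} {L M Λ : ℝ≥0}

lemma Rates.HasBounds.isVelocity (hb : ρ.HasBounds L M Λ) (hu : Continuous u) (k : Fin K) :
    IsVelocity (velocity ρ u k) L M where
  continuous := NNReal.continuous_coe.comp ((hb.a_lip k).continuous.comp
    ((continuous_real_toNNReal.comp continuous_snd).prodMk (hu.comp continuous_fst)))
  lipschitz v := LipschitzWith.of_dist_le_mul fun x x' => by
    have := abs_sub_le_of_lipschitz (hb.a_lip k) x x' (u v) (u v)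
    rwa [dist_self, add_zero] at this
  nonneg v x := NNReal.coe_nonneg _
  le v x := by exact_mod_cast hb.a_le k _ _

lemma driftFlow_eq_add_integral (hb : ρ.HasBounds L M Λ) (hu : Continuous u) {s t : ℝ≥0}
    (hst : s ≤ t) (x : ℝ) :
    driftFlow ρ u k s t x = x + ∫ v in Ioc s t, speed ρ u k v (driftFlow ρ u k s v x) ∂leb := by
  have hw := hb.isVelocity hu k
  have h := flow_eq_add_integral hw hst x
  unfold driftFlow
  rw [h]
  congr 1
  refine integral_congr_ae (Eventually.of_forall fun v => ?_)
  simp only [speed, flow_nonneg_iff hw]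
  rfl

/-- The integrated equation between the times `s` and `t`. -/
def SolvesOn (ρ : Rates K J) (r : Fin K → ℝ) (u : ℝ≥0 → Fin J → ℝ≥0) (k : Fin K)
    (q : Measure Pt) (x : ℝ≥0 → ℝ) (s t : ℝ≥0) : Prop :=
  IntegrableOn (fun p => incr ρ r u k p (Function.leftLim x p.time)) {p | p.time ∈ Ioc s t} q ∧
    x t = x s + ∫ p in {p | p.time ∈ Ioc s t}, incr ρ r u k p (Function.leftLim x p.time) ∂q
      + ∫ v in Ioc s t, drift ρ u k x v ∂leb

variable {q : Measure Pt} {x : ℝ≥0 → ℝ} {R : ℝ≥0} {x₀ : ℝ}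

namespace IsSegment

variable {s t : ℝ≥0}

lemma tendsto (hb : ρ.HasBounds L M Λ) (hu : Continuous u) (h : IsSegment ρ r u k q x s t R)
    {v : ℝ≥0} (hv : v ∈ Ioc s t) :
    Tendsto x (𝓝[<] v) (𝓝 (driftFlow ρ u k s v (x s))) := by
  have h1 : Tendsto (fun v => driftFlow ρ u k s v (x s)) (𝓝[<] v)
      (𝓝 (driftFlow ρ u k s v (x s))) :=
    (continuous_flow_right (hb.isVelocity hu k) s (x s)).continuousWithinAt
  refine h1.congr' ?_
  filter_upwards [Ico_mem_nhdsLT hv.1] with v' hv'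
  exact (h.eq_flow v' ⟨hv'.1, hv'.2.trans_le hv.2⟩).symm

lemma leftLim_eq (hb : ρ.HasBounds L M Λ) (hu : Continuous u)
    (h : IsSegment ρ r u k q x s t R) {v : ℝ≥0} (hv : v ∈ Ioc s t) :
    Function.leftLim x v = driftFlow ρ u k s v (x s) := by
  have hne : (𝓝[<] v).NeBot := nhdsLT_neBot_of_exists_lt ⟨s, hv.1⟩
  exact leftLim_eq_of_tendsto (h.tendsto hb hu hv)

lemma solvesOn (hb : ρ.HasBounds L M Λ) (hu : Continuous u)
    (h : IsSegment ρ r u k q x s t R) : SolvesOn ρ r u k q x s t := by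
  set f : Pt → ℝ := fun p => incr ρ r u k p (Function.leftLim x p.time) with hf
  set W : Set Pt := {p | p.height ≤ R ∧ p.time ∈ Ioc s t} with hW
  have hTm : MeasurableSet {p : Pt | p.time ∈ Ioc s t} := measurableSet_time measurableSet_Ioc
  have hsub : W ⊆ {p | p.time ∈ Ioc s t} := fun p hp => hp.2
  have hzero : ∀ p ∈ {p : Pt | p.time ∈ Ioc s t} \ W, f p = 0 := fun p hp => by
    rw [hf]
    simp only
    rw [h.leftLim_eq hb hu hp.1]
    refine incr_eq_zero_of_threshold_le ((h.threshold_le p hp.1).trans ?_)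
    by_contra hlt
    exact hp.2 ⟨(not_le.1 hlt).le, hp.1⟩
  have hdrift : ∫ v in Ioc s t, drift ρ u k x v ∂leb = driftFlow ρ u k s t (x s) - x s := by
    rw [driftFlow_eq_add_integral hb hu h.lt.le (x s), add_sub_cancel_left]
    refine setIntegral_congr_fun measurableSet_Ioc fun v hv => ?_
    simp only [drift_eq_speed]
    rw [h.leftLim_eq hb hu hv]
  have hjump : IntegrableOn f W q ∧
      ∫ p in W, f p ∂q = x t - driftFlow ρ u k s t (x s) := by
    rcases h.jump with ⟨h0, hx⟩ | ⟨p, hpt, hp, hx⟩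
    · rw [IntegrableOn, h0, hx]
      simp
    · rw [IntegrableOn, hp, integral_dirac, hx]
      refine ⟨integrable_dirac (by finiteness), ?_⟩
      rw [hf]
      simp only
      rw [hpt, h.leftLim_eq hb hu ⟨h.lt, le_rfl⟩, add_sub_cancel_left]
  refine ⟨hjump.1.of_forall_sdiff_eq_zero hTm hzero, ?_⟩
  rw [setIntegral_eq_of_subset_of_forall_sdiff_eq_zero hTm hsub hzero, hjump.2, hdrift]
  ring

end IsSegment

lemma SolvesOn.trans {s v t : ℝ≥0} (hsv : s ≤ v) (hvt : v ≤ t)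
    (hd : ∀ s t, IntegrableOn (drift ρ u k x) (Ioc s t) leb)
    (h : SolvesOn ρ r u k q x s v) (h' : SolvesOn ρ r u k q x v t) :
    SolvesOn ρ r u k q x s t := by
  have hset : {p : Pt | p.time ∈ Ioc s t} = {p | p.time ∈ Ioc s v} ∪ {p | p.time ∈ Ioc v t} := by
    rw [← Ioc_union_Ioc_eq_Ioc hsv hvt]; rfl
  have hdisj : Disjoint {p : Pt | p.time ∈ Ioc s v} {p | p.time ∈ Ioc v t} :=
    (Ioc_disjoint_Ioc_of_le le_rfl).preimage Pt.time
  refine ⟨by rw [hset]; exact h.1.union h'.1, ?_⟩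
  rw [hset, setIntegral_union hdisj (measurableSet_time measurableSet_Ioc) h.1 h'.1,
    setIntegral_leb_add hsv hvt (hd s t), h'.2, h.2]
  ring

/-- A path solves the equation if segments of it abut on each time from the left and from the
right. -/
lemma pathSol_of_isSegment (hb : ρ.HasBounds L M Λ) (hu : Continuous u)
    (hstate : ∀ t, x t ∈ stateSpace) (h0 : x 0 = x₀)
    (hright : ∀ v, ∃ v' > v, ∀ t ∈ Ioc v v', ∃ R, IsSegment ρ r u k q x v t R)
    (hleft : ∀ v, 0 < v → ∃ s, ∃ R, IsSegment ρ r u k q x s v R) :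
    PathSol ρ r u k q x₀ x := by
  have hcad : IsCadlag x := by
    refine fun t => ⟨?_, ?_⟩
    · obtain ⟨v', hv', h⟩ := hright t
      obtain ⟨R, hR⟩ := h v' ⟨hv', le_rfl⟩
      have h1 := (continuous_flow_right (hb.isVelocity hu k) t (x t)).continuousWithinAt
        (s := Ici t) (x := t)
      refine h1.congr_of_eventuallyEq ?_ (flow_self (hb.isVelocity hu k) t (x t)).symm
      filter_upwards [Ico_mem_nhdsGE hv'] with v hv
      exact hR.eq_flow v hv
    · rcases eq_or_ne t 0 with rfl | ht
      · refine ⟨0, ?_⟩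
        have : 𝓝[<] (0 : ℝ≥0) = ⊥ := by simp
        rw [this]
        exact tendsto_bot
      · obtain ⟨s, R, h⟩ := hleft t (pos_iff_ne_zero.2 ht)
        exact ⟨_, h.tendsto hb hu ⟨h.lt, le_rfl⟩⟩
  have hd : ∀ s t, IntegrableOn (drift ρ u k x) (Ioc s t) leb := fun s t =>
    integrableOn_leb_of_bounded (hb.measurable_drift hu hcad) (C := M) fun v _ => by
      rw [drift_eq_speed, abs_of_nonneg (speed_nonneg _ _)]
      exact hb.speed_le _ _
  have hsolves : ∀ t, SolvesOn ρ r u k q x 0 t := fun T => by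
    refine real_induction (p := fun t => SolvesOn ρ r u k q x 0 t) (T := T) ?_ ?_ ?_ T le_rfl
    · refine ⟨?_, ?_⟩ <;> simp
    · intro t ht _ hs
      obtain ⟨s, R, h⟩ := hleft t ht
      exact (hs s h.lt).trans zero_le h.lt.le hd (h.solvesOn hb hu)
    · intro t _ hs
      obtain ⟨v', hv', h⟩ := hright t
      filter_upwards [Ioo_mem_nhdsGT hv'] with v hv
      obtain ⟨R, hR⟩ := h v ⟨hv.1, hv.2.le⟩
      exact (hs t le_rfl).trans zero_le hv.1.le hd (hR.solvesOn hb hu)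
  exact ⟨hstate, hcad, fun t => hd 0 t, fun t => (hsolves t).1, fun t => h0 ▸ (hsolves t).2⟩

end OnOffNetwork

namespace OnOffNetwork

open Pt

/-! ### Steps that meet at most one point -/

variable {K J : ℕ} {ρ : Rates K J} {r : Fin K → ℝ} {u : ℝ≥0 → Fin J → ℝ≥0} {k : Fin K}
  {L M Λ : ℝ≥0} {q : Measure Pt}

/-- The effect at time `t` of the point `p` alone, for a user in the state `x` at time `s`. -/
noncomputable def kick (ρ : Rates K J) (r : Fin K → ℝ) (u : ℝ≥0 → Fin J → ℝ≥0) (k : Fin K)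
    (s t : ℝ≥0) (x : ℝ) (p : Pt) : ℝ :=
  driftFlow ρ u k p.time t (driftFlow ρ u k s p.time x +
    incr ρ r u k p (driftFlow ρ u k s p.time x)) - driftFlow ρ u k s t x

/-- The state at time `t` for the initial state `x` at time `s`, under the assumption that at most
one of the points acts in between: the effects of all the points are superposed. -/
noncomputable def step (ρ : Rates K J) (r : Fin K → ℝ) (u : ℝ≥0 → Fin J → ℝ≥0) (k : Fin K)
    (q : Measure Pt) (s t : ℝ≥0) (x : ℝ) : ℝ :=
  driftFlow ρ u k s t x + ∫ p in {p | p.time ∈ Ioc s t}, kick ρ r u k s t x p ∂q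

lemma restrict_low_of_zero {R s₀ t₀ s t : ℝ≥0} (hs : s₀ ≤ s) (ht : t ≤ t₀)
    (h : q.restrict {p | p.height ≤ R ∧ p.time ∈ Ioc s₀ t₀} = 0) :
    q.restrict {p | p.height ≤ R ∧ p.time ∈ Ioc s t} = 0 := by
  rw [Measure.restrict_eq_zero] at h ⊢
  exact measure_mono_null (t := {p | p.height ≤ R ∧ p.time ∈ Ioc s₀ t₀})
    (fun p hp => ⟨hp.1, Ioc_subset_Ioc hs ht hp.2⟩) h

lemma restrict_low_of_dirac {R s₀ t₀ s t : ℝ≥0} (hs : s₀ ≤ s) (ht : t ≤ t₀) {p : Pt}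
    (hpR : p.height ≤ R)
    (h : q.restrict {p | p.height ≤ R ∧ p.time ∈ Ioc s₀ t₀} = Measure.dirac p) :
    (p.time ∈ Ioc s t → q.restrict {p | p.height ≤ R ∧ p.time ∈ Ioc s t} = Measure.dirac p) ∧
    (p.time ∉ Ioc s t → q.restrict {p | p.height ≤ R ∧ p.time ∈ Ioc s t} = 0) := by
  classical
  have hm := measurableSet_height_time R (measurableSet_Ioc (a := s) (b := t))
  have hsub : {p : Pt | p.height ≤ R ∧ p.time ∈ Ioc s t} ⊆
      {p | p.height ≤ R ∧ p.time ∈ Ioc s₀ t₀} :=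
    fun p hp => ⟨hp.1, Ioc_subset_Ioc hs ht hp.2⟩
  have h1 := congrArg (fun μ : Measure Pt => μ.restrict {p | p.height ≤ R ∧ p.time ∈ Ioc s t}) h
  rw [Measure.restrict_restrict_of_subset hsub,
    MeasureTheory.restrict_dirac' hm] at h1
  refine ⟨fun hp => ?_, fun hp => ?_⟩
  · rw [h1, if_pos ⟨hpR, hp⟩]
  · rw [h1, if_neg fun h => hp h.2]

section Step

variable (hb : ρ.HasBounds L M Λ) (hu : Continuous u)
include hb hu

lemma driftFlow_self (s : ℝ≥0) (x : ℝ) : driftFlow ρ u k s s x = x :=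
  flow_self (hb.isVelocity hu k) s x

lemma driftFlow_driftFlow {s v t : ℝ≥0} (hsv : s ≤ v) (hvt : v ≤ t) (x : ℝ) :
    driftFlow ρ u k v t (driftFlow ρ u k s v x) = driftFlow ρ u k s t x :=
  flow_flow (hb.isVelocity hu k) hsv hvt x

lemma step_self (s : ℝ≥0) (x : ℝ) : step ρ r u k q s s x = x := by
  simp [step, driftFlow_self hb hu]

lemma step_eq_setIntegral_low {s t R : ℝ≥0} {x : ℝ}
    (hR : ∀ p, p.time ∈ Ioc s t → threshold ρ u k p (driftFlow ρ u k s p.time x) ≤ R) :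
    step ρ r u k q s t x = driftFlow ρ u k s t x +
      ∫ p in {p | p.height ≤ R ∧ p.time ∈ Ioc s t}, kick ρ r u k s t x p ∂q := by
  rw [step]
  congr 1
  refine setIntegral_eq_of_subset_of_forall_sdiff_eq_zero (measurableSet_time measurableSet_Ioc)
    (fun p hp => hp.2) fun p hp => ?_
  have h0 : incr ρ r u k p (driftFlow ρ u k s p.time x) = 0 := by
    refine incr_eq_zero_of_threshold_le ((hR p hp.1).trans ?_)
    by_contra hlt
    exact hp.2 ⟨(not_le.1 hlt).le, hp.1⟩
  rw [kick, h0, add_zero, driftFlow_driftFlow hb hu hp.1.1.le hp.1.2, sub_self]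

lemma step_of_zero {s t R : ℝ≥0} {x : ℝ}
    (hR : ∀ p, p.time ∈ Ioc s t → threshold ρ u k p (driftFlow ρ u k s p.time x) ≤ R)
    (h : q.restrict {p | p.height ≤ R ∧ p.time ∈ Ioc s t} = 0) :
    step ρ r u k q s t x = driftFlow ρ u k s t x := by
  rw [step_eq_setIntegral_low hb hu hR, h, integral_zero_measure, add_zero]

lemma step_of_dirac {s t R : ℝ≥0} {x : ℝ} {p : Pt}
    (hR : ∀ p, p.time ∈ Ioc s t → threshold ρ u k p (driftFlow ρ u k s p.time x) ≤ R)
    (h : q.restrict {p | p.height ≤ R ∧ p.time ∈ Ioc s t} = Measure.dirac p) :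
    step ρ r u k q s t x = driftFlow ρ u k p.time t (driftFlow ρ u k s p.time x +
      incr ρ r u k p (driftFlow ρ u k s p.time x)) := by
  rw [step_eq_setIntegral_low hb hu hR, h, integral_dirac, kick]
  ring

end Step

/-! ### A bound for the states -/

/-- An upper bound for the state at time `t`: the drift and all possible connections are added to
the initial state `x₀`. -/
noncomputable def stateBound (ρ : Rates K J) (u : ℝ≥0 → Fin J → ℝ≥0) (k : Fin K) (M : ℝ≥0)
    (q : Measure Pt) (x₀ : ℝ) (t : ℝ≥0) : ℝ :=
  x₀ + M * t + (∫⁻ p in {p | p.time ∈ Ioc 0 t}, connMass ρ u k p ∂q).toReal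

/-- The states that are possible at time `t`. -/
def Possible (ρ : Rates K J) (u : ℝ≥0 → Fin J → ℝ≥0) (k : Fin K) (M : ℝ≥0) (q : Measure Pt)
    (x₀ : ℝ) (t : ℝ≥0) (x : ℝ) : Prop := x ∈ stateSpace ∧ x ≤ stateBound ρ u k M q x₀ t

variable {x₀ : ℝ} {N : ℝ≥0}

lemma stateBound_add (hfin : ∫⁻ p in {p | p.time ∈ Ioc 0 N}, connMass ρ u k p ∂q < ∞) {s t : ℝ≥0}
    (hst : s ≤ t) (ht : t ≤ N) :
    stateBound ρ u k M q x₀ s + M * (t - s) +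
      (∫⁻ p in {p | p.time ∈ Ioc s t}, connMass ρ u k p ∂q).toReal =
      stateBound ρ u k M q x₀ t := by
  have hle : ∀ a b : ℝ≥0, b ≤ N → ∫⁻ p in {p | p.time ∈ Ioc a b}, connMass ρ u k p ∂q < ∞ :=
    fun a b hbN => (lintegral_mono_set fun p hp =>
      (⟨bot_le.trans_lt hp.1, hp.2.trans hbN⟩ : p.time ∈ Ioc 0 N)).trans_lt hfin
  have hset : {p : Pt | p.time ∈ Ioc 0 t} = {p | p.time ∈ Ioc 0 s} ∪ {p | p.time ∈ Ioc s t} := by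
    rw [← Ioc_union_Ioc_eq_Ioc (zero_le : 0 ≤ s) hst]; rfl
  have hdisj : Disjoint {p : Pt | p.time ∈ Ioc 0 s} {p | p.time ∈ Ioc s t} :=
    (Ioc_disjoint_Ioc_of_le le_rfl).preimage Pt.time
  rw [stateBound, stateBound, hset, lintegral_union (measurableSet_time measurableSet_Ioc) hdisj,
    ENNReal.toReal_add (hle 0 s (hst.trans ht)).ne (hle s t ht).ne]
  ring

/-- Up to a time horizon the connection points of a separated configuration have finite mass. -/
lemma setLIntegral_connMass_lt_top (hb : ρ.HasBounds L M Λ) (hu : Continuous u)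
    (hq : IsSeparated q) (N : ℕ) :
    ∫⁻ p in {p | p.time ∈ Ioc 0 (N : ℝ≥0)}, connMass ρ u k p ∂q < ∞ := by
  obtain ⟨R₀, hR₀⟩ := hb.exists_threshold_le hu k N 0
  obtain ⟨R, hR⟩ := exists_nat_ge R₀
  obtain ⟨j, hj⟩ := hq.cell_le R N
  set W : Fin (N * 2 ^ j) → Set Pt := fun i => {p | p.height ≤ R ∧ p.time ∈ cell j i} with hW
  have hWm : ∀ i, MeasurableSet (W i) := fun i => measurableSet_height_time _ measurableSet_Ioc
  have hzero : ∀ p ∈ {p : Pt | p.time ∈ Ioc 0 (N : ℝ≥0)} \ ⋃ i, W i, connMass ρ u k p = 0 := by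
    intro p hp
    refine if_neg fun hc => hp.2 ?_
    obtain ⟨i, hi, hi'⟩ := exists_mem_cell hp.1.1 j hp.1.2
    refine mem_iUnion.2 ⟨⟨i, hi⟩, ?_, hi'⟩
    have h1 := hR₀ p 0 hp.1.2 (by simp)
    rw [threshold, if_pos hc.1] at h1
    exact (hc.2.le.trans h1).trans hR
  calc ∫⁻ p in {p | p.time ∈ Ioc 0 (N : ℝ≥0)}, connMass ρ u k p ∂q
      ≤ ∫⁻ p in ⋃ i, W i, connMass ρ u k p ∂q := by
        rw [← lintegral_indicator (measurableSet_time measurableSet_Ioc),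
          ← lintegral_indicator (MeasurableSet.iUnion hWm)]
        refine lintegral_mono fun p => ?_
        by_cases h1 : p ∈ ⋃ i, W i
        · rw [indicator_of_mem h1]
          exact indicator_le_self _ _ _
        · refine le_of_eq_of_le ?_ zero_le
          by_cases h2 : p ∈ {p : Pt | p.time ∈ Ioc 0 (N : ℝ≥0)}
          · rw [indicator_of_mem h2]; exact hzero p ⟨h2, h1⟩
          · exact indicator_of_notMem h2 _
    _ ≤ ∑' i, ∫⁻ p in W i, connMass ρ u k p ∂q := lintegral_iUnion_le _ _
    _ = ∑ i, ∫⁻ p in W i, connMass ρ u k p ∂q := tsum_fintype _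
    _ < ∞ := by
        refine ENNReal.sum_lt_top.2 fun i _ => ?_
        rcases hq.restrict_eq_zero_or_dirac (hWm i) (hj i i.2) with h | ⟨p, -, -, h⟩
        · rw [h, lintegral_zero_measure]; exact ENNReal.zero_lt_top
        · rw [h, lintegral_dirac]
          unfold connMass
          split_ifs
          · exact ENNReal.add_lt_top.2 ⟨ENNReal.one_lt_top, ENNReal.coe_lt_top⟩
          · exact ENNReal.zero_lt_top

/-- In the time interval `(s₀, t₀]`, which lies before the time horizon `N`, there is at most one
point that can act on a possible state; `R` bounds the heights of the points that can act on
possible states before time `N`. -/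
structure IsCell (ρ : Rates K J) (u : ℝ≥0 → Fin J → ℝ≥0) (k : Fin K) (M : ℝ≥0) (q : Measure Pt)
    (x₀ : ℝ) (N R s₀ t₀ : ℝ≥0) : Prop where
  le : t₀ ≤ N
  finite : ∫⁻ p in {p | p.time ∈ Ioc 0 N}, connMass ρ u k p ∂q < ∞
  threshold_le : ∀ p x, p.time ≤ N → Possible ρ u k M q x₀ p.time x → threshold ρ u k p x ≤ R
  points : q.restrict {p | p.height ≤ R ∧ p.time ∈ Ioc s₀ t₀} = 0 ∨
    ∃ p ∈ {p : Pt | p.height ≤ R ∧ p.time ∈ Ioc s₀ t₀},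
      q.restrict {p | p.height ≤ R ∧ p.time ∈ Ioc s₀ t₀} = Measure.dirac p

namespace IsCell

variable {R s₀ t₀ s v t : ℝ≥0} {x : ℝ} {y : ℝ≥0 → ℝ}
  (hb : ρ.HasBounds L M Λ) (hu : Continuous u) (hr : r k ∈ Icc (0 : ℝ) 1)
  (hc : IsCell ρ u k M q x₀ N R s₀ t₀)

section

include hb hu hc

lemma possible_driftFlow (hst : s ≤ t) (ht : t ≤ t₀) (hx : Possible ρ u k M q x₀ s x) :
    Possible ρ u k M q x₀ t (driftFlow ρ u k s t x) := by
  refine ⟨flow_mem_stateSpace (hb.isVelocity hu k) hx.1, ?_⟩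
  have h1 := flow_le (hb.isVelocity hu k) hst x
  rw [← stateBound_add hc.finite hst (ht.trans hc.le)]
  have h2 : 0 ≤ (∫⁻ p in {p | p.time ∈ Ioc s t}, connMass ρ u k p ∂q).toReal :=
    ENNReal.toReal_nonneg
  have h3 := hx.2
  unfold driftFlow
  linarith

lemma threshold_driftFlow_le (ht : t ≤ t₀) (hx : Possible ρ u k M q x₀ s x) (p : Pt)
    (hp : p.time ∈ Ioc s t) : threshold ρ u k p (driftFlow ρ u k s p.time x) ≤ R :=
  hc.threshold_le p _ ((hp.2.trans ht).trans hc.le)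
    (hc.possible_driftFlow hb hu hp.1.le (hp.2.trans ht) hx)

/-- In a cell a step either follows the drift or passes through the only point. -/
lemma step_cases : (∀ s t x, s₀ ≤ s → t ≤ t₀ → Possible ρ u k M q x₀ s x →
      step ρ r u k q s t x = driftFlow ρ u k s t x) ∨
    ∃ p : Pt, ∀ s t x, s₀ ≤ s → t ≤ t₀ → Possible ρ u k M q x₀ s x →
      (p.time ∈ Ioc s t → q.restrict {p | p.height ≤ R ∧ p.time ∈ Ioc s t} = Measure.dirac p ∧
        step ρ r u k q s t x = driftFlow ρ u k p.time t (driftFlow ρ u k s p.time x +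
          incr ρ r u k p (driftFlow ρ u k s p.time x))) ∧
      (p.time ∉ Ioc s t → step ρ r u k q s t x = driftFlow ρ u k s t x) := by
  rcases hc.points with h | ⟨p, hp, h⟩
  · exact Or.inl fun s t x hs ht hx => step_of_zero hb hu
      (hc.threshold_driftFlow_le hb hu ht hx) (restrict_low_of_zero hs ht h)
  · refine Or.inr ⟨p, fun s t x hs ht hx => ⟨fun hpt => ?_, fun hpt => ?_⟩⟩
    · have h1 := (restrict_low_of_dirac hs ht hp.1 h).1 hpt
      exact ⟨h1, step_of_dirac hb hu (hc.threshold_driftFlow_le hb hu ht hx) h1⟩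
    · exact step_of_zero hb hu (hc.threshold_driftFlow_le hb hu ht hx)
        ((restrict_low_of_dirac hs ht hp.1 h).2 hpt)

end

include hb hu hr hc

lemma possible_step (hs : s₀ ≤ s) (hst : s ≤ t) (ht : t ≤ t₀) (hx : Possible ρ u k M q x₀ s x) :
    Possible ρ u k M q x₀ t (step ρ r u k q s t x) := by
  rcases hc.step_cases (r := r) hb hu with h | ⟨p, h⟩
  · rw [h s t x hs ht hx]
    exact hc.possible_driftFlow hb hu hst ht hx
  obtain ⟨h1, h2⟩ := h s t x hs ht hx
  by_cases hp : p.time ∈ Ioc s t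
  · obtain ⟨hd, he⟩ := h1 hp
    rw [he]
    have hy := hc.possible_driftFlow hb hu hp.1.le (hp.2.trans ht) hx
    refine ⟨flow_mem_stateSpace (hb.isVelocity hu k) (add_incr_mem_stateSpace hr hy.1), ?_⟩
    have e1 : driftFlow ρ u k p.time t (driftFlow ρ u k s p.time x +
        incr ρ r u k p (driftFlow ρ u k s p.time x)) ≤ _ :=
      flow_le (hb.isVelocity hu k) hp.2 _
    have e2 : driftFlow ρ u k s p.time x ≤ _ := flow_le (hb.isVelocity hu k) hp.1.le x
    -- the point is counted by the integral of the connection masses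
    have e3 : incr ρ r u k p (driftFlow ρ u k s p.time x) ≤
        (∫⁻ p in {p | p.time ∈ Ioc s t}, connMass ρ u k p ∂q).toReal := by
      refine (ENNReal.ofReal_le_iff_le_toReal ?_).1 ?_
      · exact ((lintegral_mono_set fun p hp => (⟨bot_le.trans_lt hp.1,
          hp.2.trans (ht.trans hc.le)⟩ : p.time ∈ Ioc 0 N)).trans_lt hc.finite).ne
      · refine (ofReal_incr_le_connMass hr p _).trans ?_
        calc connMass ρ u k p
            = ∫⁻ p in {p | p.height ≤ R ∧ p.time ∈ Ioc s t}, connMass ρ u k p ∂q := by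
              rw [hd, lintegral_dirac]
          _ ≤ _ := lintegral_mono_set fun p hp => hp.2
    have e4 := stateBound_add (M := M) (x₀ := x₀) hc.finite hst (ht.trans hc.le)
    have e5 := hx.2
    linarith
  · rw [h2 hp]
    exact hc.possible_driftFlow hb hu hst ht hx

/-- Steps inside a cell can be composed. -/
lemma step_step (hs : s₀ ≤ s) (hsv : s ≤ v) (hvt : v ≤ t) (ht : t ≤ t₀)
    (hx : Possible ρ u k M q x₀ s x) :
    step ρ r u k q v t (step ρ r u k q s v x) = step ρ r u k q s t x := by
  have hx' := hc.possible_step hb hu hr hs hsv (hvt.trans ht) hx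
  rcases hc.step_cases (r := r) hb hu with h | ⟨p, h⟩
  · rw [h v t _ (hs.trans hsv) ht hx', h s t x hs ht hx, h s v x hs (hvt.trans ht) hx,
      driftFlow_driftFlow hb hu hsv hvt]
  obtain ⟨h1, h2⟩ := h v t _ (hs.trans hsv) ht hx'
  obtain ⟨h3, h4⟩ := h s t x hs ht hx
  obtain ⟨h5, h6⟩ := h s v x hs (hvt.trans ht) hx
  by_cases hpt : p.time ∈ Ioc s t
  · rw [(h3 hpt).2]
    by_cases hpv : p.time ≤ v
    · rw [h2 fun h => absurd h.1 (not_lt.2 hpv), (h5 ⟨hpt.1, hpv⟩).2,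
        driftFlow_driftFlow hb hu hpv hvt]
    · rw [(h1 ⟨not_le.1 hpv, hpt.2⟩).2, h6 fun h => hpv h.2,
        driftFlow_driftFlow hb hu hsv (not_le.1 hpv).le]
  · rw [h4 hpt, h2 fun h => hpt ⟨hsv.trans_lt h.1, h.2⟩, h6 fun h => hpt ⟨h.1, h.2.trans hvt⟩,
      driftFlow_driftFlow hb hu hsv hvt]

omit hr in
/-- Where a path that evolves by steps in a cell meets no point, it is a segment. -/
lemma isSegment_of_drift (hs : s₀ ≤ s) (hst : s < t) (ht : t ≤ t₀)
    (hx : ∀ v ∈ Icc s₀ t₀, Possible ρ u k M q x₀ v (y v))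
    (hy : ∀ s v, s₀ ≤ s → s ≤ v → v ≤ t₀ → y v = step ρ r u k q s v (y s))
    (h0 : q.restrict {p | p.height ≤ R ∧ p.time ∈ Ioc s t} = 0) :
    IsSegment ρ r u k q y s t R := by
  have hxs := hx s ⟨hs, hst.le.trans ht⟩
  have hflow : ∀ v, s ≤ v → v ≤ t → y v = driftFlow ρ u k s v (y s) := fun v hsv hvt => by
    rw [hy s v hs hsv (hvt.trans ht)]
    exact step_of_zero hb hu (hc.threshold_driftFlow_le hb hu (hvt.trans ht) hxs)
      (restrict_low_of_zero le_rfl hvt h0)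
  exact ⟨hst, fun v hv => hflow v hv.1 hv.2.le, hc.threshold_driftFlow_le hb hu ht hxs,
    Or.inl ⟨h0, hflow t hst.le le_rfl⟩⟩

end IsCell

end OnOffNetwork

namespace OnOffNetwork

open Pt

variable {K J : ℕ} {ρ : Rates K J} {r : Fin K → ℝ} {u : ℝ≥0 → Fin J → ℝ≥0} {k : Fin K}
  {L M Λ : ℝ≥0} {q : Measure Pt} {x₀ : ℝ}

/-! ### Segments in a cell -/

namespace IsCell

variable {N R s₀ t₀ s v t : ℝ≥0} {x : ℝ} {y : ℝ≥0 → ℝ}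
  (hb : ρ.HasBounds L M Λ) (hu : Continuous u)
  (hc : IsCell ρ u k M q x₀ N R s₀ t₀)
  (hx : ∀ v ∈ Icc s₀ t₀, Possible ρ u k M q x₀ v (y v))
  (hy : ∀ s v, s₀ ≤ s → s ≤ v → v ≤ t₀ → y v = step ρ r u k q s v (y s))
include hb hu hc hx hy

lemma exists_isSegment_right (hv : v ∈ Ico s₀ t₀) :
    ∃ v' > v, ∀ t ∈ Ioc v v', ∃ R, IsSegment ρ r u k q y v t R := by
  rcases hc.points with h | ⟨p, hp, h⟩
  · exact ⟨t₀, hv.2, fun t ht => ⟨R, hc.isSegment_of_drift hb hu hv.1 ht.1 ht.2 hx hy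
      (restrict_low_of_zero hv.1 ht.2 h)⟩⟩
  rcases lt_or_ge v p.time with hvp | hvp
  · obtain ⟨v', hv', hv''⟩ := exists_between hvp
    have hv't : v' ≤ t₀ := hv''.le.trans hp.2.2
    exact ⟨v', hv', fun t ht => ⟨R, hc.isSegment_of_drift hb hu hv.1 ht.1 (ht.2.trans hv't) hx hy
      ((restrict_low_of_dirac hv.1 (ht.2.trans hv't) hp.1 h).2
        fun h => absurd (h.2.trans ht.2) (not_le.2 hv''))⟩⟩
  · exact ⟨t₀, hv.2, fun t ht => ⟨R, hc.isSegment_of_drift hb hu hv.1 ht.1 ht.2 hx hy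
      ((restrict_low_of_dirac hv.1 ht.2 hp.1 h).2 fun h => absurd h.1 (not_lt.2 hvp))⟩⟩

lemma exists_isSegment_left (hv : v ∈ Ioc s₀ t₀) : ∃ s, ∃ R, IsSegment ρ r u k q y s v R := by
  rcases hc.points with h | ⟨p, hp, h⟩
  · exact ⟨s₀, R, hc.isSegment_of_drift hb hu le_rfl hv.1 hv.2 hx hy
      (restrict_low_of_zero le_rfl hv.2 h)⟩
  rcases lt_trichotomy p.time v with hpv | hpv | hpv
  · exact ⟨p.time, R, hc.isSegment_of_drift hb hu hp.2.1.le hpv hv.2 hx hy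
      ((restrict_low_of_dirac hp.2.1.le hv.2 hp.1 h).2 fun h => lt_irrefl _ h.1)⟩
  · have hxs := hx s₀ ⟨le_rfl, hv.1.le.trans hv.2⟩
    have hthr := hc.threshold_driftFlow_le hb hu hv.2 hxs
    have hd := (restrict_low_of_dirac le_rfl hv.2 hp.1 h).1 ⟨hp.2.1, hpv.le⟩
    refine ⟨s₀, R, hv.1, fun w hw => ?_, hthr, Or.inr ⟨p, hpv, hd, ?_⟩⟩
    · have hwt : w ≤ t₀ := hw.2.le.trans hv.2
      rw [hy s₀ w le_rfl hw.1 hwt]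
      exact step_of_zero hb hu (hc.threshold_driftFlow_le hb hu hwt hxs)
        ((restrict_low_of_dirac le_rfl hwt hp.1 h).2
          fun h => absurd (hpv ▸ h.2) (not_le.2 hw.2))
    · rw [hy s₀ v le_rfl hv.1.le hv.2, step_of_dirac hb hu hthr hd, hpv, driftFlow_self hb hu]
  · exact ⟨s₀, R, hc.isSegment_of_drift hb hu le_rfl hv.1 hv.2 hx hy
      ((restrict_low_of_dirac le_rfl hv.2 hp.1 h).2 fun h => absurd h.2 (not_le.2 hpv))⟩

end IsCell

/-! ### The grid scheme -/

section Scheme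

variable (S : ℝ≥0 → ℝ≥0 → ℝ → ℝ) (x₀ : ℝ)

/-- The states at the points of the grid of mesh `2^{-j}`, for the one-step evolution `S`. -/
noncomputable def gridState (j : ℕ) : ℕ → ℝ
  | 0 => x₀
  | i + 1 => S ((i : ℝ≥0) / 2 ^ j) ((i + 1 : ℕ) / 2 ^ j) (gridState j i)

/-- The state at time `t`: one more step is made from the last grid point before `t`. -/
noncomputable def scheme (j : ℕ) (t : ℝ≥0) : ℝ :=
  S (gridBefore j t) t (gridState S x₀ j (⌈t * 2 ^ j⌉₊ - 1))

variable {S x₀} {j N : ℕ}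

lemma ceil_sub_one_of_mem_cell {i : ℕ} {t : ℝ≥0} (ht : t ∈ cell j i) :
    ⌈t * 2 ^ j⌉₊ - 1 = i := by
  have h2 : (0 : ℝ≥0) < 2 ^ j := by positivity
  have h1 : i < ⌈t * 2 ^ j⌉₊ := Nat.lt_ceil.2 ((div_lt_iff₀ h2).1 ht.1)
  have h3 : ⌈t * 2 ^ j⌉₊ ≤ i + 1 := Nat.ceil_le.2 ((le_div_iff₀ h2).1 ht.2)
  omega

lemma scheme_of_mem_cell {i : ℕ} {t : ℝ≥0} (ht : t ∈ cell j i) :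
    scheme S x₀ j t = S ((i : ℝ≥0) / 2 ^ j) t (gridState S x₀ j i) := by
  rw [scheme, gridBefore, ceil_sub_one_of_mem_cell ht]

lemma grid_lt (j i : ℕ) : (i : ℝ≥0) / 2 ^ j < (i + 1 : ℕ) / 2 ^ j := by
  gcongr
  exact_mod_cast Nat.lt_succ_self i

lemma scheme_zero (hS : ∀ s x, S s s x = x) : scheme S x₀ j 0 = x₀ := by
  simp [scheme, gridBefore, hS, gridState]

lemma scheme_grid (hS : ∀ s x, S s s x = x) (i : ℕ) :
    scheme S x₀ j ((i : ℝ≥0) / 2 ^ j) = gridState S x₀ j i := by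
  cases i with
  | zero => rw [Nat.cast_zero, zero_div, scheme_zero hS, gridState]
  | succ i => rw [scheme_of_mem_cell ⟨grid_lt j i, le_rfl⟩, gridState]

/-- On each closed cell the scheme is one step away from the left end. -/
lemma scheme_of_mem_Icc (hS : ∀ s x, S s s x = x) {i : ℕ} {t : ℝ≥0} (h1 : (i : ℝ≥0) / 2 ^ j ≤ t)
    (h2 : t ≤ (i + 1 : ℕ) / 2 ^ j) :
    scheme S x₀ j t = S ((i : ℝ≥0) / 2 ^ j) t (gridState S x₀ j i) := by
  rcases h1.eq_or_lt with rfl | h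
  · rw [scheme_grid hS, hS]
  · exact scheme_of_mem_cell ⟨h, h2⟩

/-- If steps can be composed inside the cells, then the scheme evolves by steps there. -/
lemma scheme_eq_step {A : ℝ≥0 → ℝ → Prop} (hS : ∀ s x, S s s x = x) (h0 : A 0 x₀)
    (hA : ∀ i < N * 2 ^ j, ∀ s t x, (i : ℝ≥0) / 2 ^ j ≤ s → s ≤ t → t ≤ (i + 1 : ℕ) / 2 ^ j →
      A s x → A t (S s t x))
    (hSS : ∀ i < N * 2 ^ j, ∀ s v t x, (i : ℝ≥0) / 2 ^ j ≤ s → s ≤ v → v ≤ t →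
      t ≤ (i + 1 : ℕ) / 2 ^ j → A s x → S v t (S s v x) = S s t x) :
    ∀ i < N * 2 ^ j, ∀ s t, (i : ℝ≥0) / 2 ^ j ≤ s → s ≤ t → t ≤ (i + 1 : ℕ) / 2 ^ j →
      A s (scheme S x₀ j s) ∧ scheme S x₀ j t = S s t (scheme S x₀ j s) := by
  have hgrid : ∀ i ≤ N * 2 ^ j, A ((i : ℝ≥0) / 2 ^ j) (gridState S x₀ j i) := fun i => by
    induction i with
    | zero => intro _; rwa [Nat.cast_zero, zero_div, gridState]
    | succ i ih =>
      intro hi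
      exact hA i hi _ _ _ le_rfl (grid_lt j i).le le_rfl (ih (Nat.le_of_succ_le hi))
  intro i hi s t hs hst ht
  have hAi := hgrid i hi.le
  rw [scheme_of_mem_Icc hS hs (hst.trans ht), scheme_of_mem_Icc hS (hs.trans hst) ht]
  exact ⟨hA i hi _ _ _ le_rfl hs (hst.trans ht) hAi,
    (hSS i hi _ _ _ _ le_rfl hs hst ht hAi).symm⟩

/-- A path that evolves by steps in the cells is reproduced by the scheme. -/
lemma scheme_eq_of_step {x : ℝ≥0 → ℝ} (h0 : x 0 = x₀) (hS : ∀ s x, S s s x = x)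
    (hx : ∀ i < N * 2 ^ j, ∀ s t, (i : ℝ≥0) / 2 ^ j ≤ s → s ≤ t → t ≤ (i + 1 : ℕ) / 2 ^ j →
      x t = S s t (x s)) {t : ℝ≥0} (ht : t ≤ N) : scheme S x₀ j t = x t := by
  have hgrid : ∀ i ≤ N * 2 ^ j, gridState S x₀ j i = x ((i : ℝ≥0) / 2 ^ j) := fun i => by
    induction i with
    | zero => intro _; rw [Nat.cast_zero, zero_div, gridState, h0]
    | succ i ih =>
      intro hi
      rw [gridState, ih (Nat.le_of_succ_le hi)]
      exact (hx i hi _ _ le_rfl (grid_lt j i).le le_rfl).symm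
  rcases eq_or_ne t 0 with rfl | ht0
  · rw [scheme_zero hS, h0]
  obtain ⟨i, hi, hi'⟩ := exists_mem_cell (pos_iff_ne_zero.2 ht0) j ht
  rw [scheme_of_mem_cell hi', hgrid i hi.le]
  exact (hx i hi _ _ le_rfl hi'.1.le hi'.2).symm

/-- A cell of a grid is contained in one of each coarser grid. -/
lemma exists_cell_subset {j₀ : ℕ} (hj : j₀ ≤ j) {i : ℕ} (hi : i < N * 2 ^ j) :
    ∃ i₀ < N * 2 ^ j₀, (i₀ : ℝ≥0) / 2 ^ j₀ ≤ (i : ℝ≥0) / 2 ^ j ∧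
      ((i + 1 : ℕ) : ℝ≥0) / 2 ^ j ≤ (i₀ + 1 : ℕ) / 2 ^ j₀ := by
  obtain ⟨d, rfl⟩ := Nat.exists_eq_add_of_le hj
  have hd : 0 < 2 ^ d := by positivity
  have h2 : (0 : ℝ≥0) < 2 ^ j₀ := by positivity
  have h2d : (0 : ℝ≥0) < 2 ^ (j₀ + d) := by positivity
  refine ⟨i / 2 ^ d, ?_, ?_, ?_⟩
  · rw [Nat.div_lt_iff_lt_mul hd, mul_assoc, ← pow_add]; exact hi
  · rw [div_le_div_iff₀ h2 h2d, pow_add]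
    have : i / 2 ^ d * 2 ^ d ≤ i := Nat.div_mul_le_self _ _
    have h : ((i / 2 ^ d : ℕ) : ℝ≥0) * 2 ^ d ≤ i := by exact_mod_cast this
    calc ((i / 2 ^ d : ℕ) : ℝ≥0) * (2 ^ j₀ * 2 ^ d) = ((i / 2 ^ d : ℕ) : ℝ≥0) * 2 ^ d * 2 ^ j₀ := by
          ring
      _ ≤ _ := by gcongr
  · rw [div_le_div_iff₀ h2d h2, pow_add]
    have : i + 1 ≤ (i / 2 ^ d + 1) * 2 ^ d := Nat.lt_succ_iff.1 (by
      have := Nat.lt_div_mul_add (a := i) hd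
      rw [add_mul, one_mul]; omega)
    have h : ((i + 1 : ℕ) : ℝ≥0) ≤ ((i / 2 ^ d + 1 : ℕ) : ℝ≥0) * 2 ^ d := by exact_mod_cast this
    calc ((i + 1 : ℕ) : ℝ≥0) * 2 ^ j₀ ≤ ((i / 2 ^ d + 1 : ℕ) : ℝ≥0) * 2 ^ d * 2 ^ j₀ := by gcongr
      _ = _ := by ring

end Scheme

/-! ### Existence along one path -/

section Existence

variable (hb : ρ.HasBounds L M Λ) (hu : Continuous u) (hr : r k ∈ Icc (0 : ℝ) 1)
  (hq : IsSeparated q) (hx₀ : x₀ ∈ stateSpace)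
include hb hu hq hx₀

lemma exists_isCell (N : ℕ) : ∃ (R : ℝ≥0) (j : ℕ), ∀ i < N * 2 ^ j,
    IsCell ρ u k M q x₀ N R ((i : ℝ≥0) / 2 ^ j) ((i + 1 : ℕ) / 2 ^ j) := by
  have hfin := setLIntegral_connMass_lt_top (k := k) hb hu hq N
  obtain ⟨R₀, hR₀⟩ := hb.exists_threshold_le hu k N (stateBound ρ u k M q x₀ N + 2)
  obtain ⟨R, hR⟩ := exists_nat_ge R₀
  obtain ⟨j, hj⟩ := hq.cell_le R N
  have h2 : (0 : ℝ≥0) < 2 ^ j := by positivity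
  refine ⟨R, j, fun i hi => ⟨?_, hfin, fun p x hp hx => ?_, ?_⟩⟩
  · rw [div_le_iff₀ h2]
    exact_mod_cast hi
  · refine (hR₀ p x hp ?_).trans hR
    have h1 := neg_one_le_of_mem_stateSpace hx.1
    have h3 := neg_one_le_of_mem_stateSpace hx₀
    have h4 := stateBound_add (M := M) (x₀ := x₀) hfin hp le_rfl
    have h5 : 0 ≤ (∫⁻ p' in {p' | p'.time ∈ Ioc p.time N}, connMass ρ u k p' ∂q).toReal :=
      ENNReal.toReal_nonneg
    have h6 : 0 ≤ (M : ℝ) * (N - p.time) := mul_nonneg M.coe_nonneg (sub_nonneg.2 hp)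
    have h7 := hx.2
    rw [abs_le]
    push_cast at h4 ⊢
    constructor <;> linarith
  · rcases hq.restrict_eq_zero_or_dirac (measurableSet_height_time R measurableSet_Ioc) (hj i hi)
      with h | ⟨p, hp, -, h⟩
    · exact Or.inl h
    · exact Or.inr ⟨p, hp, h⟩

include hr

/-- The grid scheme becomes stationary as the mesh decreases, and its limit solves the
equation. -/
theorem exists_pathSol : ∃ x, PathSol ρ r u k q x₀ x ∧
    ∀ t, ∀ᶠ j in atTop, scheme (step ρ r u k q) x₀ j t = x t := by
  -- on `[0, N]` the grid of mesh `2^{-j N}` consists of cells, and so do all finer grids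
  choose R j hcell using exists_isCell (k := k) (M := M) hb hu hq hx₀
  have hS : ∀ s x, step ρ r u k q s s x = x := step_self hb hu
  have h0 : Possible ρ u k M q x₀ 0 x₀ := ⟨hx₀, by simp [stateBound]⟩
  set y : ℕ → ℝ≥0 → ℝ := fun N => scheme (step ρ r u k q) x₀ (j N) with hy
  have hstep : ∀ N, ∀ i < N * 2 ^ j N, ∀ s t, (i : ℝ≥0) / 2 ^ j N ≤ s → s ≤ t →
      t ≤ (i + 1 : ℕ) / 2 ^ j N →
      Possible ρ u k M q x₀ s (y N s) ∧ y N t = step ρ r u k q s t (y N s) := fun N =>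
    scheme_eq_step hS h0
      (fun i hi s t x hs hst ht hx => (hcell N i hi).possible_step hb hu hr hs hst ht hx)
      (fun i hi s v t x hs hsv hvt ht hx => (hcell N i hi).step_step hb hu hr hs hsv hvt ht hx)
  have hstable : ∀ N, ∀ j' ≥ j N, ∀ t ≤ (N : ℝ≥0), scheme (step ρ r u k q) x₀ j' t = y N t := by
    intro N j' hj' t ht
    refine scheme_eq_of_step (scheme_zero hS) hS (fun i hi s t hs hst ht => ?_) ht
    obtain ⟨i₀, hi₀, h1, h2⟩ := exists_cell_subset hj' hi
    exact (hstep N i₀ hi₀ s t (h1.trans hs) hst (ht.trans h2)).2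
  have hagree : ∀ N N' : ℕ, ∀ t ≤ (N : ℝ≥0), t ≤ (N' : ℝ≥0) → y N t = y N' t :=
      fun N N' t ht ht' => by
    rw [← hstable N _ (le_max_left (j N) (j N')) t ht,
      hstable N' _ (le_max_right (j N) (j N')) t ht']
  set x : ℝ≥0 → ℝ := fun t => y (⌈t⌉₊) t with hx
  have hxy : ∀ N : ℕ, ∀ t ≤ (N : ℝ≥0), x t = y N t := fun N t ht =>
    hagree _ _ t (Nat.le_ceil t) ht
  have hxstep : ∀ N, ∀ i < N * 2 ^ j N, ∀ s t, (i : ℝ≥0) / 2 ^ j N ≤ s → s ≤ t →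
      t ≤ (i + 1 : ℕ) / 2 ^ j N →
      Possible ρ u k M q x₀ s (x s) ∧ x t = step ρ r u k q s t (x s) := by
    intro N i hi s t hs hst ht
    have htN := ht.trans (hcell N i hi).le
    rw [hxy N s (hst.trans htN), hxy N t htN]
    exact hstep N i hi s t hs hst ht
  -- each time lies in a cell that extends to the right of it
  have hfind : ∀ t : ℝ≥0, ∃ N, ∃ i < N * 2 ^ j N,
      t ∈ Ico ((i : ℝ≥0) / 2 ^ j N) ((i + 1 : ℕ) / 2 ^ j N) := fun t => by
    have h2 : (0 : ℝ≥0) < 2 ^ j (⌊t⌋₊ + 1) := by positivity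
    refine ⟨⌊t⌋₊ + 1, ⌊t * 2 ^ j (⌊t⌋₊ + 1)⌋₊, ?_, ?_, ?_⟩
    · rw [Nat.floor_lt zero_le]
      push_cast
      gcongr
      exact Nat.lt_floor_add_one t
    · rw [div_le_iff₀ h2]
      exact Nat.floor_le zero_le
    · rw [lt_div_iff₀ h2]
      push_cast
      exact Nat.lt_floor_add_one _
  refine ⟨x, pathSol_of_isSegment hb hu (fun t => ?_) ?_ (fun v => ?_) (fun v hv => ?_),
    fun t => ?_⟩
  · obtain ⟨N, i, hi, ht⟩ := hfind t
    exact (hxstep N i hi t t ht.1 le_rfl ht.2.le).1.1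
  · exact scheme_zero hS
  · obtain ⟨N, i, hi, hv⟩ := hfind v
    exact (hcell N i hi).exists_isSegment_right hb hu
      (fun s hs => (hxstep N i hi s s hs.1 le_rfl hs.2).1)
      (fun s t hs hst ht => (hxstep N i hi s t hs hst ht).2) hv
  · obtain ⟨i, hi, hv'⟩ := exists_mem_cell hv (j ⌈v⌉₊) (Nat.le_ceil v)
    exact (hcell _ i hi).exists_isSegment_left hb hu
      (fun s hs => (hxstep _ i hi s s hs.1 le_rfl hs.2).1)
      (fun s t hs hst ht => (hxstep _ i hi s t hs hst ht).2) hv'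
  · filter_upwards [eventually_ge_atTop (j ⌈t⌉₊)] with j' hj'
    exact hstable _ j' hj' t (Nat.le_ceil t)

end Existence

end OnOffNetwork

namespace OnOffNetwork

open Pt

/-! ### Adaptedness and existence -/

variable {K J : ℕ} {ρ : Rates K J} {r : Fin K → ℝ} {u : ℝ≥0 → Fin J → ℝ≥0} {k : Fin K}
  {L M Λ : ℝ≥0}

lemma Rates.HasBounds.measurable_incr (hb : ρ.HasBounds L M Λ) (hu : Continuous u)
    (r : Fin K → ℝ) (k : Fin K) : Measurable fun z : ℝ × Pt => incr ρ r u k z.2 z.1 := by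
  have hk : ∀ i, MeasurableSet {z : ℝ × Pt | z.2.1 = i} := fun i =>
    measurable_snd (measurableSet_kind i)
  refine Measurable.ite (hb.measurableSet_acts hu k) ?_ measurable_const
  refine Measurable.ite (hk 0) (by fun_prop) (Measurable.ite (hk 1) (by fun_prop) (by fun_prop))

lemma Rates.HasBounds.measurable_kick (hb : ρ.HasBounds L M Λ) (hu : Continuous u)
    (r : Fin K → ℝ) (k : Fin K) (s t : ℝ≥0) :
    Measurable fun z : ℝ × Pt => kick ρ r u k s t z.1 z.2 := by
  have hw := hb.isVelocity hu k
  have hT : Measurable fun z : ℝ × Pt => z.2.time := measurable_time.comp measurable_snd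
  have h1 : Measurable fun z : ℝ × Pt => driftFlow ρ u k s z.2.time z.1 :=
    (measurable_flow_right hw s).comp (hT.prodMk measurable_fst)
  have h2 : Measurable fun z : ℝ × Pt => incr ρ r u k z.2 (driftFlow ρ u k s z.2.time z.1) :=
    (hb.measurable_incr hu r k).comp (h1.prodMk measurable_snd)
  have h3 : Measurable fun z : ℝ × Pt => driftFlow ρ u k z.2.time t
      (driftFlow ρ u k s z.2.time z.1 + incr ρ r u k z.2 (driftFlow ρ u k s z.2.time z.1)) :=
    (measurable_flow_left hw t).comp (hT.prodMk (h1.add h2))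
  exact h3.sub ((measurable_flow hw s t).comp measurable_fst)

variable {Ω : Type*} {H : MeasurableSpace Ω} [mΩ : MeasurableSpace Ω] {P : Measure Ω}
  {F : ℝ≥0 → MeasurableSpace Ω} {Q : Ω → Measure Pt} {ν : Measure Pt}

section Adapted

variable (hC : HasCompensator F time box Q ν P) (hb : ρ.HasBounds L M Λ) (hu : Continuous u)
include hC hb hu

/-- A step from an adapted state, driven by the points up to its final time, is adapted. -/
lemma measurable_step_cutoff {s t : ℝ≥0} (hst : s ≤ t) {Z : Ω → ℝ} (hZ : Measurable[F s] Z) :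
    Measurable[F t] fun ω => step ρ r u k (cutoff time box Q t ω) s t (Z ω) := by
  have hZt : Measurable[F t] Z := hZ.mono (hC.mono hst) le_rfl
  have hflow : Measurable[F t] fun ω => driftFlow ρ u k s t (Z ω) :=
    (measurable_flow (hb.isVelocity hu k) s t).comp hZt
  have hm : MeasurableSet {p : Pt | p.time ∈ Ioc s t} := measurableSet_time measurableSet_Ioc
  have hkick : Measurable[@Prod.instMeasurableSpace Ω Pt (F t) _]
      fun z : Ω × Pt => kick ρ r u k s t (Z z.1) z.2 := by
    have hfst : Measurable[@Prod.instMeasurableSpace Ω Pt (F t) _] fun z : Ω × Pt => Z z.1 :=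
      hZt.comp (@measurable_fst Ω Pt (F t) _)
    exact (hb.measurable_kick hu r k s t).comp
      (hfst.prodMk (@measurable_snd Ω Pt (F t) _))
  have hind : Measurable[@Prod.instMeasurableSpace Ω Pt (F t) _]
      (Prod.snd ⁻¹' {p : Pt | p.time ∈ Ioc s t} |>.indicator
        fun z : Ω × Pt => kick ρ r u k s t (Z z.1) z.2) :=
    hkick.indicator (@measurable_snd Ω Pt (F t) _ _ hm)
  have hint := hC.stronglyMeasurable_integral_cutoff (t := t)
    (f := fun ω p => ({p : Pt | p.time ∈ Ioc s t}.indicator (kick ρ r u k s t (Z ω)) p))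
    hind.stronglyMeasurable
  have he : ∀ ω, step ρ r u k (cutoff time box Q t ω) s t (Z ω) = driftFlow ρ u k s t (Z ω) +
      ∫ p, {p : Pt | p.time ∈ Ioc s t}.indicator (kick ρ r u k s t (Z ω)) p
        ∂cutoff time box Q t ω := fun ω => by rw [step, integral_indicator hm]
  simp_rw [he]
  exact hflow.add hint.measurable

lemma measurable_gridState_cutoff {X₀ : Ω → ℝ} (hX₀ : Measurable[F 0] X₀) (j i : ℕ) :
    Measurable[F ((i : ℝ≥0) / 2 ^ j)] fun ω =>
      gridState (fun s t => step ρ r u k (cutoff time box Q t ω) s t) (X₀ ω) j i := by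
  induction i with
  | zero =>
    rw [Nat.cast_zero, zero_div]
    exact hX₀
  | succ i ih => exact measurable_step_cutoff hC hb hu (grid_lt j i).le ih

lemma measurable_scheme_cutoff {X₀ : Ω → ℝ} (hX₀ : Measurable[F 0] X₀) (j : ℕ) (t : ℝ≥0) :
    Measurable[F t] fun ω =>
      scheme (fun s t => step ρ r u k (cutoff time box Q t ω) s t) (X₀ ω) j t := by
  have hle : gridBefore j t ≤ t := by
    rcases eq_or_ne t 0 with rfl | ht
    · simp [gridBefore]
    · exact (gridBefore_lt (pos_iff_ne_zero.2 ht)).le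
  exact measurable_step_cutoff hC hb hu hle (measurable_gridState_cutoff hC hb hu hX₀ j _)

omit hb hu in
/-- Almost surely the cutoff does not affect the steps. -/
lemma ae_step_cutoff_eq [IsFiniteMeasure P] : ∀ᵐ ω ∂P,
    (fun s t => step ρ r u k (cutoff time box Q t ω) s t) = step ρ r u k (Q ω) := by
  filter_upwards [hC.ae_box_lt_top] with ω hω
  funext s t x
  have hsub : {p : Pt | p.time ∈ Ioc s t} ⊆ {p | p.time ≤ t} := fun p hp => hp.2
  rw [step, step, cutoff_eq hω, Measure.restrict_restrict_of_subset hsub]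

/-- Existence for one user. The schemes are adapted for every mesh, and almost surely they converge;
the upper limit is measurable without a completion of the σ-algebras. -/
theorem exists_adapted_pathSol [IsFiniteMeasure P] (hsep : ∀ᵐ ω ∂P, IsSeparated (Q ω))
    (hr : r k ∈ Icc (0 : ℝ) 1) {X₀ : Ω → ℝ} (hX₀ : Measurable[F 0] X₀)
    (hX₀s : ∀ ω, X₀ ω ∈ stateSpace) :
    ∃ X : ℝ≥0 → Ω → ℝ, (∀ t, Measurable[F t] (X t)) ∧
      ∀ᵐ ω ∂P, PathSol ρ r u k (Q ω) (X₀ ω) fun t => X t ω := by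
  refine ⟨fun t ω => limsup (fun j =>
    scheme (fun s t => step ρ r u k (cutoff time box Q t ω) s t) (X₀ ω) j t) atTop,
    fun t => Measurable.limsup fun j => measurable_scheme_cutoff hC hb hu hX₀ j t, ?_⟩
  filter_upwards [hsep, ae_step_cutoff_eq (ρ := ρ) (r := r) (u := u) (k := k) hC] with ω hq hω
  obtain ⟨x, hx, hlim⟩ := exists_pathSol hb hu hr hq (hX₀s ω)
  have : (fun t => limsup (fun j => scheme (fun s t => step ρ r u k (cutoff time box Q t ω) s t)
      (X₀ ω) j t) atTop) = x := funext fun t => by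
    rw [hω]
    exact (tendsto_const_nhds.congr' ((hlim t).mono fun j hj => hj.symm)).limsup_eq
  rwa [this]

end Adapted

/-- Existence of a solution: the users are treated one by one. -/
theorem exists_isSolution [IsProbabilityMeasure P] {η : Noise K Ω}
    {α : Fin K → Measure ℝ≥0} (hα : ∀ k, IsProbabilityMeasure (α k)) (hb : ρ.HasBounds L M Λ)
    (hr : ∀ k, r k ∈ Icc (0 : ℝ) 1) (hη : η.IsPoisson α P) (hH : H ≤ mΩ)
    (hHη : Indep H η.sigma P) (hu : Continuous u) {X₀ : Ω → Fin K → ℝ}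
    (hX₀ : Measurable[H] X₀) (hX₀s : ∀ ω k, X₀ ω k ∈ stateSpace) :
    ∃ X, IsSolution H P ρ r η u X₀ X := by
  have hH0 : H ≤ filt H η 0 := le_sup_left
  have h := fun k => exists_adapted_pathSol (k := k) (hη.hasCompensator hα hH hHη k) hb hu
    (hη.ae_isSeparated hα k) (hr k) (X₀ := fun ω => X₀ ω k)
    (((measurable_pi_apply k).comp hX₀).mono hH0 le_rfl) fun ω => hX₀s ω k
  choose X hXm hX using h
  have hm : ∀ t, Measurable[filt H η t] fun ω k => X k t ω := fun t =>
    @measurable_pi_lambda _ _ _ (filt H η t) _ _ fun k => hXm k t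
  refine ⟨fun t ω k => X k t ω, isSolution_of_ae_pathSol
    (fun t => (hm t).mono (hη.filt_le_self hH t) le_rfl)
    (fun t => ((hm t).stronglyMeasurable).aestronglyMeasurable) ?_⟩
  exact ae_all_iff.2 hX

end OnOffNetwork

theorem mainTheorem7 {K J : ℕ} (ρ : OnOffNetwork.Rates K J) (hρ : ρ.IsRegular)
    (m : Fin K → ℝ≥0) :
    ∃ A : ℝ≥0, ∀ (r : Fin K → ℝ) (α : Fin K → Measure ℝ≥0) (Ω : Type*)
      (H : MeasurableSpace Ω) [mΩ : MeasurableSpace Ω]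
      (P : Measure Ω) [IsProbabilityMeasure P] (η : OnOffNetwork.Noise K Ω),
      (∀ k, r k ∈ Icc (0 : ℝ) 1) →
      (∀ k, IsProbabilityMeasure (α k)) →
      (∀ k, ∫⁻ w, (w : ℝ≥0∞) ∂(α k) = m k) →
      η.IsPoisson α P →
      -- `H` is the information at time `0`, for instance that of the two initial values
      H ≤ mΩ → Indep H η.sigma P →
      -- existence of a solution
      (∀ (u : ℝ≥0 → Fin J → ℝ≥0) (X₀ : Ω → Fin K → ℝ), Continuous u → Measurable[H] X₀ →
        (∀ ω k, X₀ ω k ∈ OnOffNetwork.stateSpace) →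
        ∃ X, OnOffNetwork.IsSolution H P ρ r η u X₀ X) ∧
      -- the estimate for any two solutions (it contains uniqueness)
      (∀ (u u' : ℝ≥0 → Fin J → ℝ≥0) (X₀ X₀' : Ω → Fin K → ℝ) (X X' : ℝ≥0 → Ω → Fin K → ℝ),
        Continuous u → Continuous u' → Measurable[H] X₀ → Measurable[H] X₀' →
        (∀ ω k, X₀ ω k ∈ OnOffNetwork.stateSpace) →
        (∀ ω k, X₀' ω k ∈ OnOffNetwork.stateSpace) →
        OnOffNetwork.IsSolution H P ρ r η u X₀ X →
        OnOffNetwork.IsSolution H P ρ r η u' X₀' X' →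
        ∀ t : ℝ≥0, ∀ᵐ ω ∂P,
          condLExp (MeasurableSpace.comap (fun ω => (X₀ ω, X₀' ω)) inferInstance) P
              (fun ω => OnOffNetwork.supNorm (fun s => X s ω - X' s ω) t) ω ≤
            ENNReal.ofReal
              ((‖X₀ ω - X₀' ω‖ +
                  ∫ s in Ioc 0 t, OnOffNetwork.rateC A u (X₀ ω) (X₀' ω) s *
                    (OnOffNetwork.supNorm (OnOffNetwork.realPath u - OnOffNetwork.realPath u')
                      s).toReal ∂OnOffNetwork.leb) *
                Real.exp (t * OnOffNetwork.rateC A u (X₀ ω) (X₀' ω) t))) := by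
  obtain ⟨L, M, Λ, hb⟩ := hρ.exists_hasBounds
  refine ⟨OnOffNetwork.rateConst K L M Λ (∑ k, m k), ?_⟩
  intro r α Ω H mΩ P _ η hr hα hm hη hH hHη
  refine ⟨fun u X₀ hu hX₀ hX₀s =>
    OnOffNetwork.exists_isSolution hα hb hr hη hH hHη hu hX₀ hX₀s, ?_⟩
  intro u u' X₀ X₀' X X' hu hu' hX₀ hX₀' _ _ hX hX' t
  filter_upwards [OnOffNetwork.condLExp_supNorm_le hb hr hm hη hH hHη hu hu' hX₀ hX₀' hX hX' t]
    with ω hω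
  exact hω.trans (ENNReal.ofReal_le_ofReal
    (OnOffNetwork.expectedBound_le hu hu' _ t (X₀ ω) (X₀' ω)))
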